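/- Let $f:\mathbf P^1\to\mathbf P^1$ be a rational map of degree $d\ge 2$ and let $F:\mathbf C^2\to\mathbf C^2$ be a lift of $f$, i.e. a homogeneous polynomial map of degree $d$ with $F^{-1}(0)=\{0\}$ and $\pi\circ F=f\circ\pi$, where $\pi:\mathbf C^2\setminus\{0\}\to\mathbf P^1$ is the canonical projection. Let $\|\cdot\|$ be the Hermitian norm on $\mathbf C^2$, normalize $dd^c=\frac{i}{\pi}\partial\bar\partial$, and let $\omega$ be the Fubini--Study form, $\pi^*\omega=dd^c\log\|\cdot\|$, so that $\int_{\mathbf P^1}\omega=1$. Put - $G_F(z)=\lim_n d^{-n}\log\|F^n(z)\|$ for $z\neq0$, and $g_F\circ\pi=G_F-\log\|\cdot\|$ on $\mathbf C^2\setminus\{0\}$; - $\mu_f=dd^cg_F+\omega$, the Green measure of $f$, and $L(f)=\int_{\mathbf P^1}\log\|f'\|\,\mu_f$, the Lyapunov exponent of $f$ with respect to $\mu_f$, where $\|f'\|$ is the norm of the differential in the Fubini--Study metric; - $\|J_F\|_0\circ\pi(z)=e^{-2(d-1)\log\|z\|}\,|\det F'(z)|$, the canonical norm of the section $J_F$ of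 $\mathcal O_{\mathbf P^1}(2(d-1))$ induced by $\det F'$, and $[C_f]$ the current of integration on the zero divisor of $J_F$, i.e. the sum of the Dirac masses at the critical points of $f$ counted with multiplicity; - $m=(dd^c\log^+\|\cdot\|)^2$, a probability measure on $\mathbf C^2$ supported by the unit sphere; - $a\wedge b=a_1b_2-a_2b_1$ for $a,b\in\mathbf C^2$. Then the measures $\mu_f$ and $m$ are well defined, the integrals below converge, and: (i) $\displaystyle L(f)+\log d=\int_{\mathbf P^1}g_F\,[C_f]-2(d-1)\int_{\mathbf P^1}g_F(\mu_f+\omega)+\int_{\mathbf P^1}\log\|J_F\|_0\,\omega.$ (ii) $\displaystyle L(f)+\log d=\int_{\mathbf P^1}g_F\,[C_f]-2(d-1)\int_{\mathbf P^1}g_F(\mu_f+\omega)+\int_{\mathbf C^2}\log|\det F'|\,m.$ (iii) If $\tilde c_1,\dots,\tilde c_{2d-2}\in\mathbf C^2$ are such that $\det F'(z)=\prod_{j=1}^{2d-2}\tilde c_j\wedge z$ for all $z\in\mathbf C^2$, then $$L(f)+\log d=\sum_{j=1}^{2d-2}G_F(\tilde c_j)-(d-1)\Big(1+2\int_{\mathbf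 P^1}g_F(\mu_f+\omega)\Big).$$ -/

import Mathlib

open MeasureTheory Filter Topology
open scoped ContDiff ENNReal LinearAlgebra.Projectivization ComplexConjugate Laplacian

noncomputable section

namespace RatLyap

/-! ### The spaces `ℂ²` (with its Hermitian norm) and `P¹` -/

/-- `ℂ²` with its standard Hermitian norm. -/
abbrev C2 : Type := EuclideanSpace ℂ (Fin 2)

/-- The complex projective line, with the quotient topology and its Borel σ-algebra. -/
abbrev P1 : Type := ℙ ℂ C2

instance instTopologicalSpaceP1 : TopologicalSpace P1 :=
  TopologicalSpace.coinduced (Projectivization.mk' ℂ : { v : C2 // v ≠ 0 } → P1) inferInstance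

instance instMeasurableSpaceP1 : MeasurableSpace P1 := borel P1

instance instBorelSpaceP1 : BorelSpace P1 := ⟨rfl⟩

/-- `(1, z)` for `i = 0` and `(z, 1)` for `i = 1`. -/
def affineVec (i : Fin 2) (z : ℂ) : C2 :=
  WithLp.toLp 2 (Function.update (fun _ => z) i 1)

theorem affineVec_ne_zero (i : Fin 2) (z : ℂ) : affineVec i z ≠ 0 := by
  intro h
  have h1 : affineVec i z i = (0 : C2) i := by rw [h]
  simp [affineVec] at h1

/-- The two standard affine parametrizations `z ↦ [1 : z]` (`i = 0`) and `z ↦ [z : 1]` (`i = 1`)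
of `P¹` minus a point. -/
def chart (i : Fin 2) (z : ℂ) : P1 :=
  Projectivization.mk ℂ (affineVec i z) (affineVec_ne_zero i z)

/-- The affine coordinate, inverse to `chart i` : `x₁ / x₀` for `i = 0`, `x₀ / x₁` for `i = 1`. -/
def coord (i : Fin 2) (x : P1) : ℂ := x.rep (1 - i) / x.rep i

/-- The index of an affine chart whose image contains `x`. -/
def chartIndex (x : P1) : Fin 2 := if x.rep 0 ≠ 0 then 0 else 1

/-- Smooth real functions on `P¹`. -/
def IsSmooth (φ : P1 → ℝ) : Prop := ∀ i : Fin 2, ContDiff ℝ ∞ (φ ∘ chart i)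

/-- The Fubini-Study form `ω` on `P¹`, as a measure: its density in the affine chart is
`1 / (π (1 + |z|²)²)`, so that `π^* ω = dd^c log ‖·‖` and `ω` has mass one. -/
def fubiniStudy : Measure P1 :=
  ((volume : Measure ℂ).withDensity
    (fun z => ENNReal.ofReal (1 / (Real.pi * (1 + ‖z‖ ^ 2) ^ 2)))).map (chart 0)

/-! ### Lifts of rational maps and their Green functions -/

/-- The polynomial map `ℂ² → ℂ²` with components `F 0`, `F 1`. -/
def polyMap (F : Fin 2 → MvPolynomial (Fin 2) ℂ) (z : C2) : C2 :=
  WithLp.toLp 2 (fun i => MvPolynomial.eval (fun j => z j) (F i))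

/-- `F` is a lift of `f : P¹ → P¹` of algebraic degree `d` : it is a homogeneous polynomial map of
degree `d`, it is non-degenerate, and `π ∘ F = f ∘ π`. -/
structure IsLift (d : ℕ) (F : Fin 2 → MvPolynomial (Fin 2) ℂ) (f : P1 → P1) : Prop where
  homogeneous : ∀ i, (F i).IsHomogeneous d
  nondegenerate : ∀ z : C2, z ≠ 0 → polyMap F z ≠ 0
  semiconj : ∀ (z : C2) (hz : z ≠ 0),
    f (Projectivization.mk ℂ z hz) = Projectivization.mk ℂ (polyMap F z) (nondegenerate z hz)

/-- The Green function `G_F (z) = lim_n d^{-n} log ‖F^n (z)‖`, `z ≠ 0`. -/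
def greenFun (d : ℕ) (F : Fin 2 → MvPolynomial (Fin 2) ℂ) (z : C2) : ℝ :=
  limUnder atTop (fun n : ℕ => ((d : ℝ) ^ n)⁻¹ * Real.log ‖(polyMap F)^[n] z‖)

/-- The Green function `g_F` on `P¹` : `g_F ∘ π = G_F - log ‖·‖`. -/
def greenFunP1 (d : ℕ) (F : Fin 2 → MvPolynomial (Fin 2) ℂ) (x : P1) : ℝ :=
  greenFun d F x.rep - Real.log ‖x.rep‖

/-! ### The Green measure -/

/-- `μ = dd^c g_F + ω` in the sense of currents on `P¹`, that is
`∫ φ dμ = ∫ g_F dd^c φ + ∫ φ ω` for all smooth `φ`. Here `d^c` is normalized so that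
`dd^c = (i/π) ∂∂̄`, that is `dd^c φ = (1/2π) Δφ dx dy` in an affine coordinate; the complement of
the affine chart is one point, which is negligible for the smooth form `dd^c φ`. -/
def IsGreenMeasure (d : ℕ) (F : Fin 2 → MvPolynomial (Fin 2) ℂ) (μ : Measure P1) : Prop :=
  IsFiniteMeasure μ ∧
    ∀ φ : P1 → ℝ, IsSmooth φ →
      ∫ x, φ x ∂μ =
        (∫ z : ℂ, greenFunP1 d F (chart 0 z) * ((2 * Real.pi)⁻¹ * (Δ (φ ∘ chart 0)) z)) +
          ∫ x, φ x ∂fubiniStudy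

open Classical in
/-- The Green measure `μ_f = dd^c g_F + ω` : the (unique) measure representing this current. -/
def greenMeasure (d : ℕ) (F : Fin 2 → MvPolynomial (Fin 2) ℂ) : Measure P1 :=
  if h : ∃ μ, IsGreenMeasure d F μ then h.choose else 0

/-! ### The Lyapunov exponent -/

/-- The norm `‖f'(x)‖` of the differential of `f : P¹ → P¹` at `x` with respect to the Fubini-Study
metric `|dz| / (1 + |z|²)`, computed in affine charts around `x` and `f x`. -/
def sphericalDeriv (f : P1 → P1) (x : P1) : ℝ :=
  ‖deriv (coord (chartIndex (f x)) ∘ f ∘ chart (chartIndex x)) (coord (chartIndex x) x)‖ *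
    (1 + ‖coord (chartIndex x) x‖ ^ 2) / (1 + ‖coord (chartIndex (f x)) (f x)‖ ^ 2)

/-- The Lyapunov exponent `∫ log ‖f'‖ dμ` of `f` with respect to `μ`. -/
def lyapunovExponent (f : P1 → P1) (μ : Measure P1) : ℝ :=
  ∫ x, Real.log (sphericalDeriv f x) ∂μ

/-! ### The Jacobian determinant and the critical divisor -/

/-- The Jacobian determinant of `F`, as a polynomial. -/
def jacPoly (F : Fin 2 → MvPolynomial (Fin 2) ℂ) : MvPolynomial (Fin 2) ℂ :=
  (Matrix.of fun i j => MvPolynomial.pderiv j (F i)).det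

/-- `det F'(z)`. -/
def jacDet (F : Fin 2 → MvPolynomial (Fin 2) ℂ) (z : C2) : ℂ :=
  MvPolynomial.eval (fun j => z j) (jacPoly F)

/-- The canonical norm `‖J_F‖₀` of the section `J_F` of `O(D)`, `D = 2 (d - 1)`, induced by `det F'`:
`‖J_F‖₀ (π z) = exp (-D log ‖z‖) |det F'(z)|`. -/
def normJac (d : ℕ) (F : Fin 2 → MvPolynomial (Fin 2) ℂ) (x : P1) : ℝ :=
  Real.exp (-(2 * ((d : ℝ) - 1)) * Real.log ‖x.rep‖) * ‖jacDet F x.rep‖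

/-- The multiplicity of `x` as a zero of the section `J_F`. -/
def critMult (F : Fin 2 → MvPolynomial (Fin 2) ℂ) (x : P1) : ℕ :=
  analyticOrderNatAt (fun z : ℂ => jacDet F (affineVec (chartIndex x) z)) (coord (chartIndex x) x)

/-- The current of integration `[C_f]` on the critical divisor of `f` (the zero divisor of `J_F`):
the sum of the Dirac masses at the critical points, with multiplicities. -/
def critCurrent (F : Fin 2 → MvPolynomial (Fin 2) ℂ) : Measure P1 :=
  ∑ᶠ x : P1, (critMult F x : ℝ≥0∞) • Measure.dirac x

/-- `a ∧ b = a₀ b₁ - a₁ b₀`. -/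
def wedge (a b : C2) : ℂ := a 0 * b 1 - a 1 * b 0

/-! ### The Monge-Ampère measure `m = (dd^c log⁺ ‖·‖)²` on `ℂ²` -/

/-- `∂u / ∂z_j`. -/
def dz (j : Fin 2) (u : C2 → ℂ) (z : C2) : ℂ :=
  (fderiv ℝ u z (EuclideanSpace.single j 1) -
    Complex.I * fderiv ℝ u z (EuclideanSpace.single j Complex.I)) / 2

/-- `∂u / ∂z̄_j`. -/
def dzbar (j : Fin 2) (u : C2 → ℂ) (z : C2) : ℂ :=
  (fderiv ℝ u z (EuclideanSpace.single j 1) +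
    Complex.I * fderiv ℝ u z (EuclideanSpace.single j Complex.I)) / 2

/-- The density with respect to Lebesgue measure of `α ∧ β`, for the `(1,1)`-forms
`α = (i/π) ∑ a_{jk} dz_j ∧ dz̄_k` and `β = (i/π) ∑ b_{jk} dz_j ∧ dz̄_k`. -/
def wedgeDensity (a b : Matrix (Fin 2) (Fin 2) ℂ) : ℂ :=
  (4 / (Real.pi : ℂ) ^ 2) * (a 0 0 * b 1 1 + a 1 1 * b 0 0 - a 0 1 * b 1 0 - a 1 0 * b 0 1)

/-- `μ = (dd^c u)²` on `ℂ²`, for a locally Lipschitz plurisubharmonic function `u`. The measure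
`(dd^c u)² = dd^c (u dd^c u)` acts on test functions `φ` by
`φ ↦ ∫ u dd^c u ∧ dd^c φ = - ∫ du ∧ d^c u ∧ dd^c φ`, where
`du ∧ d^c u = (i/π) ∑ (∂u/∂z_j) (∂u/∂z̄_k) dz_j ∧ dz̄_k` has locally bounded coefficients and
`dd^c φ = (i/π) ∑ (∂²φ/∂z_j∂z̄_k) dz_j ∧ dz̄_k`. -/
def IsMongeAmpere (u : C2 → ℝ) (μ : Measure C2) : Prop :=
  IsFiniteMeasureOnCompacts μ ∧
    ∀ φ : C2 → ℂ, ContDiff ℝ ∞ φ → HasCompactSupport φ →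
      ∫ z, φ z ∂μ =
        -∫ z : C2, wedgeDensity
          (Matrix.of fun j k => dz j (fun w => (u w : ℂ)) z * dzbar k (fun w => (u w : ℂ)) z)
          (Matrix.of fun j k => dz j (dzbar k φ) z)

open Classical in
/-- The measure `m = (dd^c log⁺ ‖·‖)²` on `ℂ²`. -/
def logNormMeasure : Measure C2 :=
  if h : ∃ μ, IsMongeAmpere (fun z => Real.posLog ‖z‖) μ then h.choose else 0

end RatLyap

end

/-!
All three formulas come from one computation with the logarithmic kernel
`logKernel c x = log (|c ∧ x| / (‖c‖ ‖x‖))` of `P¹`, a potential of the Dirac mass at `[c]`.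

*The Green measure.* The functions `d⁻ⁿ log ‖Fⁿ‖ - log ‖·‖` converge to `g_F` uniformly
(`IsLift.exists_greenFunP1_bound`), and `dd^c log ‖Fⁿ‖` is the measure whose density is a multiple of
the squared modulus of a Wronskian (`IsHomMap.ddcForm_eq`). Hence `dd^c g_F + ω` is positive on smooth
functions, and M. Riesz's extension theorem together with the Riesz-Markov theorem makes it a measure
(`IsLift.exists_isGreenMeasure`).

*Potentials.* The mean of `logKernel c` is `-1/2` for `ω`, by unitary invariance and an explicit radial
integral (`integral_logKernel_fubiniStudy`). For `μ_f` it is `g_F([c]) - ∫ g_F ω - 1/2`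
(`IsLift.potential`): replace `|c ∧ x|` by the norm of an invertible linear map (`regMap`), apply the
definition of `μ_f` to the resulting smooth function, whose `dd^c` is an approximation of the Dirac
mass at `[c]`, and pass to the limit. Fatou's lemma shows on the way that `μ_f` does not charge points.

*The chain rule.* In homogeneous coordinates `d ‖f'‖ = |det F'| ‖v‖² / ‖F v‖²`
(`IsLift.sphericalDeriv_eq`), and since `G_F ∘ F = d G_F` this reads
`log ‖f'‖ + log d = log ‖J_F‖₀ + 2 (g_F ∘ f - d g_F)` (`IsLift.log_sphericalDeriv`). The binary form
`det F'` is a product of linear forms `c_j ∧ z` (`exists_eval_eq_prod_wedge`), so that `log ‖J_F‖₀` is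
the sum of the functions `logKernel c_j + log ‖c_j‖`, and `[C_f]` is the sum of the Dirac masses at the
points `[c_j]` (`IsCritical.critCurrent_eq`).

*Invariance.* The integral of `g_F ∘ f - d g_F` for `μ_f` is `(1 - d) ∫ g_F μ_f`, because
`∫ g_F ∘ f μ_f = ∫ g_F μ_f` (`IsLift.integral_greenFunP1_comp`). Only this case of the invariance of
`μ_f` is needed, and it has a direct proof. Factoring `c ∧ F` over the fiber of `[c]` shows that the
potential of the image of `μ_f` under `f` is `g_F` up to a constant (`IsLift.exists_potential_comp`);
that the constant does not depend on `c` is the symmetry of the resultant (`IsFiber.fiberConst_eq`).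
The symmetry of the kernel and Fubini's theorem, against `ω`, determine the constant, and, against
`μ_f`, give the invariance.

Integrating the chain rule against `μ_f` gives (iii) (`IsCritical.lyapunovExponent_eq`), and evaluating
`∫ g_F [C_f]` and `∫ log ‖J_F‖₀ ω` in terms of the `c_j` turns (iii) into (i). For (ii), the
Monge-Ampère measure of `log⁺ ‖·‖` is the rotation-invariant probability measure of the unit sphere
(`isMongeAmpere_sphereMeasureC2`, `IsMongeAmpere.unique`). The projection maps this measure to `ω`
(`map_sphereProj`), and on the sphere `‖J_F‖₀ = |det F'|` (`integral_log_jacDet`).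
-/

noncomputable section

namespace RatLyap

/-! ### Topology of the projective line -/

theorem norm_sq_C2 (v : C2) : ‖v‖ ^ 2 = ‖v 0‖ ^ 2 + ‖v 1‖ ^ 2 := by
  rw [EuclideanSpace.norm_sq_eq, Fin.sum_univ_two]

theorem norm_C2_pos {v : C2} (hv : v ≠ 0) : 0 < ‖v‖ := norm_pos_iff.2 hv

theorem exists_rep_mk (v : C2) (hv : v ≠ 0) :
    ∃ a : ℂ, a ≠ 0 ∧ (Projectivization.mk ℂ v hv).rep = a • v := by
  obtain ⟨a, ha⟩ := Projectivization.exists_smul_eq_mk_rep ℂ v hv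
  exact ⟨a, a.ne_zero, ha.symm⟩

/-- A function of degree zero on `ℂ² ∖ {0}` takes its value at a chosen representative of `[v]`
at `v` itself. -/
theorem apply_rep_mk {X : Type*} {Φ : C2 → X} (h : ∀ a : ℂ, a ≠ 0 → ∀ v : C2, v ≠ 0 → Φ (a • v) = Φ v)
    (v : C2) (hv : v ≠ 0) : Φ (Projectivization.mk ℂ v hv).rep = Φ v := by
  obtain ⟨a, ha, e⟩ := exists_rep_mk v hv
  rw [e, h a ha v hv]

theorem continuous_mk : Continuous (fun v : { v : C2 // v ≠ 0 } => Projectivization.mk ℂ v.1 v.2) :=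
  continuous_coinduced_rng

theorem continuous_rep_of_invariant {X : Type*} [TopologicalSpace X] {Φ : C2 → X}
    (h : ∀ a : ℂ, a ≠ 0 → ∀ v : C2, v ≠ 0 → Φ (a • v) = Φ v) (hc : ContinuousOn Φ {0}ᶜ) :
    Continuous (fun x : P1 => Φ x.rep) := by
  refine continuous_coinduced_dom.2 ?_
  have : ((fun x : P1 => Φ x.rep) ∘ (Projectivization.mk' ℂ : { v : C2 // v ≠ 0 } → P1)) =
      fun v : { v : C2 // v ≠ 0 } => Φ v.1 := by
    funext v
    exact apply_rep_mk h v.1 v.2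
  rw [this]
  exact hc.comp_continuous continuous_subtype_val (fun v => v.2)

theorem continuous_affineVec (i : Fin 2) : Continuous (affineVec i) := by
  unfold affineVec
  refine (PiLp.continuous_toLp 2 _).comp ?_
  exact (continuous_pi fun _ => continuous_id).update i continuous_const

theorem continuous_chart (i : Fin 2) : Continuous (chart i) :=
  continuous_mk.comp (Continuous.subtype_mk (continuous_affineVec i) (affineVec_ne_zero i))

/-- The Hopf map `[v] ↦ (|v₀|², v₁ v̄₀) / ‖v‖²`. -/
def hopf (v : C2) : ℝ × ℂ := (‖v 0‖ ^ 2 / ‖v‖ ^ 2, v 1 * conj (v 0) / (‖v‖ ^ 2 : ℝ))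

theorem hopf_smul (a : ℂ) (ha : a ≠ 0) (v : C2) (hv : v ≠ 0) : hopf (a • v) = hopf v := by
  have h1 : ‖v‖ ≠ 0 := norm_ne_zero_iff.2 hv
  have h2 : ‖a‖ ≠ 0 := norm_ne_zero_iff.2 ha
  unfold hopf
  simp only [PiLp.smul_apply, smul_eq_mul, norm_mul, norm_smul, map_mul, mul_pow]
  ext1
  · field_simp
  · have h3 : a * v 1 * (conj a * conj (v 0)) = (‖a‖ ^ 2 : ℝ) * (v 1 * conj (v 0)) := by
      push_cast
      rw [← Complex.mul_conj']; ring
    rw [h3, Complex.ofReal_mul]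
    have h4 : ((‖a‖ ^ 2 : ℝ) : ℂ) ≠ 0 := by exact_mod_cast pow_ne_zero 2 h2
    rw [mul_div_mul_left _ _ h4]

theorem continuousOn_hopf : ContinuousOn hopf {0}ᶜ := by
  unfold hopf
  refine ContinuousOn.prodMk ?_ ?_
  · refine ContinuousOn.div (by fun_prop) (by fun_prop) ?_
    intro v hv; exact pow_ne_zero 2 (norm_ne_zero_iff.2 hv)
  · refine ContinuousOn.div ?_ ?_ ?_
    · refine Continuous.continuousOn ?_
      exact (by fun_prop : Continuous fun v : C2 => v 1).mul
        (Complex.continuous_conj.comp (by fun_prop : Continuous fun v : C2 => v 0))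
    · exact (Complex.continuous_ofReal.comp (by fun_prop : Continuous fun v : C2 => ‖v‖ ^ 2)).continuousOn
    · intro v hv
      have := pow_ne_zero 2 (norm_ne_zero_iff.2 hv)
      exact_mod_cast this

theorem wedge_eq_zero_iff {a b : C2} (ha : a ≠ 0) (hb : b ≠ 0) :
    wedge a b = 0 ↔ Projectivization.mk ℂ a ha = Projectivization.mk ℂ b hb := by
  rw [Projectivization.mk_eq_mk_iff']
  constructor
  · intro h
    unfold wedge at h
    by_cases h0 : b 0 = 0
    · have h1 : b 1 ≠ 0 := by
        intro h1; apply hb; ext i; fin_cases i <;> simpa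
      refine ⟨a 1 / b 1, ?_⟩
      ext i
      fin_cases i
      · simp only [h0, mul_zero, sub_zero, mul_eq_zero, h1, or_false] at h
        simp [h0, h]
      · simp [h1]
    · refine ⟨a 0 / b 0, ?_⟩
      ext i
      fin_cases i
      · simp [h0]
      · simp only [Fin.mk_one, PiLp.smul_apply, smul_eq_mul]
        field_simp
        linear_combination h
  · rintro ⟨t, rfl⟩
    simp [wedge]; ring

/-- The Hopf map separates lines: its components are entries of the matrix of the orthogonal
projection onto the line of `v`. -/
theorem wedge_eq_zero_of_hopf_eq {a b : C2} (hx : a ≠ 0) (hy : b ≠ 0) (hxy : hopf a = hopf b) :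
    wedge a b = 0 := by
  simp only [hopf, Prod.mk.injEq] at hxy
  obtain ⟨h1, h2⟩ := hxy
  have na := pow_ne_zero 2 (norm_ne_zero_iff.2 hx)
  have nb := pow_ne_zero 2 (norm_ne_zero_iff.2 hy)
  have nac : ((‖a‖ ^ 2 : ℝ) : ℂ) ≠ 0 := by exact_mod_cast na
  have nbc : ((‖b‖ ^ 2 : ℝ) : ℂ) ≠ 0 := by exact_mod_cast nb
  rw [div_eq_div_iff na nb] at h1
  rw [div_eq_div_iff nac nbc] at h2
  have h1' : a 0 * conj (a 0) * ((‖b‖ ^ 2 : ℝ) : ℂ) = b 0 * conj (b 0) * ((‖a‖ ^ 2 : ℝ) : ℂ) := by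
    rw [Complex.mul_conj', Complex.mul_conj', ← Complex.ofReal_pow, ← Complex.ofReal_pow,
      ← Complex.ofReal_mul, ← Complex.ofReal_mul, h1]
  unfold wedge
  by_cases h0 : b 0 = 0
  · have : ‖a 0‖ ^ 2 = 0 := by
      have : ‖a 0‖ ^ 2 * ‖b‖ ^ 2 = 0 := by rw [h1, h0]; simp
      exact (mul_eq_zero.1 this).resolve_right nb
    have : a 0 = 0 := by simpa using this
    simp [h0, this]
  · have hc : conj (b 0) ≠ 0 := by simpa using h0
    have ha0 : a 0 ≠ 0 := by
      intro h; rw [h] at h1'; simp only [zero_mul] at h1'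
      exact (mul_ne_zero (mul_ne_zero h0 hc) nac) h1'.symm
    have hca : conj (a 0) ≠ 0 := by simpa using ha0
    have key : (a 0 * b 1 - a 1 * b 0) * (conj (a 0) * conj (b 0) * ((‖a‖ ^ 2 : ℝ) : ℂ)) = 0 := by
      have e1 : a 0 * b 1 * (conj (a 0) * conj (b 0) * ((‖a‖ ^ 2 : ℝ) : ℂ))
          = a 0 * conj (a 0) * (b 1 * conj (b 0) * ((‖a‖ ^ 2 : ℝ) : ℂ)) := by ring
      have e2 : a 1 * b 0 * (conj (a 0) * conj (b 0) * ((‖a‖ ^ 2 : ℝ) : ℂ))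
          = a 1 * conj (a 0) * (b 0 * conj (b 0) * ((‖a‖ ^ 2 : ℝ) : ℂ)) := by ring
      rw [sub_mul, e1, e2, ← h1', ← h2]; ring
    exact (mul_eq_zero.1 key).resolve_right (mul_ne_zero (mul_ne_zero hca hc) nac)

/-- The Hopf map embeds `P¹` in `ℝ × ℂ`, which is why `P¹` is Hausdorff. -/
theorem hopf_injective : Function.Injective (fun x : P1 => hopf x.rep) := by
  intro x y hxy
  rw [← x.mk_rep, ← y.mk_rep, ← wedge_eq_zero_iff x.rep_nonzero y.rep_nonzero]
  exact wedge_eq_zero_of_hopf_eq x.rep_nonzero y.rep_nonzero hxy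

theorem continuous_hopf_rep : Continuous (fun x : P1 => hopf x.rep) :=
  continuous_rep_of_invariant hopf_smul continuousOn_hopf

instance instT2SpaceP1 : T2Space P1 :=
  T2Space.of_injective_continuous hopf_injective continuous_hopf_rep

theorem ne_zero_of_mem_sphere {v : C2} (hv : v ∈ Metric.sphere (0 : C2) 1) : v ≠ 0 := by
  rintro rfl
  simp at hv

/-- The projection of the unit sphere onto the projective line. -/
def sphereProj (v : Metric.sphere (0 : C2) 1) : P1 :=
  Projectivization.mk ℂ v.1 (ne_zero_of_mem_sphere v.2)

theorem continuous_sphereProj : Continuous sphereProj :=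
  continuous_mk.comp (Continuous.subtype_mk continuous_subtype_val
    (fun v => ne_zero_of_mem_sphere v.2))

theorem sphereProj_surjective : Function.Surjective sphereProj := by
  intro x
  have hx := x.rep_nonzero
  have h : ‖x.rep‖ ≠ 0 := norm_ne_zero_iff.2 hx
  refine ⟨⟨((‖x.rep‖⁻¹ : ℝ) : ℂ) • x.rep, ?_⟩, ?_⟩
  · rw [mem_sphere_zero_iff_norm, norm_smul, Complex.norm_real, norm_inv, norm_norm, inv_mul_cancel₀ h]
  · unfold sphereProj
    conv_rhs => rw [← x.mk_rep]
    rw [Projectivization.mk_eq_mk_iff']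
    exact ⟨_, rfl⟩

instance instCompactSpaceP1 : CompactSpace P1 := by
  refine ⟨?_⟩
  rw [← sphereProj_surjective.range_eq]
  exact isCompact_range continuous_sphereProj

instance instSecondCountableP1 : SecondCountableTopology P1 :=
  (continuous_hopf_rep.isClosedEmbedding hopf_injective).isEmbedding.secondCountableTopology

theorem Continuous.integrable_P1 {φ : P1 → ℝ} (hφ : Continuous φ) (μ : Measure P1)
    [IsFiniteMeasure μ] : Integrable φ μ :=
  hφ.integrable_of_hasCompactSupport (HasCompactSupport.of_compactSpace φ)

theorem chart_injective (i : Fin 2) : Function.Injective (chart i) := by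
  intro z w h
  unfold chart at h
  rw [← wedge_eq_zero_iff] at h
  fin_cases i
  · simp [wedge, affineVec] at h; rw [← sub_eq_zero, ← neg_eq_zero, ← h]; ring
  · simp [wedge, affineVec] at h; rw [← sub_eq_zero, ← h]

@[simp] theorem affineVec_zero_zero (z : ℂ) : affineVec 0 z 0 = 1 := by simp [affineVec]
@[simp] theorem affineVec_zero_one (z : ℂ) : affineVec 0 z 1 = z := by simp [affineVec]
@[simp] theorem affineVec_one_zero (z : ℂ) : affineVec 1 z 0 = z := by simp [affineVec]
@[simp] theorem affineVec_one_one (z : ℂ) : affineVec 1 z 1 = 1 := by simp [affineVec]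

theorem norm_sq_affineVec (i : Fin 2) (z : ℂ) : ‖affineVec i z‖ ^ 2 = 1 + ‖z‖ ^ 2 := by
  rw [norm_sq_C2]
  fin_cases i <;> simp [add_comm]

theorem chart_one_eq_chart_zero {z : ℂ} (hz : z ≠ 0) : chart 0 z = chart 1 z⁻¹ := by
  unfold chart
  rw [← wedge_eq_zero_iff]
  simp [wedge, hz]

/-- Lagrange's identity, as an inequality. -/
theorem norm_wedge_le (a b : C2) : ‖wedge a b‖ ≤ ‖a‖ * ‖b‖ := by
  refine abs_le_of_sq_le_sq' ?_ (by positivity) |>.2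
  rw [mul_pow, norm_sq_C2, norm_sq_C2]
  have h : ‖wedge a b‖ ^ 2 ≤ (‖a 0‖ * ‖b 1‖ + ‖a 1‖ * ‖b 0‖) ^ 2 := by
    gcongr
    refine (norm_sub_le _ _).trans ?_
    rw [norm_mul, norm_mul]
  nlinarith [sq_nonneg (‖a 0‖ * ‖b 0‖ - ‖a 1‖ * ‖b 1‖)]

/-! ### The Laplacian on `ℂ` and on smooth functions on `P¹` -/

theorem laplacian_eq_fderiv {u : ℂ → ℝ} {z : ℂ} (hu : ContDiffAt ℝ 2 u z) :
    (Δ u) z = fderiv ℝ (fun w => fderiv ℝ u w 1) z 1 +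
      fderiv ℝ (fun w => fderiv ℝ u w Complex.I) z Complex.I := by
  rw [InnerProductSpace.laplacian_eq_iteratedFDeriv_complexPlane]
  have hd : DifferentiableAt ℝ (fderiv ℝ u) z :=
    (hu.fderiv_right (m := 1) (by norm_num)).differentiableAt (by norm_num)
  simp only [iteratedFDeriv_two_apply]
  rw [fderiv_clm_apply hd (by fun_prop), fderiv_clm_apply hd (by fun_prop)]
  simp

/-- The Laplacian from two successive directional derivatives, known in closed form, along `1` and
`i`. -/
theorem laplacian_of_lineDeriv {u A B : ℂ → ℝ} {a b : ℝ} {z : ℂ} (hu : ContDiff ℝ 2 u)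
    (hA : ∀ w, HasLineDerivAt ℝ u (A w) w 1) (hB : ∀ w, HasLineDerivAt ℝ u (B w) w Complex.I)
    (ha : HasLineDerivAt ℝ A a z 1) (hb : HasLineDerivAt ℝ B b z Complex.I) :
    (Δ u) z = a + b := by
  have hd : Differentiable ℝ u := hu.differentiable (by norm_num)
  have hd2 : ∀ v : ℂ, Differentiable ℝ (fun w => fderiv ℝ u w v) := fun v =>
    ((hu.fderiv_right (m := 1) (by norm_num)).clm_apply contDiff_const).differentiable (by norm_num)
  have e1 : (fun w => fderiv ℝ u w 1) = A := by
    funext w; rw [← (hd w).lineDeriv_eq_fderiv, (hA w).lineDeriv]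
  have e2 : (fun w => fderiv ℝ u w Complex.I) = B := by
    funext w; rw [← (hd w).lineDeriv_eq_fderiv, (hB w).lineDeriv]
  rw [laplacian_eq_fderiv hu.contDiffAt]
  rw [← (hd2 1 z).lineDeriv_eq_fderiv, ← (hd2 Complex.I z).lineDeriv_eq_fderiv, e1, e2,
    ha.lineDeriv, hb.lineDeriv]

theorem hasLineDerivAt_of_hasDerivAt {p : ℂ → ℂ} {p' z : ℂ} (hp : HasDerivAt p p' z) (v : ℂ) :
    HasLineDerivAt ℝ p (p' * v) z v := by
  have h1 := (hp.hasFDerivAt.restrictScalars ℝ).hasLineDerivAt v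
  simpa [mul_comm] using h1

theorem hasLineDerivAt_re_conj_mul {p q : ℂ → ℂ} {p' q' z v : ℂ}
    (hp : HasLineDerivAt ℝ p p' z v) (hq : HasLineDerivAt ℝ q q' z v) :
    HasLineDerivAt ℝ (fun w => (conj (p w) * q w).re)
      ((conj p' * q z).re + (conj (p z) * q').re) z v := by
  unfold HasLineDerivAt at *
  have h1 : HasDerivAt (fun t : ℝ => conj (p (z + t • v))) (conj p') 0 := hp.star_conj
  have h2 := h1.mul hq
  have h3 := (Complex.reCLM.hasFDerivAt (x := conj (p (z + (0:ℝ) • v)) * q (z + (0:ℝ) • v))).comp_hasDerivAt (0:ℝ) h2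
  simp only [zero_smul, add_zero] at h3
  exact h3.congr_deriv (by simp)

/-- `Δ log (|p|² + |q|²)^{1/2} = 2 |p q' - q p'|² / (|p|² + |q|²)²` for holomorphic `p`, `q` without
common zeros. -/
theorem laplacian_log_norm {p q : ℂ → ℂ} (hp : Differentiable ℂ p) (hq : Differentiable ℂ q)
    (h0 : ∀ z, p z ≠ 0 ∨ q z ≠ 0) (z : ℂ) :
    (Δ fun z => (1 / 2 : ℝ) * Real.log (‖p z‖ ^ 2 + ‖q z‖ ^ 2)) z =
      2 * ‖p z * deriv q z - q z * deriv p z‖ ^ 2 / (‖p z‖ ^ 2 + ‖q z‖ ^ 2) ^ 2 := by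
  set N : ℂ → ℝ := fun z => ‖p z‖ ^ 2 + ‖q z‖ ^ 2 with hN
  have hNpos : ∀ z, 0 < N z := by
    intro z
    rcases h0 z with h | h
    · have := norm_pos_iff.2 h; positivity
    · have := norm_pos_iff.2 h; positivity
  have hNre : ∀ z, N z = (conj (p z) * p z).re + (conj (q z) * q z).re := by
    intro z
    rw [Complex.conj_mul', Complex.conj_mul']; norm_cast
  have hpR : ContDiff ℝ 2 p := (hp.contDiff (n := 2)).restrict_scalars ℝ
  have hqR : ContDiff ℝ 2 q := (hq.contDiff (n := 2)).restrict_scalars ℝ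
  have hNc : ContDiff ℝ 2 N := by
    have := hpR.norm_sq ℝ; have := hqR.norm_sq ℝ; fun_prop
  have hu : ContDiff ℝ 2 (fun z => (1 / 2 : ℝ) * Real.log (N z)) :=
    contDiff_const.mul (hNc.log fun z => (hNpos z).ne')
  have lp : ∀ w v, HasLineDerivAt ℝ p (deriv p w * v) w v := fun w v =>
    hasLineDerivAt_of_hasDerivAt (hp w).hasDerivAt v
  have lq : ∀ w v, HasLineDerivAt ℝ q (deriv q w * v) w v := fun w v =>
    hasLineDerivAt_of_hasDerivAt (hq w).hasDerivAt v
  have hp1 : Differentiable ℂ (deriv p) := hp.deriv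
  have hq1 : Differentiable ℂ (deriv q) := hq.deriv
  have lp1 : ∀ w v, HasLineDerivAt ℝ (fun w => deriv p w * v) (deriv (deriv p) w * v * v) w v := by
    intro w v
    exact hasLineDerivAt_of_hasDerivAt ((hp1 w).hasDerivAt.mul_const v) v
  have lq1 : ∀ w v, HasLineDerivAt ℝ (fun w => deriv q w * v) (deriv (deriv q) w * v * v) w v := by
    intro w v
    exact hasLineDerivAt_of_hasDerivAt ((hq1 w).hasDerivAt.mul_const v) v
  -- `S v w` is half the derivative of `N` at `w` in the direction `v`.
  set S : ℂ → ℂ → ℝ := fun v w => (conj (p w) * (deriv p w * v)).re + (conj (q w) * (deriv q w * v)).re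
    with hS
  have lN : ∀ w v, HasLineDerivAt ℝ N (2 * S v w) w v := by
    intro w v
    have h := hasLineDerivAt_re_conj_mul (lp w v) (lp w v)
    have h' := hasLineDerivAt_re_conj_mul (lq w v) (lq w v)
    unfold HasLineDerivAt at *
    have h2 := h.add h'
    have : N = fun z => (conj (p z) * p z).re + (conj (q z) * q z).re := funext hNre
    rw [this]
    refine h2.congr_deriv ?_
    simp only [hS, Complex.mul_re, Complex.conj_re, Complex.conj_im, Complex.mul_im]
    ring
  have lS : ∀ w v, HasLineDerivAt ℝ (S v)
      (‖deriv p w * v‖ ^ 2 + ‖deriv q w * v‖ ^ 2 + (conj (p w) * (deriv (deriv p) w * v * v)).re +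
        (conj (q w) * (deriv (deriv q) w * v * v)).re) w v := by
    intro w v
    have h := hasLineDerivAt_re_conj_mul (lp w v) (lp1 w v)
    have h' := hasLineDerivAt_re_conj_mul (lq w v) (lq1 w v)
    unfold HasLineDerivAt at *
    refine (h.add h').congr_deriv ?_
    rw [Complex.conj_mul', Complex.conj_mul']
    norm_cast
    ring
  have lu : ∀ v w, HasLineDerivAt ℝ (fun z => (1 / 2 : ℝ) * Real.log (N z)) (S v w / N w) w v := by
    intro v w
    have h := lN w v
    unfold HasLineDerivAt at *
    have h2 := (h.log (by simpa using (hNpos w).ne')).const_mul (1 / 2 : ℝ)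
    simp only [zero_smul, add_zero] at h2
    refine h2.congr_deriv ?_
    ring
  have lA : ∀ v w, HasLineDerivAt ℝ (fun w => S v w / N w)
      (((‖deriv p w * v‖ ^ 2 + ‖deriv q w * v‖ ^ 2 + (conj (p w) * (deriv (deriv p) w * v * v)).re +
        (conj (q w) * (deriv (deriv q) w * v * v)).re) * N w - S v w * (2 * S v w)) / N w ^ 2) w v := by
    intro v w
    have h := lN w v
    have h' := lS w v
    unfold HasLineDerivAt at *
    have h2 := h'.fun_div h (by simpa using (hNpos w).ne')
    simpa only [zero_smul, add_zero] using h2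
  have key := laplacian_of_lineDeriv (z := z) hu (lu 1) (lu Complex.I) (lA 1 z) (lA Complex.I z)
  refine key.trans ?_
  rw [← add_div]
  congr 1
  simp only [hN, hS, ← Complex.normSq_eq_norm_sq, Complex.normSq_apply,
    Complex.mul_re, Complex.mul_im, Complex.conj_re, Complex.conj_im, Complex.I_re, Complex.I_im,
    Complex.one_re, Complex.one_im, Complex.sub_re, Complex.sub_im]
  ring

theorem IsSmooth.contDiff {φ : P1 → ℝ} (hφ : IsSmooth φ) (i : Fin 2) : ContDiff ℝ 2 (φ ∘ chart i) :=
  contDiff_infty.1 (hφ i) 2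

/-- A bound at infinity, read off in the coordinate `1 / z`, is a global decay estimate. -/
theorem exists_decay_bound {f g : ℂ → ℝ} {k : ℕ} (hf : Continuous f) (hg : Continuous g)
    (h : ∀ z, z ≠ 0 → |f z| ≤ g z⁻¹ / ‖z‖ ^ k) : ∃ C, ∀ z, |f z| ≤ C / (1 + ‖z‖) ^ k := by
  obtain ⟨M, hM⟩ := (isCompact_closedBall (0 : ℂ) 1).exists_bound_of_continuousOn hf.continuousOn
  obtain ⟨M', hM'⟩ := (isCompact_closedBall (0 : ℂ) 1).exists_bound_of_continuousOn hg.continuousOn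
  have hM0 : 0 ≤ M := (norm_nonneg _).trans (hM 0 (by simp))
  have hM0' : 0 ≤ M' := (norm_nonneg _).trans (hM' 0 (by simp))
  refine ⟨2 ^ k * (M + M'), fun z => ?_⟩
  rw [le_div_iff₀ (by positivity)]
  rcases le_total ‖z‖ 1 with hz | hz
  · have h1 : |f z| ≤ M := hM z (by simpa using hz)
    have h2 : (1 + ‖z‖) ^ k ≤ 2 ^ k := by gcongr; linarith
    calc |f z| * (1 + ‖z‖) ^ k ≤ (M + M') * 2 ^ k := by gcongr; linarith
      _ = _ := by ring
  · have hz0 : z ≠ 0 := by rintro rfl; simp at hz; linarith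
    have h1 : g z⁻¹ ≤ M' := (le_abs_self _).trans
      (hM' z⁻¹ (by simpa using inv_le_one_of_one_le₀ hz))
    have h2 : (1 + ‖z‖) ^ k ≤ 2 ^ k * ‖z‖ ^ k := by rw [← mul_pow]; gcongr; linarith
    have h3 : |f z| ≤ M' / ‖z‖ ^ k := (h z hz0).trans (by gcongr)
    have hzk : 0 < ‖z‖ ^ k := by positivity
    calc |f z| * (1 + ‖z‖) ^ k ≤ (M' / ‖z‖ ^ k) * (2 ^ k * ‖z‖ ^ k) := by gcongr
      _ = 2 ^ k * M' := by field_simp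
      _ ≤ _ := by gcongr; linarith

theorem hasFDerivAt_inv_real {z : ℂ} (hz : z ≠ 0) :
    HasFDerivAt (fun w : ℂ => w⁻¹)
      ((ContinuousLinearMap.toSpanSingleton ℂ (-(z ^ 2)⁻¹)).restrictScalars ℝ) z :=
  ((hasDerivAt_inv hz).hasFDerivAt).restrictScalars ℝ

variable {φ ψ : P1 → ℝ}

theorem comp_chart_zero_eq {z : ℂ} (hz : z ≠ 0) : (φ ∘ chart 0) z = (φ ∘ chart 1) z⁻¹ := by
  simp [chart_one_eq_chart_zero hz]

theorem IsSmooth.fderiv_chart_zero (hφ : IsSmooth φ) {z : ℂ} (hz : z ≠ 0) (v : ℂ) :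
    fderiv ℝ (φ ∘ chart 0) z v = fderiv ℝ (φ ∘ chart 1) z⁻¹ (v * -(z ^ 2)⁻¹) := by
  have h1 : φ ∘ chart 0 =ᶠ[𝓝 z] fun w => (φ ∘ chart 1) w⁻¹ := by
    filter_upwards [isOpen_ne.mem_nhds hz] with w hw using comp_chart_zero_eq hw
  have h2 : HasFDerivAt (φ ∘ chart 1) (fderiv ℝ (φ ∘ chart 1) z⁻¹) z⁻¹ :=
    ((hφ.contDiff 1).differentiable (by norm_num) z⁻¹).hasFDerivAt
  have h3 : HasFDerivAt (fun w => (φ ∘ chart 1) w⁻¹) _ z := h2.comp z (hasFDerivAt_inv_real hz)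
  rw [h1.fderiv_eq, h3.fderiv]
  simp

/-- The transformation of the second derivative under the change of chart `z ↦ 1 / z`. -/
theorem IsSmooth.fderiv_fderiv_chart_zero (hφ : IsSmooth φ) {z : ℂ} (hz : z ≠ 0) (v : ℂ) :
    fderiv ℝ (fun w => fderiv ℝ (φ ∘ chart 0) w v) z v =
      fderiv ℝ (fderiv ℝ (φ ∘ chart 1)) z⁻¹ (v * -(z ^ 2)⁻¹) (v * -(z ^ 2)⁻¹) +
        fderiv ℝ (φ ∘ chart 1) z⁻¹ (v * (v * (2 * (z ^ 3)⁻¹))) := by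
  have h1 : (fun w => fderiv ℝ (φ ∘ chart 0) w v) =ᶠ[𝓝 z]
      fun w => fderiv ℝ (φ ∘ chart 1) w⁻¹ (v * -(w ^ 2)⁻¹) := by
    filter_upwards [isOpen_ne.mem_nhds hz] with w hw using hφ.fderiv_chart_zero hw v
  have h2 : HasFDerivAt (fderiv ℝ (φ ∘ chart 1)) (fderiv ℝ (fderiv ℝ (φ ∘ chart 1)) z⁻¹) z⁻¹ :=
    (((hφ.contDiff 1).fderiv_right (m := 1) (by norm_num)).differentiable (by norm_num)
      z⁻¹).hasFDerivAt
  have h3 : HasDerivAt (fun w : ℂ => v * -(w ^ 2)⁻¹) (v * (2 * (z ^ 3)⁻¹)) z := by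
    have := (((hasDerivAt_pow 2 z).fun_inv (pow_ne_zero 2 hz)).fun_neg).const_mul v
    refine this.congr_deriv ?_
    field_simp
    norm_num
    ring
  have h4 := (h2.comp z (hasFDerivAt_inv_real hz)).clm_apply (h3.hasFDerivAt.restrictScalars ℝ)
  rw [h1.fderiv_eq]
  have h5 := h4.fderiv
  simp only [Function.comp_apply] at h5
  rw [h5]
  simp [add_comm]

/-- The Laplacian of a smooth function on `P¹` decays like `|z|⁻⁴` in an affine chart: it is the
Laplacian in the coordinate `1 / z`, multiplied by the square of the modulus of the derivative `-1 /
z²`. -/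
theorem IsSmooth.abs_laplacian_le (hφ : IsSmooth φ) {z : ℂ} (hz : z ≠ 0) :
    |(Δ (φ ∘ chart 0)) z| ≤ 2 * ‖fderiv ℝ (fderiv ℝ (φ ∘ chart 1)) z⁻¹‖ / ‖z‖ ^ 4 := by
  set T := fderiv ℝ (fderiv ℝ (φ ∘ chart 1)) z⁻¹ with hT
  rw [laplacian_eq_fderiv (hφ.contDiff 0).contDiffAt, hφ.fderiv_fderiv_chart_zero hz,
    hφ.fderiv_fderiv_chart_zero hz]
  -- the first-order terms cancel since `1² + i² = 0`
  have hc : fderiv ℝ (φ ∘ chart 1) z⁻¹ (Complex.I * (Complex.I * (2 * (z ^ 3)⁻¹))) =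
      - fderiv ℝ (φ ∘ chart 1) z⁻¹ (1 * (1 * (2 * (z ^ 3)⁻¹))) := by
    rw [← map_neg]; congr 1; linear_combination (2 * (z ^ 3)⁻¹) * Complex.I_mul_I
  rw [hc]
  have hb : ∀ v : ℂ, ‖v‖ = 1 → |T (v * -(z ^ 2)⁻¹) (v * -(z ^ 2)⁻¹)| ≤ ‖T‖ / ‖z‖ ^ 4 := by
    intro v hv
    have h1 : ‖v * -(z ^ 2)⁻¹‖ = (‖z‖ ^ 2)⁻¹ := by simp [hv]
    have h2 := T.le_opNorm₂ (v * -(z ^ 2)⁻¹) (v * -(z ^ 2)⁻¹)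
    rw [h1, Real.norm_eq_abs] at h2
    refine h2.trans (le_of_eq ?_)
    have : ‖z‖ ≠ 0 := norm_ne_zero_iff.2 hz
    field_simp
  have h1 := hb 1 (by simp)
  have h2 := hb Complex.I (by simp)
  rw [abs_le] at *
  rw [mul_div_assoc]
  constructor <;> linarith [h1.1, h1.2, h2.1, h2.2]

theorem IsSmooth.continuous_laplacian (hφ : IsSmooth φ) : Continuous (Δ (φ ∘ chart 0)) := by
  have h : (Δ (φ ∘ chart 0)) = fun z => fderiv ℝ (fun w => fderiv ℝ (φ ∘ chart 0) w 1) z 1 +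
      fderiv ℝ (fun w => fderiv ℝ (φ ∘ chart 0) w Complex.I) z Complex.I :=
    funext fun z => laplacian_eq_fderiv (hφ.contDiff 0).contDiffAt
  have h1 : ∀ v : ℂ, Continuous fun z => fderiv ℝ (fun w => fderiv ℝ (φ ∘ chart 0) w v) z v := by
    intro v
    have h2 : ContDiff ℝ 1 (fun w => fderiv ℝ (φ ∘ chart 0) w v) :=
      ((hφ.contDiff 0).fderiv_right (m := 1) (by norm_num)).clm_apply contDiff_const
    exact (h2.continuous_fderiv (by norm_num)).clm_apply continuous_const
  rw [h]
  exact (h1 1).add (h1 Complex.I)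

theorem IsSmooth.exists_laplacian_bound (hφ : IsSmooth φ) :
    ∃ C, ∀ z, |(Δ (φ ∘ chart 0)) z| ≤ C / (1 + ‖z‖) ^ 4 := by
  refine exists_decay_bound hφ.continuous_laplacian
    (g := fun w => 2 * ‖fderiv ℝ (fderiv ℝ (φ ∘ chart 1)) w‖) ?_ (fun z hz => hφ.abs_laplacian_le hz)
  have := (((hφ.contDiff 1).fderiv_right (m := 1) (by norm_num)).continuous_fderiv (by norm_num))
  exact continuous_const.mul this.norm

theorem IsSmooth.exists_fderiv_bound (hφ : IsSmooth φ) {v : ℂ} (hv : ‖v‖ = 1) :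
    ∃ C, ∀ z, |fderiv ℝ (φ ∘ chart 0) z v| ≤ C / (1 + ‖z‖) ^ 2 := by
  refine exists_decay_bound (g := fun w => ‖fderiv ℝ (φ ∘ chart 1) w‖) ?_ ?_ (fun z hz => ?_)
  · exact ((hφ.contDiff 0).continuous_fderiv (by norm_num)).clm_apply continuous_const
  · exact ((hφ.contDiff 1).continuous_fderiv (by norm_num)).norm
  · rw [hφ.fderiv_chart_zero hz]
    refine ((fderiv ℝ (φ ∘ chart 1) z⁻¹).le_opNorm _).trans (le_of_eq ?_)
    simp [hv, div_eq_mul_inv]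

theorem integrable_one_add_norm_pow {k : ℕ} (hk : 2 < k) (C : ℝ) :
    Integrable (fun z : ℂ => C / (1 + ‖z‖) ^ k) := by
  have h := (integrable_one_add_norm (E := ℂ) (μ := volume) (r := (k : ℝ))
    (by rw [Complex.finrank_real_complex]; exact_mod_cast hk)).const_mul C
  refine h.congr (ae_of_all _ fun z => ?_)
  simp only
  rw [Real.rpow_neg (by positivity), Real.rpow_natCast, div_eq_mul_inv]

theorem IsSmooth.integrable_laplacian (hφ : IsSmooth φ) : Integrable (Δ (φ ∘ chart 0)) := by
  obtain ⟨C, hC⟩ := hφ.exists_laplacian_bound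
  exact (integrable_one_add_norm_pow (by norm_num) C).mono'
    hφ.continuous_laplacian.aestronglyMeasurable (ae_of_all _ hC)

theorem chart_continuous_comp (hφ : Continuous φ) (i : Fin 2) : Continuous (φ ∘ chart i) :=
  hφ.comp (continuous_chart i)

theorem exists_bound_P1 (hφ : Continuous φ) : ∃ M, ∀ x, |φ x| ≤ M := by
  obtain ⟨M, hM⟩ := (isCompact_univ (X := P1)).exists_bound_of_continuousOn hφ.continuousOn
  exact ⟨M, fun x => hM x (Set.mem_univ x)⟩

theorem IsSmooth.integrable_mul_laplacian (hφ : IsSmooth φ) (hψ : Continuous ψ) :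
    Integrable (fun z => ψ (chart 0 z) * (Δ (φ ∘ chart 0)) z) := by
  obtain ⟨M, hM⟩ := exists_bound_P1 hψ
  exact hφ.integrable_laplacian.bdd_mul (c := M)
    (chart_continuous_comp hψ 0).aestronglyMeasurable (ae_of_all _ fun z => hM _)

/-- The topology of `P¹`, a quotient of `ℂ² ∖ {0}`, is the one defined by the affine charts. -/
theorem continuous_of_charts {X : Type*} [TopologicalSpace X] {φ : P1 → X}
    (h : ∀ i, Continuous (φ ∘ chart i)) : Continuous φ := by
  refine continuous_coinduced_dom.2 (continuous_iff_continuousAt.2 fun v => ?_)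
  obtain ⟨i, hi⟩ : ∃ i, v.1 i ≠ 0 := by
    by_contra! hc
    exact v.2 (by ext i; simpa using hc i)
  have hc : ContinuousAt (fun w : { v : C2 // v ≠ 0 } => (φ ∘ chart i) (w.1 (1 - i) / w.1 i)) v := by
    refine (h i).continuousAt.comp (ContinuousAt.div ?_ ?_ hi)
    · exact Continuous.continuousAt (by fun_prop)
    · exact Continuous.continuousAt (by fun_prop)
  refine hc.congr ?_
  have hn : ∀ᶠ w : { v : C2 // v ≠ 0 } in 𝓝 v, w.1 i ≠ 0 := by
    have : Continuous fun w : { v : C2 // v ≠ 0 } => w.1 i := by fun_prop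
    exact this.continuousAt.eventually_ne hi
  filter_upwards [hn] with w hw
  simp only [Function.comp_apply]
  congr 1
  rw [Projectivization.mk'_eq_mk]
  unfold chart
  rw [← wedge_eq_zero_iff]
  unfold wedge
  fin_cases i
  · simp at hw ⊢; field_simp; simp
  · simp at hw ⊢; field_simp; simp

theorem IsSmooth.continuous {φ : P1 → ℝ} (hφ : IsSmooth φ) : Continuous φ :=
  continuous_of_charts fun i => (hφ i).continuous

/-! ### Green's identity on `P¹` -/

/-- Integration by parts on `ℂ` for a field decaying like `|z|⁻²` : cut off at radius `R`, the
boundary term is `O(1/R)`. -/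
theorem integral_eq_zero_of_divergence {W₁ W₂ : ℂ → ℝ} (h₁ : ContDiff ℝ 1 W₁) (h₂ : ContDiff ℝ 1 W₂)
    {C : ℝ} (b₁ : ∀ z, |W₁ z| ≤ C / (1 + ‖z‖) ^ 2) (b₂ : ∀ z, |W₂ z| ≤ C / (1 + ‖z‖) ^ 2)
    (hi : Integrable fun z => fderiv ℝ W₁ z 1 + fderiv ℝ W₂ z Complex.I) :
    ∫ z, (fderiv ℝ W₁ z 1 + fderiv ℝ W₂ z Complex.I) = 0 := by
  let χ : ContDiffBump (0 : ℂ) := ⟨1, 2, by norm_num, by norm_num⟩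
  have hχ : ContDiff ℝ 1 χ := χ.contDiff
  -- the cut-off at scale `n + 1`
  let s : ℕ → ℝ := fun n => ((n : ℝ) + 1)⁻¹
  have hs0 : ∀ n, 0 < s n := fun n => by positivity
  have hs1 : ∀ n, s n ≤ 1 := fun n => inv_le_one_of_one_le₀ (by simp)
  have hslim : Tendsto s atTop (𝓝 0) := tendsto_one_div_add_atTop_nhds_zero_nat.congr (by simp [s])
  let X : ℕ → ℂ → ℝ := fun n z => χ (s n • z)
  have hX : ∀ n, ContDiff ℝ 1 (X n) := fun n => hχ.comp (contDiff_const_smul _)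
  have hXc : ∀ n, HasCompactSupport (X n) := fun n =>
    χ.hasCompactSupport.comp_homeomorph (Homeomorph.smulOfNeZero (s n) (hs0 n).ne')
  have hXd : ∀ n z v, fderiv ℝ (X n) z v = s n * fderiv ℝ χ (s n • z) v := by
    intro n z v
    have h := ((hχ.differentiable (by norm_num) (s n • z)).hasFDerivAt.comp z
      ((hasFDerivAt_id z).const_smul (s n)))
    have h' : HasFDerivAt (X n) _ z := h
    rw [h'.fderiv]
    simp
  have hparts : ∀ (n : ℕ) {W : ℂ → ℝ} (_ : ContDiff ℝ 1 W) (v : ℂ),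
      Integrable (fun z => X n z * fderiv ℝ W z v) ∧ Integrable (fun z => fderiv ℝ (X n) z v * W z) ∧
      ∫ z, X n z * fderiv ℝ W z v = - ∫ z, fderiv ℝ (X n) z v * W z := by
    intro n W hW v
    have c1 : Continuous fun z => fderiv ℝ W z v :=
      (hW.continuous_fderiv (by norm_num)).clm_apply continuous_const
    have c2 : Continuous fun z => fderiv ℝ (X n) z v :=
      ((hX n).continuous_fderiv (by norm_num)).clm_apply continuous_const
    have i1 : Integrable (fun z => X n z * fderiv ℝ W z v) :=
      ((hX n).continuous.mul c1).integrable_of_hasCompactSupport (hXc n).mul_right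
    have i2 : Integrable (fun z => fderiv ℝ (X n) z v * W z) :=
      (c2.mul hW.continuous).integrable_of_hasCompactSupport ((hXc n).fderiv_apply ℝ v).mul_right
    have i3 : Integrable (fun z => X n z * W z) :=
      ((hX n).continuous.mul hW.continuous).integrable_of_hasCompactSupport (hXc n).mul_right
    exact ⟨i1, i2, integral_mul_fderiv_eq_neg_fderiv_mul_of_integrable i2 i1 i3
      (fun x _ => (hX n).differentiable (by norm_num) x)
      (fun x _ => hW.differentiable (by norm_num) x)⟩
  obtain ⟨K, hK0, hK⟩ : ∃ K, 0 ≤ K ∧ ∀ w v : ℂ, ‖v‖ = 1 → |fderiv ℝ χ w v| * (1 + ‖w‖) ≤ K := by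
    have c : Continuous fun w => ‖fderiv ℝ χ w‖ * (1 + ‖w‖) := by
      have := hχ.continuous_fderiv (by norm_num); fun_prop
    have hc : HasCompactSupport fun w => ‖fderiv ℝ χ w‖ * (1 + ‖w‖) :=
      (χ.hasCompactSupport.fderiv ℝ).norm.mul_right
    obtain ⟨K, hK⟩ := hc.exists_bound_of_continuous c
    refine ⟨K, (norm_nonneg _).trans (hK 0), fun w v hv => ?_⟩
    have h1 := (fderiv ℝ χ w).le_opNorm v
    rw [hv, mul_one, Real.norm_eq_abs] at h1
    calc |fderiv ℝ χ w v| * (1 + ‖w‖) ≤ ‖fderiv ℝ χ w‖ * (1 + ‖w‖) := by gcongr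
      _ ≤ K := (le_abs_self _).trans (hK w)
  have hXb : ∀ n z (v : ℂ), ‖v‖ = 1 → |fderiv ℝ (X n) z v| ≤ K / (1 + ‖z‖) := by
    intro n z v hv
    rw [hXd, abs_mul, abs_of_pos (hs0 n), le_div_iff₀ (by positivity)]
    have h1 := hK (s n • z) v hv
    rw [norm_smul, Real.norm_of_nonneg (hs0 n).le] at h1
    calc s n * |fderiv ℝ χ (s n • z) v| * (1 + ‖z‖)
        = |fderiv ℝ χ (s n • z) v| * (s n + s n * ‖z‖) := by ring
      _ ≤ |fderiv ℝ χ (s n • z) v| * (1 + s n * ‖z‖) := by gcongr; exact hs1 n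
      _ ≤ K := h1
  have hXlim : ∀ z (v : ℂ), ‖v‖ = 1 → Tendsto (fun n => fderiv ℝ (X n) z v) atTop (𝓝 0) := by
    intro z v hv
    refine squeeze_zero_norm (a := fun n => s n * K) (fun n => ?_) (by simpa using hslim.mul_const K)
    rw [hXd, norm_mul, Real.norm_of_nonneg (hs0 n).le]
    gcongr
    refine le_trans ?_ (hK (s n • z) v hv)
    exact le_mul_of_one_le_right (abs_nonneg _) (le_add_of_nonneg_right (norm_nonneg _))
  have hC : 0 ≤ C := by simpa using (abs_nonneg _).trans (b₁ 0)
  have hlim0 : ∀ {W : ℂ → ℝ} (_ : ContDiff ℝ 1 W) (_ : ∀ z, |W z| ≤ C / (1 + ‖z‖) ^ 2) (v : ℂ)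
      (_ : ‖v‖ = 1), Tendsto (fun n => ∫ z, fderiv ℝ (X n) z v * W z) atTop (𝓝 0) := by
    intro W hW hb v hv
    have := tendsto_integral_of_dominated_convergence (μ := volume) (F := fun n z => fderiv ℝ (X n) z v * W z)
      (f := fun _ => (0 : ℝ)) (fun z => K * C / (1 + ‖z‖) ^ 3)
      (fun n => (hparts n hW v).2.1.aestronglyMeasurable)
      (integrable_one_add_norm_pow (by norm_num) _)
      (fun n => ae_of_all _ fun z => ?_) (ae_of_all _ fun z => ?_)
    · simpa using this
    · rw [norm_mul]
      calc ‖fderiv ℝ (X n) z v‖ * ‖W z‖ ≤ (K / (1 + ‖z‖)) * (C / (1 + ‖z‖) ^ 2) :=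
            mul_le_mul (hXb n z v hv) (hb z) (norm_nonneg _) (by positivity)
        _ = K * C / (1 + ‖z‖) ^ 3 := by
            have : (1 + ‖z‖) ≠ 0 := by positivity
            field_simp
    · simpa using (hXlim z v hv).mul_const (W z)
  have hleft : Tendsto (fun n => ∫ z, X n z * (fderiv ℝ W₁ z 1 + fderiv ℝ W₂ z Complex.I)) atTop
      (𝓝 (∫ z, (fderiv ℝ W₁ z 1 + fderiv ℝ W₂ z Complex.I))) := by
    refine tendsto_integral_of_dominated_convergence
      (fun z => ‖fderiv ℝ W₁ z 1 + fderiv ℝ W₂ z Complex.I‖) (fun n => ?_) hi.norm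
      (fun n => ae_of_all _ fun z => ?_) (ae_of_all _ fun z => ?_)
    · exact (hX n).continuous.aestronglyMeasurable.mul hi.aestronglyMeasurable
    · rw [norm_mul, Real.norm_of_nonneg χ.nonneg]
      exact mul_le_of_le_one_left (norm_nonneg _) χ.le_one
    · have h1 : Tendsto (fun n => X n z) atTop (𝓝 1) := by
        have h2 : Tendsto (fun n => s n • z) atTop (𝓝 0) := by simpa using hslim.smul_const z
        have h3 := (χ.continuous.tendsto 0).comp h2
        have h4 : χ (0 : ℂ) = 1 := χ.one_of_mem_closedBall (by simp [χ])
        rw [h4] at h3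
        exact h3
      simpa using h1.mul_const (fderiv ℝ W₁ z 1 + fderiv ℝ W₂ z Complex.I)
  have hright : Tendsto (fun n => ∫ z, X n z * (fderiv ℝ W₁ z 1 + fderiv ℝ W₂ z Complex.I)) atTop
      (𝓝 0) := by
    have h := ((hlim0 h₁ b₁ 1 (by simp)).neg).add ((hlim0 h₂ b₂ Complex.I (by simp)).neg)
    simp only [neg_zero, add_zero] at h
    refine h.congr fun n => ?_
    rw [← (hparts n h₁ 1).2.2, ← (hparts n h₂ Complex.I).2.2,
      ← integral_add (hparts n h₁ 1).1 (hparts n h₂ Complex.I).1]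
    simp only [mul_add]
  exact tendsto_nhds_unique hleft hright

/-- `dd^c` is symmetric on smooth functions on `P¹`. -/
theorem IsSmooth.integral_mul_laplacian_comm {φ ψ : P1 → ℝ} (hφ : IsSmooth φ) (hψ : IsSmooth ψ) :
    ∫ z, ψ (chart 0 z) * (Δ (φ ∘ chart 0)) z = ∫ z, φ (chart 0 z) * (Δ (ψ ∘ chart 0)) z := by
  rw [← sub_eq_zero, ← integral_sub (hφ.integrable_mul_laplacian hψ.continuous)
    (hψ.integrable_mul_laplacian hφ.continuous)]
  have hint := (hφ.integrable_mul_laplacian hψ.continuous).sub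
    (hψ.integrable_mul_laplacian hφ.continuous)
  have cφ := hφ.contDiff 0
  have cψ := hψ.contDiff 0
  have d1 : ∀ {u : ℂ → ℝ} (_ : ContDiff ℝ 2 u) (v : ℂ), ContDiff ℝ 1 fun z => fderiv ℝ u z v :=
    fun hu v => (hu.fderiv_right (m := 1) (by norm_num)).clm_apply contDiff_const
  let W : ℂ → ℂ → ℝ := fun v z => (ψ ∘ chart 0) z * fderiv ℝ (φ ∘ chart 0) z v -
    (φ ∘ chart 0) z * fderiv ℝ (ψ ∘ chart 0) z v
  have hW : ∀ v, ContDiff ℝ 1 (W v) := fun v =>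
    ((cψ.of_le (by norm_num)).mul (d1 cφ v)).sub ((cφ.of_le (by norm_num)).mul (d1 cψ v))
  have hWd : ∀ v z, fderiv ℝ (W v) z v =
      (ψ ∘ chart 0) z * fderiv ℝ (fun w => fderiv ℝ (φ ∘ chart 0) w v) z v -
      (φ ∘ chart 0) z * fderiv ℝ (fun w => fderiv ℝ (ψ ∘ chart 0) w v) z v := by
    intro v z
    have a1 := (cψ.differentiable (by norm_num) z).hasFDerivAt
    have a2 := (cφ.differentiable (by norm_num) z).hasFDerivAt
    have a3 := ((d1 cφ v).differentiable (by norm_num) z).hasFDerivAt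
    have a4 := ((d1 cψ v).differentiable (by norm_num) z).hasFDerivAt
    have a5 : HasFDerivAt (W v) _ z := (a1.mul a3).sub (a2.mul a4)
    rw [a5.fderiv]
    simp only [sub_apply, add_apply,
      smul_apply, smul_eq_mul]
    ring
  have hdiv : (fun z => ψ (chart 0 z) * (Δ (φ ∘ chart 0)) z - φ (chart 0 z) * (Δ (ψ ∘ chart 0)) z) =
      fun z => fderiv ℝ (W 1) z 1 + fderiv ℝ (W Complex.I) z Complex.I := by
    funext z
    rw [hWd, hWd, laplacian_eq_fderiv cφ.contDiffAt, laplacian_eq_fderiv cψ.contDiffAt]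
    simp only [Function.comp_apply]
    ring
  have hb : ∀ v : ℂ, ‖v‖ = 1 → ∃ C, ∀ z, |W v z| ≤ C / (1 + ‖z‖) ^ 2 := by
    intro v hv
    obtain ⟨A, hA⟩ := hφ.exists_fderiv_bound hv
    obtain ⟨B, hB⟩ := hψ.exists_fderiv_bound hv
    obtain ⟨M, hM⟩ := exists_bound_P1 hφ.continuous
    obtain ⟨M', hM'⟩ := exists_bound_P1 hψ.continuous
    have hM0 : 0 ≤ M := (abs_nonneg _).trans (hM (chart 0 0))
    have hM0' : 0 ≤ M' := (abs_nonneg _).trans (hM' (chart 0 0))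
    refine ⟨M' * A + M * B, fun z => ?_⟩
    refine (abs_sub _ _).trans ?_
    rw [abs_mul, abs_mul, add_div, mul_div_assoc, mul_div_assoc]
    exact add_le_add (mul_le_mul (hM' _) (hA z) (abs_nonneg _) hM0')
      (mul_le_mul (hM _) (hB z) (abs_nonneg _) hM0)
  obtain ⟨C₁, hC₁⟩ := hb 1 (by simp)
  obtain ⟨C₂, hC₂⟩ := hb Complex.I (by simp)
  have hint' : Integrable fun z => fderiv ℝ (W 1) z 1 + fderiv ℝ (W Complex.I) z Complex.I := by
    rw [← hdiv]; exact hint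
  rw [hdiv]
  refine integral_eq_zero_of_divergence (hW 1) (hW Complex.I) (C := max C₁ C₂)
    (fun z => (hC₁ z).trans ?_) (fun z => (hC₂ z).trans ?_) hint'
  · gcongr; exact le_max_left _ _
  · gcongr; exact le_max_right _ _

/-! ### Homogeneous maps of `ℂ²` and their potentials -/

/-- A holomorphic map `ℂ² → ℂ²`, homogeneous of degree `k` and non-degenerate. -/
structure IsHomMap (k : ℕ) (H : C2 → C2) : Prop where
  contDiff : ContDiff ℂ ∞ H
  map_smul : ∀ (a : ℂ) (v : C2), H (a • v) = a ^ k • H v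
  ne_zero : ∀ v, v ≠ 0 → H v ≠ 0

theorem isHomMap_id : IsHomMap 1 id :=
  ⟨contDiff_id, fun a v => by simp, fun _ hv => hv⟩

theorem IsHomMap.comp {k l : ℕ} {H K : C2 → C2} (hH : IsHomMap k H) (hK : IsHomMap l K) :
    IsHomMap (l * k) (H ∘ K) :=
  ⟨hH.contDiff.comp hK.contDiff,
    fun a v => by simp only [Function.comp_apply, hK.map_smul, hH.map_smul, pow_mul],
    fun v hv => hH.ne_zero _ (hK.ne_zero v hv)⟩

theorem IsHomMap.iterate {k : ℕ} {H : C2 → C2} (hH : IsHomMap k H) (n : ℕ) :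
    IsHomMap (k ^ n) (H^[n]) := by
  induction n with
  | zero => simpa using isHomMap_id
  | succ n ih =>
    rw [Function.iterate_succ, pow_succ, mul_comm]
    exact ih.comp hH

/-- The function `log ‖H v‖ - k log ‖v‖` on `P¹`. -/
def homPotential (k : ℕ) (H : C2 → C2) (x : P1) : ℝ := Real.log ‖H x.rep‖ - k * Real.log ‖x.rep‖

variable {k : ℕ} {H : C2 → C2}

theorem IsHomMap.homPotential_mk (hH : IsHomMap k H) (v : C2) (hv : v ≠ 0) :
    homPotential k H (Projectivization.mk ℂ v hv) = Real.log ‖H v‖ - k * Real.log ‖v‖ := by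
  refine apply_rep_mk (Φ := fun v => Real.log ‖H v‖ - k * Real.log ‖v‖) ?_ v hv
  intro a ha v hv
  have h1 := norm_ne_zero_iff.2 ha
  have h2 := norm_ne_zero_iff.2 hv
  have h3 := norm_ne_zero_iff.2 (hH.ne_zero v hv)
  simp only [hH.map_smul, norm_smul, norm_pow]
  rw [Real.log_mul (pow_ne_zero _ h1) h3, Real.log_mul h1 h2, Real.log_pow]
  ring

theorem contDiff_affineVec (i : Fin 2) : ContDiff ℂ ∞ (affineVec i) := by
  rw [contDiff_euclidean]
  intro j
  fin_cases i <;> fin_cases j <;> simp <;> fun_prop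

theorem IsHomMap.contDiff_comp_affineVec (hH : IsHomMap k H) (i : Fin 2) :
    ContDiff ℂ ∞ (fun z => H (affineVec i z)) :=
  hH.contDiff.comp (contDiff_affineVec i)

theorem IsHomMap.isSmooth (hH : IsHomMap k H) : IsSmooth (homPotential k H) := by
  intro i
  have h : homPotential k H ∘ chart i =
      fun z => Real.log ‖H (affineVec i z)‖ - k * Real.log ‖affineVec i z‖ := by
    funext z
    exact hH.homPotential_mk _ (affineVec_ne_zero i z)
  rw [h]
  have h1 := affineVec_ne_zero i
  have h2 := fun z => hH.ne_zero _ (h1 z)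
  have c1 : ContDiff ℝ ∞ (affineVec i) := (contDiff_affineVec i).restrict_scalars ℝ
  have c2 : ContDiff ℝ ∞ fun z => H (affineVec i z) := (hH.contDiff_comp_affineVec i).restrict_scalars ℝ
  exact ((c2.norm ℝ h2).log fun z => norm_ne_zero_iff.2 (h2 z)).sub
    (contDiff_const.mul ((c1.norm ℝ h1).log fun z => norm_ne_zero_iff.2 (h1 z)))

/-- The Wronskian `H₀ H₁' - H₁ H₀'` of `H` in the affine chart `z ↦ [1 : z]`. -/
def affineWronskian (H : C2 → C2) (z : ℂ) : ℂ :=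
  H (affineVec 0 z) 0 * deriv (fun w => H (affineVec 0 w) 1) z -
    H (affineVec 0 z) 1 * deriv (fun w => H (affineVec 0 w) 0) z

theorem log_norm_C2 (v : C2) : Real.log ‖v‖ = 1 / 2 * Real.log (‖v 0‖ ^ 2 + ‖v 1‖ ^ 2) := by
  rw [← norm_sq_C2, Real.log_pow]; push_cast; ring

/-- In the affine chart, `dd^c log ‖H‖` has density `|H₀ H₁' - H₁ H₀'|² / (π ‖H‖⁴)`, and `dd^c log
‖·‖` is the Fubini-Study form. -/
theorem IsHomMap.laplacian_homPotential (hH : IsHomMap k H) (z : ℂ) :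
    (Δ (homPotential k H ∘ chart 0)) z =
      2 * ‖affineWronskian H z‖ ^ 2 / ‖H (affineVec 0 z)‖ ^ 4 - k * (2 / (1 + ‖z‖ ^ 2) ^ 2) := by
  have hp : ∀ j, Differentiable ℂ (fun z => H (affineVec 0 z) j) := fun j =>
    ((contDiff_euclidean.1 (hH.contDiff_comp_affineVec 0)) j).differentiable (by norm_num)
  have h0 : ∀ z, H (affineVec 0 z) 0 ≠ 0 ∨ H (affineVec 0 z) 1 ≠ 0 := by
    intro z
    by_contra! hc
    refine hH.ne_zero _ (affineVec_ne_zero 0 z) ?_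
    ext j; fin_cases j
    · exact hc.1
    · exact hc.2
  have h : homPotential k H ∘ chart 0 =
      (fun z => (1 / 2 : ℝ) * Real.log (‖H (affineVec 0 z) 0‖ ^ 2 + ‖H (affineVec 0 z) 1‖ ^ 2)) -
        (k : ℝ) • fun z => (1 / 2 : ℝ) * Real.log (‖(1 : ℂ)‖ ^ 2 + ‖z‖ ^ 2) := by
    funext z
    refine (hH.homPotential_mk _ (affineVec_ne_zero 0 z)).trans ?_
    rw [log_norm_C2, log_norm_C2]
    simp
  have e1 := laplacian_log_norm (hp 0) (hp 1) h0 z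
  have e2 := laplacian_log_norm (p := fun _ => 1) (q := fun z => z) (differentiable_const _)
    differentiable_id (fun _ => Or.inl one_ne_zero) z
  have c1 : ContDiffAt ℝ 2 (fun z => (1 / 2 : ℝ) *
      Real.log (‖H (affineVec 0 z) 0‖ ^ 2 + ‖H (affineVec 0 z) 1‖ ^ 2)) z := by
    have hc : ∀ j, ContDiff ℝ 2 (fun z => ‖H (affineVec 0 z) j‖ ^ 2) := fun j =>
      (((hp j).contDiff (n := 2)).restrict_scalars ℝ).norm_sq ℝ
    refine contDiffAt_const.mul (((hc 0).add (hc 1)).contDiffAt.log ?_)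
    rcases h0 z with h | h
    · have := norm_pos_iff.2 h; positivity
    · have := norm_pos_iff.2 h; positivity
  have c2 : ContDiffAt ℝ 2 (fun z : ℂ => (1 / 2 : ℝ) * Real.log (‖(1 : ℂ)‖ ^ 2 + ‖z‖ ^ 2)) z := by
    refine contDiffAt_const.mul ((contDiff_const.add (contDiff_id.norm_sq ℝ)).contDiffAt.log ?_)
    simp only [norm_one]; positivity
  have c3 : ContDiffAt ℝ 2 ((k : ℝ) • fun z : ℂ => (1 / 2 : ℝ) * Real.log (‖(1 : ℂ)‖ ^ 2 + ‖z‖ ^ 2)) z :=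
    contDiffAt_const.smul c2
  rw [h, c1.laplacian_sub c3, InnerProductSpace.laplacian_smul _ c2, e1, e2]
  simp only [affineWronskian, smul_eq_mul]
  congr 1
  · rw [show ‖H (affineVec 0 z)‖ ^ 4 = (‖H (affineVec 0 z)‖ ^ 2) ^ 2 by ring, norm_sq_C2]
  · simp

/-! ### The Green function -/

theorem eval_smul_of_isHomogeneous {p : MvPolynomial (Fin 2) ℂ} {n : ℕ} (hp : p.IsHomogeneous n)
    (a : ℂ) (z : C2) :
    MvPolynomial.eval (fun j => (a • z) j) p = a ^ n * MvPolynomial.eval (fun j => z j) p := by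
  rw [MvPolynomial.eval_eq', MvPolynomial.eval_eq', Finset.mul_sum]
  refine Finset.sum_congr rfl fun s hs => ?_
  have h := hp.degree_eq_sum_deg_support hs
  have h2 : s.sum (fun _ e => e) = ∑ i, s i := Finsupp.sum_fintype _ _ (fun _ => rfl)
  simp only [PiLp.smul_apply, smul_eq_mul, mul_pow, Finset.prod_mul_distrib, Finset.prod_pow_eq_pow_sum]
  have h3 : ∑ i, s i = n := by
    rw [h, ← h2]; rfl
  rw [h3]; ring

theorem contDiff_eval (p : MvPolynomial (Fin 2) ℂ) :
    ContDiff ℂ ∞ (fun z : C2 => MvPolynomial.eval (fun j => z j) p) := by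
  induction p using MvPolynomial.induction_on with
  | C a => simpa using contDiff_const
  | add p q hp hq => simpa using hp.add hq
  | mul_X p i hp => simpa using hp.mul (by fun_prop : ContDiff ℂ ∞ fun z : C2 => z i)

variable {d : ℕ} {F : Fin 2 → MvPolynomial (Fin 2) ℂ} {f : P1 → P1}

theorem IsLift.isHomMap (hF : IsLift d F f) : IsHomMap d (polyMap F) where
  contDiff := contDiff_euclidean.2 fun i => contDiff_eval (F i)
  map_smul a v := by
    ext i
    exact eval_smul_of_isHomogeneous (hF.homogeneous i) a v
  ne_zero := hF.nondegenerate

theorem IsLift.exists_log_bound (hF : IsLift d F f) :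
    ∃ M, ∀ v : C2, v ≠ 0 → |Real.log ‖polyMap F v‖ - d * Real.log ‖v‖| ≤ M := by
  obtain ⟨M, hM⟩ := exists_bound_P1 hF.isHomMap.isSmooth.continuous
  refine ⟨M, fun v hv => ?_⟩
  rw [← hF.isHomMap.homPotential_mk v hv]
  exact hM _

/-- The approximations `d⁻ⁿ log ‖Fⁿ‖` converge geometrically, uniformly on `ℂ² ∖ {0}`. -/
theorem IsLift.exists_greenFun_bound (hF : IsLift d F f) (hd : 2 ≤ d) :
    ∃ C, ∀ v : C2, v ≠ 0 →
      Tendsto (fun n : ℕ => ((d : ℝ) ^ n)⁻¹ * Real.log ‖(polyMap F)^[n] v‖) atTop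
        (𝓝 (greenFun d F v)) ∧
      ∀ n : ℕ, |((d : ℝ) ^ n)⁻¹ * Real.log ‖(polyMap F)^[n] v‖ - greenFun d F v| ≤
        C * ((d : ℝ)⁻¹) ^ n := by
  obtain ⟨M, hM⟩ := hF.exists_log_bound
  have hd0 : (0 : ℝ) < d := by positivity
  have hr : (d : ℝ)⁻¹ < 1 := inv_lt_one_of_one_lt₀ (by exact_mod_cast hd)
  refine ⟨M * (d : ℝ)⁻¹ / (1 - (d : ℝ)⁻¹), fun v hv => ?_⟩
  have hstep : ∀ n : ℕ, dist (((d : ℝ) ^ n)⁻¹ * Real.log ‖(polyMap F)^[n] v‖)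
      (((d : ℝ) ^ (n + 1))⁻¹ * Real.log ‖(polyMap F)^[n + 1] v‖) ≤ M * (d : ℝ)⁻¹ * ((d : ℝ)⁻¹) ^ n := by
    intro n
    have h1 := hM _ ((hF.isHomMap.iterate n).ne_zero v hv)
    rw [Function.iterate_succ_apply', dist_comm, Real.dist_eq]
    set w := (polyMap F)^[n] v
    have h2 : ((d : ℝ) ^ (n + 1))⁻¹ * Real.log ‖polyMap F w‖ - ((d : ℝ) ^ n)⁻¹ * Real.log ‖w‖ =
        ((d : ℝ)⁻¹) ^ (n + 1) * (Real.log ‖polyMap F w‖ - d * Real.log ‖w‖) := by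
      rw [inv_pow, pow_succ]; field_simp
    rw [h2, abs_mul, abs_of_nonneg (by positivity), pow_succ]
    calc ((d : ℝ)⁻¹) ^ n * (d : ℝ)⁻¹ * |Real.log ‖polyMap F w‖ - d * Real.log ‖w‖|
        ≤ ((d : ℝ)⁻¹) ^ n * (d : ℝ)⁻¹ * M := by gcongr
      _ = _ := by ring
  have hlim : Tendsto (fun n : ℕ => ((d : ℝ) ^ n)⁻¹ * Real.log ‖(polyMap F)^[n] v‖) atTop
      (𝓝 (greenFun d F v)) :=
    tendsto_nhds_limUnder (cauchySeq_tendsto_of_complete (cauchySeq_of_le_geometric _ _ hr hstep))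
  refine ⟨hlim, fun n => ?_⟩
  have := dist_le_of_le_geometric_of_tendsto _ _ hr hstep hlim n
  rw [Real.dist_eq] at this
  refine this.trans (le_of_eq ?_)
  ring

theorem IsLift.tendsto_greenFun (hF : IsLift d F f) (hd : 2 ≤ d) {v : C2} (hv : v ≠ 0) :
    Tendsto (fun n : ℕ => ((d : ℝ) ^ n)⁻¹ * Real.log ‖(polyMap F)^[n] v‖) atTop
      (𝓝 (greenFun d F v)) := by
  obtain ⟨C, hC⟩ := hF.exists_greenFun_bound hd
  exact (hC v hv).1

theorem IsLift.greenFun_smul (hF : IsLift d F f) (hd : 2 ≤ d) {a : ℂ} (ha : a ≠ 0) {v : C2}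
    (hv : v ≠ 0) : greenFun d F (a • v) = greenFun d F v + Real.log ‖a‖ := by
  refine tendsto_nhds_unique (hF.tendsto_greenFun hd (smul_ne_zero ha hv))
    (((hF.tendsto_greenFun hd hv).add_const (Real.log ‖a‖)).congr fun n => ?_)
  have hn := hF.isHomMap.iterate n
  have hd0 : (d : ℝ) ≠ 0 := by positivity
  rw [hn.map_smul, norm_smul, norm_pow, Real.log_mul (pow_ne_zero _ (norm_ne_zero_iff.2 ha))
    (norm_ne_zero_iff.2 (hn.ne_zero v hv)), Real.log_pow]
  push_cast
  field_simp
  ring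

theorem IsLift.greenFun_map (hF : IsLift d F f) (hd : 2 ≤ d) {v : C2} (hv : v ≠ 0) :
    greenFun d F (polyMap F v) = d * greenFun d F v := by
  have h1 := ((hF.tendsto_greenFun hd hv).comp (tendsto_add_atTop_nat 1)).const_mul (d : ℝ)
  refine tendsto_nhds_unique (hF.tendsto_greenFun hd (hF.nondegenerate v hv)) (h1.congr fun n => ?_)
  have hd0 : (d : ℝ) ≠ 0 := by positivity
  simp only [Function.comp_apply, Function.iterate_succ_apply, pow_succ]
  field_simp

theorem IsLift.greenFunP1_mk (hF : IsLift d F f) (hd : 2 ≤ d) (v : C2) (hv : v ≠ 0) :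
    greenFunP1 d F (Projectivization.mk ℂ v hv) = greenFun d F v - Real.log ‖v‖ := by
  refine apply_rep_mk (Φ := fun v => greenFun d F v - Real.log ‖v‖) (fun a ha v hv => ?_) v hv
  rw [hF.greenFun_smul hd ha hv, norm_smul, Real.log_mul (norm_ne_zero_iff.2 ha)
    (norm_ne_zero_iff.2 hv)]
  ring

/-- `g_F` is the uniform limit of the smooth functions `d⁻ⁿ log ‖Fⁿ‖ - log ‖·‖`. -/
theorem IsLift.exists_greenFunP1_bound (hF : IsLift d F f) (hd : 2 ≤ d) :
    ∃ C, ∀ (n : ℕ) (x : P1),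
      |((d : ℝ) ^ n)⁻¹ * homPotential (d ^ n) (polyMap F)^[n] x - greenFunP1 d F x| ≤
        C * ((d : ℝ)⁻¹) ^ n := by
  obtain ⟨C, hC⟩ := hF.exists_greenFun_bound hd
  refine ⟨C, fun n x => ?_⟩
  refine le_trans (le_of_eq ?_) ((hC x.rep x.rep_nonzero).2 n)
  congr 1
  unfold homPotential greenFunP1
  have hd0 : (d : ℝ) ≠ 0 := by positivity
  push_cast
  field_simp
  ring

theorem tendsto_inv_pow_atTop (hd : 2 ≤ d) (C : ℝ) :
    Tendsto (fun n : ℕ => C * ((d : ℝ)⁻¹) ^ n) atTop (𝓝 0) := by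
  have hr : (d : ℝ)⁻¹ < 1 := inv_lt_one_of_one_lt₀ (by exact_mod_cast hd)
  simpa using (tendsto_pow_atTop_nhds_zero_of_lt_one (by positivity) hr).const_mul C

theorem IsLift.continuous_greenFunP1 (hF : IsLift d F f) (hd : 2 ≤ d) :
    Continuous (greenFunP1 d F) := by
  obtain ⟨C, hC⟩ := hF.exists_greenFunP1_bound hd
  have h : TendstoUniformly
      (fun (n : ℕ) x => ((d : ℝ) ^ n)⁻¹ * homPotential (d ^ n) (polyMap F)^[n] x)
      (greenFunP1 d F) atTop := by
    rw [Metric.tendstoUniformly_iff]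
    intro ε hε
    filter_upwards [(tendsto_inv_pow_atTop hd C).eventually_lt_const hε] with n hn x
    rw [dist_comm, Real.dist_eq]
    exact (hC n x).trans_lt hn
  refine h.continuous (Eventually.of_forall fun n => ?_).frequently
  exact continuous_const.mul (hF.isHomMap.iterate n).isSmooth.continuous

/-- The functional equation `G_F ∘ F = d G_F`, read on `P¹`. -/
theorem IsLift.greenFunP1_comp (hF : IsLift d F f) (hd : 2 ≤ d) (x : P1) :
    greenFunP1 d F (f x) - d * greenFunP1 d F x = -homPotential d (polyMap F) x := by
  induction x using Projectivization.ind with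
  | h v hv =>
    rw [hF.semiconj v hv, hF.greenFunP1_mk hd, hF.greenFunP1_mk hd, hF.isHomMap.homPotential_mk,
      hF.greenFun_map hd hv]
    ring

/-! ### The Fubini-Study measure -/

/-- `ℂ²` is isometric to the Hilbert sum `ℂ ⊕ ℂ`. -/
def isometryProd : C2 ≃ₗᵢ[ℝ] WithLp 2 (ℂ × ℂ) where
  toFun v := WithLp.toLp 2 (v 0, v 1)
  invFun w := WithLp.toLp 2 ![w.fst, w.snd]
  map_add' v w := rfl
  map_smul' r v := rfl
  left_inv v := by ext i; fin_cases i <;> rfl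
  right_inv w := rfl
  norm_map' v := by
    refine (sq_eq_sq₀ (norm_nonneg _) (norm_nonneg _)).1 ?_
    rw [norm_sq_C2]
    exact WithLp.prod_norm_sq_eq_of_L2 _

theorem finrank_real_C2 : Module.finrank ℝ C2 = 4 := by
  rw [isometryProd.toLinearEquiv.finrank_eq, (WithLp.linearEquiv 2 ℝ (ℂ × ℂ)).finrank_eq,
    Module.finrank_prod, Complex.finrank_real_complex]

theorem lintegral_C2 {Ψ : C2 → ℝ≥0∞} (hΨ : Measurable Ψ) :
    ∫⁻ v, Ψ v = ∫⁻ a : ℂ, ∫⁻ b : ℂ, Ψ (WithLp.toLp 2 ![a, b]) := by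
  have e1 : MeasurePreserving (fun p : ℂ × ℂ => (WithLp.toLp 2 ![p.1, p.2] : C2)) :=
    isometryProd.symm.measurePreserving.comp (WithLp.volume_preserving_toLp ℂ ℂ)
  rw [← e1.lintegral_comp hΨ, Measure.volume_eq_prod, lintegral_prod]
  exact (hΨ.comp e1.measurable).aemeasurable

theorem lintegral_comp_mul_left {h : ℂ → ℝ≥0∞} (hh : Measurable h) {a : ℂ} (ha : a ≠ 0) :
    ∫⁻ b, h b = ENNReal.ofReal (‖a‖ ^ 2) * ∫⁻ z, h (a * z) := by
  have hn : ‖a‖ ≠ 0 := norm_ne_zero_iff.2 ha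
  let u : Circle := ⟨a / ‖a‖, by simp [Submonoid.unitSphere, hn]⟩
  have e1 : ∀ z, h (a * z) = h (‖a‖ • rotation u z) := by
    intro z
    congr 1
    have : (‖a‖ : ℂ) ≠ 0 := by exact_mod_cast hn
    rw [rotation_apply, Complex.real_smul]
    change a * z = ‖a‖ * (a / ‖a‖ * z)
    field_simp
  simp_rw [e1]
  rw [(rotation u).measurePreserving.lintegral_comp (f := fun z => h (‖a‖ • z))
    (hh.comp (measurable_const_smul _))]
  have e2 := Measure.map_addHaar_smul (volume : Measure ℂ) hn
  rw [← lintegral_map hh (measurable_const_smul _), e2, lintegral_smul_measure,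
    Complex.finrank_real_complex, smul_eq_mul, ← mul_assoc, ← ENNReal.ofReal_mul (by positivity),
    abs_of_nonneg (by positivity), mul_inv_cancel₀ (by positivity)]
  simp

theorem integral_radial (g : ℝ → ℝ) :
    ∫ z : ℂ, g ‖z‖ = 2 * Real.pi * ∫ y in Set.Ioi (0 : ℝ), y * g y := by
  rw [integral_fun_norm_addHaar (volume : Measure ℂ) g, Complex.finrank_real_complex,
    measureReal_def, Complex.volume_ball]
  simp
  ring

theorem lintegral_norm_sq_ball {r : ℝ} (hr : 0 < r) :
    ∫⁻ a : ℂ, (Metric.ball (0 : ℂ) r).indicator (fun a => ENNReal.ofReal (‖a‖ ^ 2)) a =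
      ENNReal.ofReal (Real.pi / 2 * r ^ 4) := by
  rw [lintegral_indicator Metric.isOpen_ball.measurableSet]
  have hi : IntegrableOn (fun a : ℂ => ‖a‖ ^ 2) (Metric.ball 0 r) :=
    ((by fun_prop : Continuous fun a : ℂ => ‖a‖ ^ 2).continuousOn.integrableOn_compact
      (isCompact_closedBall 0 r)).mono_set Metric.ball_subset_closedBall
  rw [← ofReal_integral_eq_lintegral_ofReal hi (ae_of_all _ fun a => by positivity),
    ← integral_indicator Metric.isOpen_ball.measurableSet]
  have e1 : (fun a : ℂ => (Metric.ball (0 : ℂ) r).indicator (fun a => ‖a‖ ^ 2) a) =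
      fun a => (Set.Iio r).indicator (fun y => y ^ 2) ‖a‖ := by
    funext a
    by_cases h : ‖a‖ < r <;> simp [h]
  rw [e1, integral_radial]
  have e2 : ∀ y : ℝ, y * (Set.Iio r).indicator (fun y => y ^ 2) y =
      (Set.Iio r).indicator (fun y => y ^ 3) y := by
    intro y
    by_cases h : y < r <;> simp [h]
    ring
  simp_rw [e2]
  rw [setIntegral_indicator measurableSet_Iio, Set.Ioi_inter_Iio, ← integral_Ioc_eq_integral_Ioo,
    ← intervalIntegral.integral_of_le hr.le, integral_pow]
  congr 1
  norm_num
  ring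

open Classical in
/-- The pull-back of a function on `P¹` to `ℂ²`, with value `0` at the origin. -/
def pullC2 (Φ : P1 → ℝ≥0∞) (v : C2) : ℝ≥0∞ :=
  if h : v ∈ ({0}ᶜ : Set C2) then Φ (Projectivization.mk ℂ v h) else 0

theorem pullC2_of_ne (Φ : P1 → ℝ≥0∞) {v : C2} (hv : v ≠ 0) :
    pullC2 Φ v = Φ (Projectivization.mk ℂ v hv) := by
  unfold pullC2
  rw [dif_pos (show v ∈ ({0}ᶜ : Set C2) from hv)]

theorem measurable_pullC2 {Φ : P1 → ℝ≥0∞} (hΦ : Measurable Φ) : Measurable (pullC2 Φ) := by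
  unfold pullC2
  refine Measurable.dite (s := ({0}ᶜ : Set C2))
    (f := fun v => Φ (Projectivization.mk ℂ v.1 v.2)) (g := fun _ => 0) ?_ measurable_const
    (measurableSet_singleton _).compl
  exact hΦ.comp continuous_mk.measurable

theorem continuous_fubiniStudy_density :
    Continuous fun z : ℂ => 1 / (Real.pi * (1 + ‖z‖ ^ 2) ^ 2) := by
  refine Continuous.div (by fun_prop) (by fun_prop) fun z => ?_
  have := Real.pi_pos
  positivity

theorem lintegral_fubiniStudy {Φ : P1 → ℝ≥0∞} (hΦ : Measurable Φ) :
    ∫⁻ x, Φ x ∂fubiniStudy =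
      ∫⁻ z : ℂ, ENNReal.ofReal (1 / (Real.pi * (1 + ‖z‖ ^ 2) ^ 2)) * Φ (chart 0 z) := by
  unfold fubiniStudy
  rw [lintegral_map hΦ (continuous_chart 0).measurable, lintegral_withDensity_eq_lintegral_mul]
  · rfl
  · exact continuous_fubiniStudy_density.measurable.ennreal_ofReal
  · exact hΦ.comp (continuous_chart 0).measurable

/-- The Fubini-Study measure is the image of the normalized Lebesgue measure of the unit ball. -/
theorem lintegral_fubiniStudy_eq_ball {Φ : P1 → ℝ≥0∞} (hΦ : Measurable Φ) :
    ∫⁻ x, Φ x ∂fubiniStudy =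
      ENNReal.ofReal (2 / Real.pi ^ 2) * ∫⁻ v in Metric.ball (0 : C2) 1, pullC2 Φ v := by
  have hm := (measurable_pullC2 hΦ).indicator (Metric.isOpen_ball (x := (0 : C2)) (ε := 1)).measurableSet
  rw [← lintegral_indicator Metric.isOpen_ball.measurableSet, lintegral_C2 hm]
  -- substitute `b = a z` in the inner integral
  have e1 : ∀ᵐ a : ℂ, ∫⁻ b : ℂ, (Metric.ball (0 : C2) 1).indicator (pullC2 Φ) (WithLp.toLp 2 ![a, b]) =
      ∫⁻ z : ℂ, Φ (chart 0 z) * (Metric.ball (0 : ℂ) (√(1 + ‖z‖ ^ 2))⁻¹).indicator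
        (fun a => ENNReal.ofReal (‖a‖ ^ 2)) a := by
    have hne : ∀ᵐ a : ℂ, a ≠ 0 := by simp [ae_iff]
    filter_upwards [hne] with a ha
    have hmeas : Measurable fun b : ℂ => (WithLp.toLp 2 ![a, b] : C2) := by
      have : Continuous fun b : ℂ => (WithLp.toLp 2 ![a, b] : C2) :=
        (PiLp.continuous_toLp 2 _).comp (by fun_prop)
      exact this.measurable
    have hmb : Measurable fun b : ℂ =>
        (Metric.ball (0 : C2) 1).indicator (pullC2 Φ) (WithLp.toLp 2 ![a, b]) := hm.comp hmeas
    have hmz : Measurable fun z : ℂ =>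
        (Metric.ball (0 : C2) 1).indicator (pullC2 Φ) (WithLp.toLp 2 ![a, a * z]) :=
      hmb.comp (measurable_const_mul a)
    rw [lintegral_comp_mul_left hmb ha, ← lintegral_const_mul _ hmz]
    refine lintegral_congr fun z => ?_
    have hv : (WithLp.toLp 2 ![a, a * z] : C2) = a • affineVec 0 z := by
      ext i; fin_cases i <;> simp
    have hmem : (WithLp.toLp 2 ![a, a * z] : C2) ∈ Metric.ball (0 : C2) 1 ↔
        a ∈ Metric.ball (0 : ℂ) (√(1 + ‖z‖ ^ 2))⁻¹ := by
      rw [mem_ball_zero_iff, mem_ball_zero_iff, hv, norm_smul, ← norm_sq_affineVec 0 z,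
        Real.sqrt_sq (norm_nonneg _), lt_inv_comm₀ (norm_pos_iff.2 ha)
        (norm_C2_pos (affineVec_ne_zero 0 z)), ← one_div, lt_div_iff₀ (norm_pos_iff.2 ha), mul_comm]
    have hpull : pullC2 Φ (WithLp.toLp 2 ![a, a * z]) = Φ (chart 0 z) := by
      rw [hv, pullC2_of_ne _ (smul_ne_zero ha (affineVec_ne_zero 0 z))]
      congr 1
      unfold chart
      rw [Projectivization.mk_eq_mk_iff']
      exact ⟨a, rfl⟩
    by_cases h : a ∈ Metric.ball (0 : ℂ) (√(1 + ‖z‖ ^ 2))⁻¹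
    · rw [Set.indicator_of_mem (hmem.2 h), Set.indicator_of_mem h, hpull, mul_comm]
    · rw [Set.indicator_of_notMem (fun h' => h (hmem.1 h')), Set.indicator_of_notMem h]
      simp
  rw [lintegral_congr_ae e1, lintegral_lintegral_swap]
  · rw [lintegral_fubiniStudy hΦ, ← lintegral_const_mul']
    · refine lintegral_congr fun z => ?_
      have hr : 0 < (√(1 + ‖z‖ ^ 2))⁻¹ := by positivity
      rw [lintegral_const_mul, lintegral_norm_sq_ball hr, mul_comm (Φ _), ← mul_assoc,
        ← ENNReal.ofReal_mul (by positivity)]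
      · congr 2
        have h4 : (√(1 + ‖z‖ ^ 2)) ^ 4 = (1 + ‖z‖ ^ 2) ^ 2 := by
          rw [show (4 : ℕ) = 2 * 2 by norm_num, pow_mul, Real.sq_sqrt (by positivity)]
        rw [inv_pow, h4]
        have := Real.pi_ne_zero
        field_simp
      · exact Measurable.indicator (by fun_prop) Metric.isOpen_ball.measurableSet
    · exact ENNReal.ofReal_ne_top
  · have h1 : Measurable fun p : ℂ × ℂ => Φ (chart 0 p.2) :=
      (hΦ.comp (continuous_chart 0).measurable).comp measurable_snd
    have h2 : Measurable fun p : ℂ × ℂ => (Metric.ball (0 : ℂ) (√(1 + ‖p.2‖ ^ 2))⁻¹).indicator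
        (fun a => ENNReal.ofReal (‖a‖ ^ 2)) p.1 := by
      have hs : MeasurableSet {p : ℂ × ℂ | ‖p.1‖ < (√(1 + ‖p.2‖ ^ 2))⁻¹} :=
        measurableSet_lt (by fun_prop) (by fun_prop)
      have : Measurable ({p : ℂ × ℂ | ‖p.1‖ < (√(1 + ‖p.2‖ ^ 2))⁻¹}.indicator
          (fun p => ENNReal.ofReal (‖p.1‖ ^ 2))) := Measurable.indicator (by fun_prop) hs
      convert this using 2 with p
      by_cases h : ‖p.1‖ < (√(1 + ‖p.2‖ ^ 2))⁻¹ <;> simp [Set.indicator, h]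
    exact (h1.mul h2).aemeasurable

theorem volume_ball_C2 : volume (Metric.ball (0 : C2) 1) = ENNReal.ofReal (Real.pi ^ 2 / 2) := by
  rw [InnerProductSpace.volume_ball_of_dim_even (k := 2) finrank_real_C2]
  simp

instance instIsProbabilityMeasureFubiniStudy : IsProbabilityMeasure fubiniStudy := by
  refine ⟨?_⟩
  rw [← lintegral_one, lintegral_fubiniStudy_eq_ball measurable_const]
  have h : ∀ᵐ v ∂(volume.restrict (Metric.ball (0 : C2) 1)), pullC2 (fun _ => 1) v = 1 := by
    have hne : ∀ᵐ v : C2, v ≠ 0 := by simp [ae_iff]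
    filter_upwards [ae_restrict_of_ae hne] with v hv
    rw [pullC2_of_ne _ hv]
  rw [lintegral_congr_ae h, setLIntegral_one, volume_ball_C2, ← ENNReal.ofReal_mul (by positivity),
    ENNReal.ofReal_eq_one]
  have := Real.pi_ne_zero
  field_simp

theorem integral_fubiniStudy (φ : P1 → ℝ) (hφ : Measurable φ) :
    ∫ x, φ x ∂fubiniStudy = ∫ z : ℂ, φ (chart 0 z) * (1 / (Real.pi * (1 + ‖z‖ ^ 2) ^ 2)) := by
  unfold fubiniStudy
  rw [integral_map (continuous_chart 0).measurable.aemeasurable hφ.aestronglyMeasurable,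
    integral_withDensity_eq_integral_toReal_smul
      continuous_fubiniStudy_density.measurable.ennreal_ofReal (ae_of_all _ fun _ => ENNReal.ofReal_lt_top)]
  refine integral_congr_ae (ae_of_all _ fun z => ?_)
  have := Real.pi_pos
  simp only [smul_eq_mul]
  rw [ENNReal.toReal_ofReal (by positivity), mul_comm]

/-! ### The logarithmic kernel of `P¹` -/

/-- The ratio `|c ∧ v| / (‖c‖ ‖v‖)`, which is the chordal distance between `[c]` and `[v]`. -/
def chordal (c v : C2) : ℝ := ‖wedge c v‖ / (‖c‖ * ‖v‖)

/-- The kernel `log (|c ∧ v| / (‖c‖ ‖v‖))` of `P¹`, with the value `0` where `[v] = [c]`. -/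
def logKernel (c : C2) (x : P1) : ℝ := Real.log (chordal c x.rep)

theorem wedge_smul_right (c v : C2) (a : ℂ) : wedge c (a • v) = a * wedge c v := by
  simp [wedge]; ring

theorem wedge_swap (c v : C2) : wedge c v = -wedge v c := by
  simp [wedge]; ring

theorem chordal_comm (c v : C2) : chordal c v = chordal v c := by
  unfold chordal
  rw [wedge_swap, norm_neg, mul_comm ‖c‖]

theorem chordal_nonneg (c v : C2) : 0 ≤ chordal c v := by unfold chordal; positivity

theorem chordal_le_one (c v : C2) : chordal c v ≤ 1 :=
  div_le_one_of_le₀ (norm_wedge_le c v) (by positivity)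

theorem chordal_smul (c : C2) (a : ℂ) (ha : a ≠ 0) (v : C2) (_ : v ≠ 0) :
    chordal c (a • v) = chordal c v := by
  unfold chordal
  rw [wedge_smul_right, norm_mul, norm_smul]
  have := norm_ne_zero_iff.2 ha
  rw [show ‖c‖ * (‖a‖ * ‖v‖) = ‖a‖ * (‖c‖ * ‖v‖) by ring, mul_div_mul_left _ _ this]

theorem continuous_wedge (c : C2) : Continuous (wedge c) := by
  unfold wedge; fun_prop

theorem continuous_chordal_rep {c : C2} (hc : c ≠ 0) : Continuous fun x : P1 => chordal c x.rep := by
  refine continuous_rep_of_invariant (chordal_smul c) ?_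
  unfold chordal
  have := continuous_wedge c
  refine ContinuousOn.div (by fun_prop) (by fun_prop) fun v hv => ?_
  exact mul_ne_zero (norm_ne_zero_iff.2 hc) (norm_ne_zero_iff.2 hv)

theorem logKernel_mk (c : C2) (v : C2) (hv : v ≠ 0) :
    logKernel c (Projectivization.mk ℂ v hv) = Real.log (chordal c v) := by
  unfold logKernel
  rw [apply_rep_mk (chordal_smul c)]

theorem measurable_logKernel {c : C2} (hc : c ≠ 0) : Measurable (logKernel c) :=
  Real.measurable_log.comp (continuous_chordal_rep hc).measurable

theorem logKernel_nonpos (c : C2) (x : P1) : logKernel c x ≤ 0 :=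
  Real.log_nonpos (chordal_nonneg _ _) (chordal_le_one _ _)

/-- The unitary map sending `c` to a multiple of the first basis vector. -/
theorem exists_isometry_wedge {c : C2} (hc : c ≠ 0) :
    ∃ U : C2 ≃ₗᵢ[ℝ] C2, ∀ v, U v 1 = wedge c v / ‖c‖ := by
  have hn : ‖c‖ ≠ 0 := norm_ne_zero_iff.2 hc
  have hnc : (‖c‖ : ℂ) ≠ 0 := by exact_mod_cast hn
  let T : C2 →ₗᵢ[ℝ] C2 :=
    { toFun := fun v => WithLp.toLp 2 ![(conj (c 0) * v 0 + conj (c 1) * v 1) / ‖c‖, wedge c v / ‖c‖]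
      map_add' := fun v w => by
        ext i; fin_cases i <;> simp [wedge] <;> ring
      map_smul' := fun r v => by
        ext i; fin_cases i <;> simp [wedge] <;> ring
      norm_map' := fun v => by
        refine (sq_eq_sq₀ (norm_nonneg _) (norm_nonneg _)).1 ?_
        rw [norm_sq_C2]
        simp only [LinearMap.coe_mk, AddHom.coe_mk, Matrix.cons_val_zero, Matrix.cons_val_one,
          norm_div, Complex.norm_real, norm_norm, div_pow, Matrix.cons_val_fin_one]
        rw [← add_div, div_eq_iff (pow_ne_zero 2 hn), norm_sq_C2 v, norm_sq_C2 c]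
        unfold wedge
        simp only [← Complex.normSq_eq_norm_sq, Complex.normSq_apply, Complex.add_re, Complex.add_im,
          Complex.sub_re, Complex.sub_im, Complex.mul_re, Complex.mul_im, Complex.conj_re,
          Complex.conj_im]
        ring }
  exact ⟨T.toLinearIsometryEquiv rfl, fun v => rfl⟩

/-- The mean of the kernel for `ω` does not depend on the pole, since the unitary group preserves
`ω` and is transitive on lines. -/
theorem lintegral_logKernel_eq {c c' : C2} (hc : c ≠ 0) (hc' : c' ≠ 0) :
    ∫⁻ x, ENNReal.ofReal (-logKernel c x) ∂fubiniStudy =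
      ∫⁻ x, ENNReal.ofReal (-logKernel c' x) ∂fubiniStudy := by
  obtain ⟨U, hU⟩ := exists_isometry_wedge hc
  obtain ⟨U', hU'⟩ := exists_isometry_wedge hc'
  have key : ∀ {c : C2} (_ : c ≠ 0) (U : C2 ≃ₗᵢ[ℝ] C2) (_ : ∀ v, U v 1 = wedge c v / ‖c‖),
      ∫⁻ v in Metric.ball (0 : C2) 1, pullC2 (fun x => ENNReal.ofReal (-logKernel c x)) v =
        ∫⁻ v in Metric.ball (0 : C2) 1, ENNReal.ofReal (-Real.log (‖v 1‖ / ‖v‖)) := by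
    intro c hc U hU
    have hm : Measurable fun v : C2 => ENNReal.ofReal (-Real.log (‖v 1‖ / ‖v‖)) := by fun_prop
    rw [← lintegral_indicator Metric.isOpen_ball.measurableSet,
      ← lintegral_indicator Metric.isOpen_ball.measurableSet,
      ← U.measurePreserving.lintegral_comp (hm.indicator Metric.isOpen_ball.measurableSet)]
    have hne : ∀ᵐ v : C2, v ≠ 0 := by simp [ae_iff]
    refine lintegral_congr_ae ?_
    filter_upwards [hne] with v hv
    have hmem : U v ∈ Metric.ball (0 : C2) 1 ↔ v ∈ Metric.ball (0 : C2) 1 := by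
      simp
    by_cases h : v ∈ Metric.ball (0 : C2) 1
    · rw [Set.indicator_of_mem h, Set.indicator_of_mem (hmem.2 h), pullC2_of_ne _ hv, logKernel_mk,
        hU, U.norm_map, norm_div, Complex.norm_real, norm_norm, div_div]
      rfl
    · rw [Set.indicator_of_notMem h, Set.indicator_of_notMem (fun h' => h (hmem.1 h'))]
  have m1 : ∀ {c : C2} (_ : c ≠ 0), Measurable fun x => ENNReal.ofReal (-logKernel c x) :=
    fun hc => (measurable_logKernel hc).neg.ennreal_ofReal
  rw [lintegral_fubiniStudy_eq_ball (m1 hc), lintegral_fubiniStudy_eq_ball (m1 hc'), key hc U hU,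
    key hc' U' hU']

/-- The radial primitive behind `∫ log (|z| / (1 + |z|²)^{1/2}) ω = -1/2`. -/
theorem hasDerivAt_radial_primitive {y : ℝ} (hy : 0 < y) :
    HasDerivAt (fun y : ℝ => 1 / 2 * (Real.negMulLog (y ^ 2 / (1 + y ^ 2)) + y ^ 2 / (1 + y ^ 2)))
      (2 * Real.pi * (y * (-Real.log (y / √(1 + y ^ 2)) * (1 / (Real.pi * (1 + y ^ 2) ^ 2))))) y := by
  have h1 : (0 : ℝ) < 1 + y ^ 2 := by positivity
  have ht : y ^ 2 / (1 + y ^ 2) ≠ 0 := by positivity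
  have d1 : HasDerivAt (fun y : ℝ => y ^ 2 / (1 + y ^ 2)) (2 * y / (1 + y ^ 2) ^ 2) y := by
    have := (hasDerivAt_pow 2 y).fun_div ((hasDerivAt_pow 2 y).const_add 1) h1.ne'
    refine this.congr_deriv ?_
    field_simp
    push_cast
    ring
  have d2 := (((Real.hasDerivAt_negMulLog ht).comp y d1).add d1).const_mul (1 / 2 : ℝ)
  refine d2.congr_deriv ?_
  have e1 : Real.log (y ^ 2 / (1 + y ^ 2)) = 2 * Real.log (y / √(1 + y ^ 2)) := by
    have h := Real.log_pow (y / √(1 + y ^ 2)) 2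
    rw [div_pow, Real.sq_sqrt h1.le] at h
    exact_mod_cast h
  rw [e1]
  have := Real.pi_ne_zero
  field_simp
  ring

/-- Minus the mean for `ω` of the kernel with pole `[1 : 0]`, in polar coordinates. -/
theorem radial_primitive_facts :
    IntegrableOn (fun y : ℝ =>
      2 * Real.pi * (y * (-Real.log (y / √(1 + y ^ 2)) * (1 / (Real.pi * (1 + y ^ 2) ^ 2)))))
      (Set.Ioi 0) ∧
    ∫ y in Set.Ioi (0 : ℝ),
      2 * Real.pi * (y * (-Real.log (y / √(1 + y ^ 2)) * (1 / (Real.pi * (1 + y ^ 2) ^ 2)))) =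
        1 / 2 := by
  have hcont : Continuous (fun y : ℝ =>
      1 / 2 * (Real.negMulLog (y ^ 2 / (1 + y ^ 2)) + y ^ 2 / (1 + y ^ 2))) := by
    have h : Continuous fun y : ℝ => y ^ 2 / (1 + y ^ 2) :=
      Continuous.div (by fun_prop) (by fun_prop) fun y => by positivity
    exact continuous_const.mul ((Real.continuous_negMulLog.comp h).add h)
  have hpos : ∀ y ∈ Set.Ioi (0 : ℝ), 0 ≤
      2 * Real.pi * (y * (-Real.log (y / √(1 + y ^ 2)) * (1 / (Real.pi * (1 + y ^ 2) ^ 2)))) := by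
    intro y hy
    have hy' : 0 < y := hy
    have h1 : y / √(1 + y ^ 2) ≤ 1 := by
      refine div_le_one_of_le₀ (Real.le_sqrt_of_sq_le (by linarith)) (by positivity)
    have h2 := Real.log_nonpos (by positivity) h1
    have := Real.pi_pos
    have h3 : 0 ≤ -Real.log (y / √(1 + y ^ 2)) := by linarith
    positivity
  have hlim : Tendsto (fun y : ℝ =>
      1 / 2 * (Real.negMulLog (y ^ 2 / (1 + y ^ 2)) + y ^ 2 / (1 + y ^ 2))) atTop (𝓝 (1 / 2)) := by
    have ht : Tendsto (fun y : ℝ => y ^ 2 / (1 + y ^ 2)) atTop (𝓝 1) := by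
      have h1 : Tendsto (fun y : ℝ => 1 - (1 + y ^ 2)⁻¹) atTop (𝓝 (1 - 0)) := by
        refine tendsto_const_nhds.sub (tendsto_inv_atTop_zero.comp ?_)
        exact tendsto_atTop_add_const_left _ _ (tendsto_pow_atTop (by norm_num))
      rw [sub_zero] at h1
      refine h1.congr fun y => ?_
      have : (1 + y ^ 2) ≠ 0 := by positivity
      field_simp
      ring
    have h2 := (((Real.continuous_negMulLog.tendsto 1).comp ht).add ht).const_mul (1 / 2 : ℝ)
    simpa using h2
  refine ⟨integrableOn_Ioi_deriv_of_nonneg hcont.continuousWithinAt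
    (fun y hy => hasDerivAt_radial_primitive hy) hpos hlim, ?_⟩
  rw [integral_Ioi_of_hasDerivAt_of_nonneg hcont.continuousWithinAt
    (fun y hy => hasDerivAt_radial_primitive hy) hpos hlim]
  simp

theorem lintegral_neg_logKernel {c : C2} (hc : c ≠ 0) :
    ∫⁻ x, ENNReal.ofReal (-logKernel c x) ∂fubiniStudy = ENNReal.ofReal (1 / 2) := by
  rw [lintegral_logKernel_eq hc (affineVec_ne_zero 0 0),
    lintegral_fubiniStudy (Φ := fun x => ENNReal.ofReal (-logKernel (affineVec 0 0) x))
      (measurable_logKernel (affineVec_ne_zero 0 0)).neg.ennreal_ofReal]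
  have e1 : ∀ z : ℂ, ENNReal.ofReal (1 / (Real.pi * (1 + ‖z‖ ^ 2) ^ 2)) *
      ENNReal.ofReal (-logKernel (affineVec 0 0) (chart 0 z)) =
      ENNReal.ofReal (-Real.log (‖z‖ / √(1 + ‖z‖ ^ 2)) * (1 / (Real.pi * (1 + ‖z‖ ^ 2) ^ 2))) := by
    intro z
    have := Real.pi_pos
    rw [← ENNReal.ofReal_mul (by positivity), mul_comm]
    congr 2
    unfold chart
    rw [logKernel_mk]
    congr 2
    have n1 : ‖affineVec 0 0‖ = 1 := by
      have h := norm_sq_affineVec 0 0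
      have h' := norm_nonneg (affineVec 0 0)
      simp only [norm_zero] at h
      nlinarith
    have n2 : ‖affineVec 0 z‖ = √(1 + ‖z‖ ^ 2) := by
      rw [← norm_sq_affineVec 0 z, Real.sqrt_sq (norm_nonneg _)]
    simp [chordal, n1, n2, wedge]
  simp_rw [e1]
  have hnn : ∀ z : ℂ, 0 ≤ -Real.log (‖z‖ / √(1 + ‖z‖ ^ 2)) * (1 / (Real.pi * (1 + ‖z‖ ^ 2) ^ 2)) := by
    intro z
    have := Real.pi_pos
    have h1 : ‖z‖ / √(1 + ‖z‖ ^ 2) ≤ 1 :=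
      div_le_one_of_le₀ (Real.le_sqrt_of_sq_le (by linarith)) (by positivity)
    have h2 := Real.log_nonpos (by positivity) h1
    have h3 : 0 ≤ -Real.log (‖z‖ / √(1 + ‖z‖ ^ 2)) := by linarith
    positivity
  obtain ⟨f1, f2⟩ := radial_primitive_facts
  have hi : Integrable fun z : ℂ =>
      -Real.log (‖z‖ / √(1 + ‖z‖ ^ 2)) * (1 / (Real.pi * (1 + ‖z‖ ^ 2) ^ 2)) := by
    rw [integrable_fun_norm_addHaar (volume : Measure ℂ) (f := fun y : ℝ =>
      -Real.log (y / √(1 + y ^ 2)) * (1 / (Real.pi * (1 + y ^ 2) ^ 2)))]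
    rw [Complex.finrank_real_complex]
    have h := f1.const_mul (2 * Real.pi)⁻¹
    refine h.congr (ae_of_all _ fun y => ?_)
    have := Real.pi_ne_zero
    simp only [smul_eq_mul]
    rw [← mul_assoc, inv_mul_cancel₀ (by positivity)]
    simp
  rw [← ofReal_integral_eq_lintegral_ofReal hi (ae_of_all _ hnn)]
  congr 1
  rw [integral_radial (fun y : ℝ => -Real.log (y / √(1 + y ^ 2)) * (1 / (Real.pi * (1 + y ^ 2) ^ 2))),
    ← integral_const_mul, f2]

theorem integrable_logKernel_fubiniStudy {c : C2} (hc : c ≠ 0) :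
    Integrable (logKernel c) fubiniStudy := by
  rw [← integrable_neg_iff]
  refine ⟨(measurable_logKernel hc).neg.aestronglyMeasurable, ?_⟩
  rw [hasFiniteIntegral_iff_ofReal (ae_of_all _ fun x => by simpa using logKernel_nonpos c x)]
  simp only [Pi.neg_apply]
  rw [lintegral_neg_logKernel hc]
  exact ENNReal.ofReal_lt_top

theorem integral_logKernel_fubiniStudy {c : C2} (hc : c ≠ 0) :
    ∫ x, logKernel c x ∂fubiniStudy = -(1 / 2) := by
  have h := integral_eq_lintegral_of_nonneg_ae (μ := fubiniStudy) (f := fun x => -logKernel c x)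
    (ae_of_all _ fun x => by simpa using logKernel_nonpos c x)
    (measurable_logKernel hc).neg.aestronglyMeasurable
  rw [lintegral_neg_logKernel hc, integral_neg, ENNReal.toReal_ofReal (by norm_num)] at h
  linarith

/-! ### The unit sphere -/

/-- The normalized surface measure of the unit sphere of `ℂ²`. -/
def sphereMeasure : Measure (Metric.sphere (0 : C2) 1) :=
  ENNReal.ofReal (1 / (2 * Real.pi ^ 2)) • (volume : Measure C2).toSphere

instance instIsFiniteMeasureSphereMeasure : IsFiniteMeasure sphereMeasure := by
  unfold sphereMeasure
  exact Measure.smul_finite _ ENNReal.ofReal_ne_top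

open Pointwise in
/-- The Hopf fibration maps the normalized surface measure of the sphere to `ω`: both come from
Lebesgue measure on the unit ball. -/
theorem map_sphereProj : sphereMeasure.map sphereProj = fubiniStudy := by
  ext A hA
  have hm := continuous_sphereProj.measurable
  have hset : Set.Ioo (0 : ℝ) 1 • ((↑) '' (sphereProj ⁻¹' A) : Set C2) =
      {v : C2 | v ∈ Metric.ball (0 : C2) 1 ∧ pullC2 (A.indicator 1) v = 1} := by
    ext v
    simp only [Set.mem_smul, Set.mem_image, Set.mem_preimage, Set.mem_ofPred_eq]
    constructor
    · rintro ⟨r, hr, _, ⟨w, hw, rfl⟩, rfl⟩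
      have hw0 := ne_zero_of_mem_sphere w.2
      have hw1 : ‖w.1‖ = 1 := mem_sphere_zero_iff_norm.1 w.2
      have hv0 : r • w.1 ≠ 0 := smul_ne_zero hr.1.ne' hw0
      refine ⟨?_, ?_⟩
      · rw [mem_ball_zero_iff, norm_smul, hw1, mul_one, Real.norm_of_nonneg hr.1.le]
        exact hr.2
      · rw [pullC2_of_ne _ hv0]
        have : Projectivization.mk ℂ (r • w.1) hv0 = sphereProj w := by
          unfold sphereProj
          rw [Projectivization.mk_eq_mk_iff']
          exact ⟨r, by simp⟩
        rw [this, Set.indicator_of_mem hw]; rfl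
    · rintro ⟨hv, h1⟩
      have hv0 : v ≠ 0 := by
        rintro rfl
        unfold pullC2 at h1
        simp at h1
      have hn := norm_C2_pos hv0
      rw [pullC2_of_ne _ hv0] at h1
      have hA : Projectivization.mk ℂ v hv0 ∈ A := by
        by_contra h
        rw [Set.indicator_of_notMem h] at h1
        exact zero_ne_one h1
      refine ⟨‖v‖, ⟨hn, by simpa using hv⟩, ‖v‖⁻¹ • v, ⟨⟨‖v‖⁻¹ • v, ?_⟩, ?_, rfl⟩, ?_⟩
      · rw [mem_sphere_zero_iff_norm, norm_smul, norm_inv, norm_norm, inv_mul_cancel₀ hn.ne']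
      · have : sphereProj ⟨‖v‖⁻¹ • v, by
            rw [mem_sphere_zero_iff_norm, norm_smul, norm_inv, norm_norm, inv_mul_cancel₀ hn.ne']⟩ =
            Projectivization.mk ℂ v hv0 := by
          unfold sphereProj
          rw [Projectivization.mk_eq_mk_iff']
          exact ⟨(‖v‖⁻¹ : ℝ), Complex.coe_smul _ _⟩
        rw [this]; exact hA
      · rw [smul_smul, mul_inv_cancel₀ hn.ne', one_smul]
  have hmeas : Measurable (A.indicator 1 : P1 → ℝ≥0∞) := measurable_one.indicator hA
  have hsm : MeasurableSet {v : C2 | v ∈ Metric.ball (0 : C2) 1 ∧ pullC2 (A.indicator 1) v = 1} :=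
    Metric.isOpen_ball.measurableSet.inter (measurable_pullC2 hmeas (measurableSet_singleton 1))
  rw [Measure.map_apply hm hA, sphereMeasure, Measure.smul_apply, Measure.toSphere_apply' _ (hm hA),
    hset, finrank_real_C2, ← lintegral_indicator_one hA, lintegral_fubiniStudy_eq_ball hmeas,
    ← lintegral_indicator Metric.isOpen_ball.measurableSet, ← lintegral_indicator_one hsm, smul_eq_mul,
    ← mul_assoc]
  congr 1
  · rw [show ((4 : ℕ) : ℝ≥0∞) = ENNReal.ofReal 4 by simp, ← ENNReal.ofReal_mul (by positivity)]
    congr 1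
    have := Real.pi_ne_zero
    field_simp
    norm_num
  · refine lintegral_congr fun v => ?_
    by_cases hv : v ∈ Metric.ball (0 : C2) 1
    · rw [Set.indicator_of_mem hv]
      by_cases h1 : pullC2 (A.indicator 1) v = 1
      · rw [Set.indicator_of_mem (show v ∈ {v : C2 | v ∈ Metric.ball (0 : C2) 1 ∧ pullC2 (A.indicator 1) v = 1} from ⟨hv, h1⟩), h1]; rfl
      · rw [Set.indicator_of_notMem (fun h : v ∈ {v : C2 | v ∈ Metric.ball (0 : C2) 1 ∧ pullC2 (A.indicator 1) v = 1} => h1 h.2)]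
        unfold pullC2 at h1 ⊢
        split_ifs at h1 ⊢ with h0
        · by_cases hm : Projectivization.mk ℂ v h0 ∈ A
          · exact absurd (by rw [Set.indicator_of_mem hm]; rfl) h1
          · rw [Set.indicator_of_notMem hm]
        · rfl
    · rw [Set.indicator_of_notMem hv, Set.indicator_of_notMem (fun h : v ∈ {v : C2 | v ∈ Metric.ball (0 : C2) 1 ∧ pullC2 (A.indicator 1) v = 1} => hv h.1)]

/-! ### Existence of the Green measure -/

theorem isSmooth_const (c : ℝ) : IsSmooth fun _ => c := fun _ => contDiff_const

theorem IsSmooth.add {φ ψ : P1 → ℝ} (hφ : IsSmooth φ) (hψ : IsSmooth ψ) :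
    IsSmooth fun x => φ x + ψ x := fun i => (hφ i).add (hψ i)

theorem IsSmooth.const_mul {φ : P1 → ℝ} (hφ : IsSmooth φ) (c : ℝ) :
    IsSmooth fun x => c * φ x := fun i => contDiff_const.mul (hφ i)

theorem IsSmooth.integrable {φ : P1 → ℝ} (hφ : IsSmooth φ) (μ : Measure P1) [IsFiniteMeasure μ] :
    Integrable φ μ :=
  Continuous.integrable_P1 hφ.continuous μ

/-- The current `dd^c g + ω`, evaluated on a test function. -/
def ddcForm (g φ : P1 → ℝ) : ℝ :=
  (∫ z : ℂ, g (chart 0 z) * ((2 * Real.pi)⁻¹ * (Δ (φ ∘ chart 0)) z)) + ∫ x, φ x ∂fubiniStudy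

theorem IsSmooth.integrable_ddc {g φ : P1 → ℝ} (hφ : IsSmooth φ) (hg : Continuous g) :
    Integrable fun z => g (chart 0 z) * ((2 * Real.pi)⁻¹ * (Δ (φ ∘ chart 0)) z) := by
  refine ((hφ.integrable_mul_laplacian hg).const_mul (2 * Real.pi)⁻¹).congr
    (ae_of_all _ fun z => ?_)
  simp only
  ring

theorem ddcForm_add {g φ ψ : P1 → ℝ} (hg : Continuous g) (hφ : IsSmooth φ) (hψ : IsSmooth ψ) :
    ddcForm g (fun x => φ x + ψ x) = ddcForm g φ + ddcForm g ψ := by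
  unfold ddcForm
  have h : ∀ z, (Δ ((fun x => φ x + ψ x) ∘ chart 0)) z = (Δ (φ ∘ chart 0)) z + (Δ (ψ ∘ chart 0)) z :=
    fun z => (hφ.contDiff 0).contDiffAt.laplacian_add (hψ.contDiff 0).contDiffAt
  simp_rw [h, mul_add]
  rw [integral_add (hφ.integrable_ddc hg) (hψ.integrable_ddc hg),
    integral_add (hφ.integrable _) (hψ.integrable _)]
  ring

theorem ddcForm_const_mul {g φ : P1 → ℝ} (hφ : IsSmooth φ) (c : ℝ) :
    ddcForm g (fun x => c * φ x) = c * ddcForm g φ := by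
  unfold ddcForm
  have h : ∀ z, (Δ ((fun x => c * φ x) ∘ chart 0)) z = c * (Δ (φ ∘ chart 0)) z :=
    fun z => InnerProductSpace.laplacian_smul c (hφ.contDiff 0).contDiffAt
  simp_rw [h]
  have e : ∫ z, g (chart 0 z) * ((2 * Real.pi)⁻¹ * (c * (Δ (φ ∘ chart 0)) z)) =
      c * ∫ z, g (chart 0 z) * ((2 * Real.pi)⁻¹ * (Δ (φ ∘ chart 0)) z) := by
    rw [← integral_const_mul]
    congr 1
    funext z
    ring
  rw [integral_const_mul, mul_add, e]

theorem ddcForm_const (g : P1 → ℝ) (c : ℝ) : ddcForm g (fun _ => c) = c := by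
  unfold ddcForm
  have h : ∀ z, (Δ ((fun _ : P1 => c) ∘ chart 0)) z = 0 := by
    intro z
    have : ((fun _ : P1 => c) ∘ chart 0) = fun _ => c := rfl
    rw [this, InnerProductSpace.laplacian_const]
    rfl
  simp_rw [h]
  simp

/-- For a homogeneous map `H` of degree `k`, `dd^c (k⁻¹ log ‖H‖ - log ‖·‖) + ω` is the measure with
density `|H₀ H₁' - H₁ H₀'|² / (k π ‖H‖⁴)`. -/
theorem IsHomMap.ddcForm_eq {k : ℕ} {H : C2 → C2} (hH : IsHomMap k H) (hk : k ≠ 0) {φ : P1 → ℝ}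
    (hφ : IsSmooth φ) :
    ddcForm (fun x => (k : ℝ)⁻¹ * homPotential k H x) φ =
      ∫ z, φ (chart 0 z) * (‖affineWronskian H z‖ ^ 2 / (k * Real.pi * ‖H (affineVec 0 z)‖ ^ 4)) := by
  have hkr : (k : ℝ) ≠ 0 := by exact_mod_cast hk
  have hs := hH.isSmooth
  unfold ddcForm
  have e1 : ∫ z, ((k : ℝ)⁻¹ * homPotential k H (chart 0 z)) *
      ((2 * Real.pi)⁻¹ * (Δ (φ ∘ chart 0)) z) =
      ∫ z, ((k : ℝ)⁻¹ * (2 * Real.pi)⁻¹) * (φ (chart 0 z) * (Δ (homPotential k H ∘ chart 0)) z) := by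
    rw [integral_const_mul, ← hφ.integral_mul_laplacian_comm hs, ← integral_const_mul]
    congr 1
    funext z
    ring
  have i1 := (hs.integrable_mul_laplacian hφ.continuous).const_mul ((k : ℝ)⁻¹ * (2 * Real.pi)⁻¹)
  have i2 : Integrable fun z : ℂ => φ (chart 0 z) * (1 / (Real.pi * (1 + ‖z‖ ^ 2) ^ 2)) := by
    obtain ⟨M, hM⟩ := exists_bound_P1 hφ.continuous
    refine Integrable.bdd_mul (c := M) ?_ (hφ 0).continuous.aestronglyMeasurable
      (ae_of_all _ fun z => hM _)
    have h := integrable_one_add_norm_pow (k := 4) (by norm_num) (16 / Real.pi)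
    refine h.mono' continuous_fubiniStudy_density.aestronglyMeasurable (ae_of_all _ fun z => ?_)
    have := Real.pi_pos
    rw [Real.norm_of_nonneg (by positivity), div_div, div_le_div_iff₀ (by positivity) (by positivity)]
    have h2 : (1 + ‖z‖) ^ 4 ≤ 16 * (1 + ‖z‖ ^ 2) ^ 2 := by
      have h3 : (1 + ‖z‖) ^ 2 ≤ 4 * (1 + ‖z‖ ^ 2) := by nlinarith [sq_nonneg (1 - ‖z‖), norm_nonneg z]
      calc (1 + ‖z‖) ^ 4 = ((1 + ‖z‖) ^ 2) ^ 2 := by ring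
        _ ≤ (4 * (1 + ‖z‖ ^ 2)) ^ 2 := by gcongr
        _ = _ := by ring
    calc 1 * (Real.pi * (1 + ‖z‖) ^ 4) ≤ 1 * (Real.pi * (16 * (1 + ‖z‖ ^ 2) ^ 2)) := by gcongr
      _ = _ := by ring
  rw [e1, integral_fubiniStudy φ hφ.continuous.measurable, ← integral_add i1 i2]
  congr 1
  funext z
  rw [hH.laplacian_homPotential]
  have h1 : ‖H (affineVec 0 z)‖ ≠ 0 := norm_ne_zero_iff.2 (hH.ne_zero _ (affineVec_ne_zero 0 z))
  have h2 : (1 + ‖z‖ ^ 2) ≠ 0 := by positivity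
  have := Real.pi_ne_zero
  field_simp
  ring

/-- Uniform convergence of potentials implies weak convergence of the currents `dd^c g + ω`. -/
theorem tendsto_ddcForm {g : P1 → ℝ} {gs : ℕ → P1 → ℝ} {ε : ℕ → ℝ} (hgs : ∀ n, Continuous (gs n))
    (hg : Continuous g) (h : ∀ n x, |gs n x - g x| ≤ ε n) (hε : Tendsto ε atTop (𝓝 0))
    {φ : P1 → ℝ} (hφ : IsSmooth φ) :
    Tendsto (fun n => ddcForm (gs n) φ) atTop (𝓝 (ddcForm g φ)) := by
  unfold ddcForm
  refine Tendsto.add_const _ ?_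
  rw [tendsto_iff_norm_sub_tendsto_zero]
  set h' : ℂ → ℝ := fun z => (2 * Real.pi)⁻¹ * (Δ (φ ∘ chart 0)) z with hh'
  have hi : Integrable h' := hφ.integrable_laplacian.const_mul _
  refine squeeze_zero (fun n => norm_nonneg _) (g := fun n => ε n * ∫ z, ‖h' z‖) (fun n => ?_)
    (by simpa using hε.mul_const _)
  rw [← integral_sub (hφ.integrable_ddc (hgs n)) (hφ.integrable_ddc hg), ← integral_const_mul]
  refine norm_integral_le_of_norm_le (hi.norm.const_mul _) (ae_of_all _ fun z => ?_)
  rw [← sub_mul, norm_mul]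
  exact mul_le_mul_of_nonneg_right (h n _) (norm_nonneg _)

/-- Positivity of `dd^c g_F + ω` : it is the limit of the smooth positive measures
`d⁻ⁿ dd^c log ‖Fⁿ‖`. -/
theorem IsLift.ddcForm_nonneg (hF : IsLift d F f) (hd : 2 ≤ d) {φ : P1 → ℝ} (hφ : IsSmooth φ)
    (h0 : ∀ x, 0 ≤ φ x) : 0 ≤ ddcForm (greenFunP1 d F) φ := by
  obtain ⟨C, hC⟩ := hF.exists_greenFunP1_bound hd
  have hlim := tendsto_ddcForm
    (gs := fun n x => ((d : ℝ) ^ n)⁻¹ * homPotential (d ^ n) (polyMap F)^[n] x)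
    (fun n => continuous_const.mul (hF.isHomMap.iterate n).isSmooth.continuous)
    (hF.continuous_greenFunP1 hd) hC (tendsto_inv_pow_atTop hd C) hφ
  refine ge_of_tendsto' hlim fun n => ?_
  have h := (hF.isHomMap.iterate n).ddcForm_eq (pow_ne_zero n (by positivity)) hφ
  push_cast at h
  rw [h]
  refine integral_nonneg fun z => mul_nonneg (h0 _) ?_
  have := Real.pi_pos
  positivity

/-- The subspace of smooth functions in `C(P¹)`. -/
def smoothSubmodule : Submodule ℝ (CompactlySupportedContinuousMap P1 ℝ) where
  carrier := {φ | IsSmooth φ}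
  add_mem' hφ hψ := IsSmooth.add hφ hψ
  zero_mem' := isSmooth_const 0
  smul_mem' c _ hφ := IsSmooth.const_mul hφ c

/-- The cone of non-negative functions in `C(P¹)`. -/
def nonnegCone : PointedCone ℝ (CompactlySupportedContinuousMap P1 ℝ) where
  carrier := {φ | ∀ x, 0 ≤ φ x}
  add_mem' hφ hψ x := add_nonneg (hφ x) (hψ x)
  zero_mem' _ := le_rfl
  smul_mem' c _ hφ x := mul_nonneg c.2 (hφ x)

/-- The current `dd^c g + ω` as a partially defined functional on `C(P¹)`. -/
def ddcPMap {g : P1 → ℝ} (hg : Continuous g) : CompactlySupportedContinuousMap P1 ℝ →ₗ.[ℝ] ℝ where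
  domain := smoothSubmodule
  toFun :=
    { toFun := fun φ => ddcForm g φ.1
      map_add' := fun φ ψ => ddcForm_add hg φ.2 ψ.2
      map_smul' := fun c φ => ddcForm_const_mul φ.2 c }

/-- The Green measure exists: a positive functional on smooth functions extends to `C(P¹)` by
M. Riesz's extension theorem, and is then a measure. -/
theorem IsLift.exists_isGreenMeasure (hF : IsLift d F f) (hd : 2 ≤ d) :
    ∃ μ, IsGreenMeasure d F μ := by
  have hg := hF.continuous_greenFunP1 hd
  obtain ⟨Λ, h1, h2⟩ := riesz_extension nonnegCone (ddcPMap hg)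
    (fun φ hφ => hF.ddcForm_nonneg hd φ.2 hφ) (fun ψ => by
      obtain ⟨M, hM⟩ := exists_bound_P1 ψ.continuous
      let K : CompactlySupportedContinuousMap P1 ℝ :=
        ⟨⟨fun _ => M, continuous_const⟩, HasCompactSupport.of_compactSpace _⟩
      refine ⟨⟨K, isSmooth_const M⟩, fun x => ?_⟩
      have h3 : -M ≤ ψ x := (abs_le.1 (hM x)).1
      change 0 ≤ M + ψ x
      linarith)
  let Λ' := PositiveLinearMap.mk₀ Λ fun φ hφ =>
    h2 φ fun x => CompactlySupportedContinuousMap.le_def.1 hφ x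
  refine ⟨RealRMK.rieszMeasure Λ', ?_, fun φ hφ => ?_⟩
  · infer_instance
  · let φ' : CompactlySupportedContinuousMap P1 ℝ :=
      ⟨⟨φ, hφ.continuous⟩, HasCompactSupport.of_compactSpace _⟩
    have h3 := RealRMK.integral_rieszMeasure Λ' φ'
    have h4 := h1 ⟨φ', hφ⟩
    exact h3.trans h4

theorem IsLift.isGreenMeasure (hF : IsLift d F f) (hd : 2 ≤ d) :
    IsGreenMeasure d F (greenMeasure d F) := by
  have h := hF.exists_isGreenMeasure hd
  unfold greenMeasure
  rw [dif_pos h]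
  exact h.choose_spec

theorem IsGreenMeasure.isProbabilityMeasure {μ : Measure P1} (hμ : IsGreenMeasure d F μ) :
    IsProbabilityMeasure μ := by
  have := hμ.1
  have h := hμ.2 _ (isSmooth_const 1)
  have h2 := ddcForm_const (greenFunP1 d F) 1
  unfold ddcForm at h2
  rw [h2] at h
  simp only [integral_const, smul_eq_mul, mul_one] at h
  refine ⟨?_⟩
  rw [measureReal_def] at h
  rw [← ENNReal.ofReal_toReal (measure_ne_top μ _), h, ENNReal.ofReal_one]

/-! ### The potential of the Green measure -/

/-- The linear map `v ↦ ((1 + ε)^{1/2} (c ∧ v), ε^{1/2} ⟨c, v⟩) / ‖c‖`, whose norm is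
`(|c ∧ v|² / ‖c‖² + ε ‖v‖²)^{1/2}`. -/
def regMap (c : C2) (ε : ℝ) (v : C2) : C2 :=
  WithLp.toLp 2 ![(√(1 + ε) : ℂ) * (wedge c v / ‖c‖),
    (√ε : ℂ) * ((conj (c 0) * v 0 + conj (c 1) * v 1) / ‖c‖)]

theorem norm_sq_regMap {c : C2} (hc : c ≠ 0) {ε : ℝ} (hε : 0 < ε) (v : C2) :
    ‖regMap c ε v‖ ^ 2 = ‖wedge c v‖ ^ 2 / ‖c‖ ^ 2 + ε * ‖v‖ ^ 2 := by
  have hn : ‖c‖ ≠ 0 := norm_ne_zero_iff.2 hc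
  -- Lagrange's identity
  have hL : ‖wedge c v‖ ^ 2 + ‖conj (c 0) * v 0 + conj (c 1) * v 1‖ ^ 2 = ‖c‖ ^ 2 * ‖v‖ ^ 2 := by
    rw [norm_sq_C2 v, norm_sq_C2 c]
    unfold wedge
    simp only [← Complex.normSq_eq_norm_sq, Complex.normSq_apply, Complex.add_re, Complex.add_im,
      Complex.sub_re, Complex.sub_im, Complex.mul_re, Complex.mul_im, Complex.conj_re,
      Complex.conj_im]
    ring
  rw [norm_sq_C2]
  simp only [regMap, Matrix.cons_val_zero, Matrix.cons_val_one, Matrix.cons_val_fin_one, norm_mul,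
    norm_div, Complex.norm_real, norm_norm, mul_pow, div_pow, Real.norm_of_nonneg (Real.sqrt_nonneg _)]
  rw [Real.sq_sqrt hε.le, Real.sq_sqrt (by linarith)]
  have h2 : ‖conj (c 0) * v 0 + conj (c 1) * v 1‖ ^ 2 = ‖c‖ ^ 2 * ‖v‖ ^ 2 - ‖wedge c v‖ ^ 2 := by
    linarith
  rw [h2]
  field_simp
  ring

theorem isHomMap_regMap {c : C2} (hc : c ≠ 0) {ε : ℝ} (hε : 0 < ε) : IsHomMap 1 (regMap c ε) where
  contDiff := by
    rw [contDiff_euclidean]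
    intro i
    unfold regMap wedge
    fin_cases i <;> simp <;> fun_prop
  map_smul a v := by
    ext i
    fin_cases i <;> simp [regMap, wedge] <;> ring
  ne_zero v hv h := by
    have h1 := norm_sq_regMap hc hε v
    rw [h] at h1
    have := norm_C2_pos hv
    have h2 : 0 < ε * ‖v‖ ^ 2 := by positivity
    have h3 : 0 ≤ ‖wedge c v‖ ^ 2 / ‖c‖ ^ 2 := by positivity
    simp at h1
    linarith

/-- The Wronskian of a linear map in the affine chart is its determinant. -/
theorem norm_sq_affineWronskian_regMap {c : C2} (hc : c ≠ 0) {ε : ℝ} (hε : 0 < ε) (z : ℂ) :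
    ‖affineWronskian (regMap c ε) z‖ ^ 2 = ε * (1 + ε) := by
  have hn : ‖c‖ ≠ 0 := norm_ne_zero_iff.2 hc
  have hnc : (‖c‖ : ℂ) ≠ 0 := by exact_mod_cast hn
  have d0 : deriv (fun w => regMap c ε (affineVec 0 w) 0) z = (√(1 + ε) : ℂ) * (c 0 / ‖c‖) := by
    have h : (fun w => regMap c ε (affineVec 0 w) 0) =
        fun w => (√(1 + ε) : ℂ) * (c 0 / ‖c‖) * w - (√(1 + ε) : ℂ) * (c 1 / ‖c‖) := by
      funext w; simp [regMap, wedge]; ring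
    rw [h]
    simp
  have d1 : deriv (fun w => regMap c ε (affineVec 0 w) 1) z = (√ε : ℂ) * (conj (c 1) / ‖c‖) := by
    have h : (fun w => regMap c ε (affineVec 0 w) 1) =
        fun w => (√ε : ℂ) * (conj (c 1) / ‖c‖) * w + (√ε : ℂ) * (conj (c 0) / ‖c‖) := by
      funext w; simp [regMap]; ring
    rw [h]
    simp
  have hW : affineWronskian (regMap c ε) z = -((√(1 + ε) : ℂ) * √ε) := by
    have hcc : c 0 * conj (c 0) + c 1 * conj (c 1) = (‖c‖ : ℂ) ^ 2 := by
      rw [Complex.mul_conj', Complex.mul_conj', ← Complex.ofReal_pow, ← Complex.ofReal_pow,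
        ← Complex.ofReal_pow, ← Complex.ofReal_add, norm_sq_C2]
    unfold affineWronskian
    rw [d0, d1]
    simp only [regMap, wedge, Matrix.cons_val_zero, Matrix.cons_val_one, Matrix.cons_val_fin_one,
      affineVec_zero_zero, affineVec_zero_one]
    field_simp
    linear_combination (-(√(1 + ε) : ℂ) * √ε) * hcc
  rw [hW, norm_neg, norm_mul, Complex.norm_real, Complex.norm_real, mul_pow,
    Real.norm_of_nonneg (Real.sqrt_nonneg _), Real.norm_of_nonneg (Real.sqrt_nonneg _),
    Real.sq_sqrt hε.le, Real.sq_sqrt (by linarith)]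
  ring

theorem homPotential_regMap {c : C2} (hc : c ≠ 0) {ε : ℝ} (hε : 0 < ε) (x : P1) :
    homPotential 1 (regMap c ε) x = 1 / 2 * Real.log (chordal c x.rep ^ 2 + ε) := by
  have hn : ‖c‖ ≠ 0 := norm_ne_zero_iff.2 hc
  have hx := norm_C2_pos x.rep_nonzero
  have hr := norm_C2_pos ((isHomMap_regMap hc hε).ne_zero _ x.rep_nonzero)
  have h1 : chordal c x.rep ^ 2 + ε = (‖regMap c ε x.rep‖ / ‖x.rep‖) ^ 2 := by
    rw [div_pow, norm_sq_regMap hc hε]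
    unfold chordal
    field_simp
  rw [h1, Real.log_pow, Real.log_div hr.ne' hx.ne']
  unfold homPotential
  push_cast
  ring

/-- The density with respect to `ω` of `dd^c log ((chordal c)² + ε)^{1/2} + ω`, an approximation of
the Dirac mass at `[c]`. -/
def peak (c : C2) (ε : ℝ) (x : P1) : ℝ := ε * (1 + ε) / (chordal c x.rep ^ 2 + ε) ^ 2

theorem continuous_peak {c : C2} (hc : c ≠ 0) {ε : ℝ} (hε : 0 < ε) : Continuous (peak c ε) := by
  have := continuous_chordal_rep hc
  unfold peak
  exact Continuous.div (by fun_prop) (by fun_prop) fun x => by positivity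

theorem peak_chart {c : C2} (hc : c ≠ 0) {ε : ℝ} (hε : 0 < ε) (z : ℂ) :
    ‖affineWronskian (regMap c ε) z‖ ^ 2 / ((1 : ℕ) * Real.pi * ‖regMap c ε (affineVec 0 z)‖ ^ 4) =
      peak c ε (chart 0 z) * (1 / (Real.pi * (1 + ‖z‖ ^ 2) ^ 2)) := by
  have hn : ‖c‖ ≠ 0 := norm_ne_zero_iff.2 hc
  have hv := norm_C2_pos (affineVec_ne_zero 0 z)
  have h1 : chordal c (chart 0 z).rep = chordal c (affineVec 0 z) :=
    apply_rep_mk (chordal_smul c) _ (affineVec_ne_zero 0 z)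
  rw [norm_sq_affineWronskian_regMap hc hε, show ‖regMap c ε (affineVec 0 z)‖ ^ 4 =
    (‖regMap c ε (affineVec 0 z)‖ ^ 2) ^ 2 by ring, norm_sq_regMap hc hε, ← norm_sq_affineVec 0 z]
  unfold peak
  rw [h1]
  have h2 : ‖wedge c (affineVec 0 z)‖ ^ 2 / ‖c‖ ^ 2 + ε * ‖affineVec 0 z‖ ^ 2 =
      (chordal c (affineVec 0 z) ^ 2 + ε) * ‖affineVec 0 z‖ ^ 2 := by
    unfold chordal
    field_simp
  rw [h2]
  have h3 : 0 < chordal c (affineVec 0 z) ^ 2 + ε := by positivity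
  have := Real.pi_ne_zero
  push_cast
  field_simp

/-- The current of the regularized kernel has mass one, as `dd^c` of a smooth function has mass
zero. -/
theorem integral_peak {c : C2} (hc : c ≠ 0) {ε : ℝ} (hε : 0 < ε) :
    ∫ x, peak c ε x ∂fubiniStudy = 1 := by
  have h := (isHomMap_regMap hc hε).ddcForm_eq one_ne_zero (isSmooth_const 1)
  rw [ddcForm_const] at h
  rw [h, integral_fubiniStudy _ (continuous_peak hc hε).measurable]
  congr 1
  funext z
  rw [one_mul, peak_chart hc hε]

/-- The current `dd^c g + ω` on the regularized kernel: move `dd^c` to the kernel, where it is `peak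
- 1`. -/
theorem ddcForm_regMap {c : C2} (hc : c ≠ 0) {ε : ℝ} (hε : 0 < ε) {g : P1 → ℝ} (hg : Continuous g) :
    ddcForm g (homPotential 1 (regMap c ε)) =
      (∫ x, peak c ε x * g x ∂fubiniStudy) - (∫ x, g x ∂fubiniStudy) +
        ∫ x, homPotential 1 (regMap c ε) x ∂fubiniStudy := by
  unfold ddcForm
  have hp := continuous_peak hc hε
  congr 1
  have i1 : Integrable (fun x => peak c ε x * g x) fubiniStudy :=
    Continuous.integrable_P1 (hp.mul hg) _
  rw [← integral_sub i1 (Continuous.integrable_P1 hg _),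
    integral_fubiniStudy (fun x => peak c ε x * g x - g x) ((hp.mul hg).sub hg).measurable]
  congr 1
  funext z
  rw [(isHomMap_regMap hc hε).laplacian_homPotential]
  have h1 := peak_chart hc hε z
  have h2 := (isHomMap_regMap hc hε).ne_zero _ (affineVec_ne_zero 0 z)
  have hr := norm_C2_pos h2
  have := Real.pi_pos
  have h3 : peak c ε (chart 0 z) = ‖affineWronskian (regMap c ε) z‖ ^ 2 *
      (1 + ‖z‖ ^ 2) ^ 2 / ‖regMap c ε (affineVec 0 z)‖ ^ 4 := by
    push_cast at h1
    field_simp at h1 ⊢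
    linarith
  rw [h3]
  have h4 : (0 : ℝ) < 1 + ‖z‖ ^ 2 := by positivity
  push_cast
  field_simp

theorem chordal_eq_zero_iff {c v : C2} (hc : c ≠ 0) (hv : v ≠ 0) :
    chordal c v = 0 ↔ Projectivization.mk ℂ c hc = Projectivization.mk ℂ v hv := by
  rw [← wedge_eq_zero_iff hc hv]
  unfold chordal
  have h1 := norm_ne_zero_iff.2 hc
  have h2 := norm_ne_zero_iff.2 hv
  rw [div_eq_zero_iff, norm_eq_zero]
  simp [h1, h2]

theorem chordal_rep_pos {c : C2} (hc : c ≠ 0) {x : P1} (hx : x ≠ Projectivization.mk ℂ c hc) :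
    0 < chordal c x.rep := by
  refine lt_of_le_of_ne (chordal_nonneg _ _) fun h => hx ?_
  rw [← x.mk_rep]
  exact ((chordal_eq_zero_iff hc x.rep_nonzero).1 h.symm).symm

/-- The scale of the regularizations. -/
def regScale (n : ℕ) : ℝ := 1 / ((n : ℝ) + 1)

theorem regScale_pos (n : ℕ) : 0 < regScale n := by unfold regScale; positivity

theorem regScale_le_one (n : ℕ) : regScale n ≤ 1 := by
  unfold regScale
  exact div_le_one_of_le₀ (by simp) (by positivity)

theorem tendsto_regScale : Tendsto regScale atTop (𝓝 0) := tendsto_one_div_add_atTop_nhds_zero_nat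

/-- The functions `peak` are an approximation of the Dirac mass at `[c]`. -/
theorem tendsto_integral_peak {c : C2} (hc : c ≠ 0) {g : P1 → ℝ} (hg : Continuous g) :
    Tendsto (fun n => ∫ x, peak c (regScale n) x * g x ∂fubiniStudy) atTop
      (𝓝 (g (Projectivization.mk ℂ c hc))) := by
  have h := tendsto_integral_peak_smul_of_integrable_of_tendsto (μ := fubiniStudy)
    (φ := fun n x => peak c (regScale n) x) (l := atTop) (g := g) (t := Set.univ)
    (x₀ := Projectivization.mk ℂ c hc) (a := g (Projectivization.mk ℂ c hc))
    MeasurableSet.univ univ_mem (measure_ne_top _ _)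
    (Eventually.of_forall fun n x => by
      have := regScale_pos n
      unfold peak
      positivity) ?_ ?_
    (Eventually.of_forall fun n => (continuous_peak hc (regScale_pos n)).aestronglyMeasurable)
    (Continuous.integrable_P1 hg _) (hg.tendsto _)
  · simpa only [smul_eq_mul] using h
  · intro u hu hcu
    rcases uᶜ.eq_empty_or_nonempty with he | hne
    · rw [he]; exact tendstoUniformlyOn_empty
    obtain ⟨x₀, hx₀, hmin⟩ := hu.isClosed_compl.isCompact.exists_isMinOn hne
      (continuous_chordal_rep hc).continuousOn
    have hδ : 0 < chordal c x₀.rep := chordal_rep_pos hc fun h => hx₀ (h ▸ hcu)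
    set δ := chordal c x₀.rep
    have hlim : Tendsto (fun n => regScale n * 2 / (δ ^ 2) ^ 2) atTop (𝓝 0) := by
      simpa using (tendsto_regScale.mul_const 2).div_const ((δ ^ 2) ^ 2)
    rw [Metric.tendstoUniformlyOn_iff]
    intro η hη
    filter_upwards [hlim.eventually_lt_const hη] with n hn x hx
    have h1 := regScale_pos n
    have h2 := regScale_le_one n
    have h3 : δ ≤ chordal c x.rep := hmin hx
    have h4 : 0 ≤ peak c (regScale n) x := by unfold peak; positivity
    rw [Pi.zero_apply, dist_zero_left, Real.norm_of_nonneg h4]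
    refine lt_of_le_of_lt ?_ hn
    unfold peak
    gcongr
    · linarith
    · nlinarith [sq_nonneg δ]
  · simp only [Measure.restrict_univ]
    refine tendsto_const_nhds.congr fun n => ?_
    rw [integral_peak hc (regScale_pos n)]

theorem homPotential_regMap_le {c : C2} (hc : c ≠ 0) (n : ℕ) (x : P1) :
    homPotential 1 (regMap c (regScale n)) x ≤ 1 / 2 * Real.log 2 := by
  have h1 := regScale_pos n
  have h2 := regScale_le_one n
  rw [homPotential_regMap hc h1]
  have h3 := chordal_le_one c x.rep
  have h4 := chordal_nonneg c x.rep
  gcongr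
  nlinarith

theorem logKernel_le_homPotential_regMap {c : C2} (hc : c ≠ 0) (n : ℕ) {x : P1}
    (hx : x ≠ Projectivization.mk ℂ c hc) :
    logKernel c x ≤ homPotential 1 (regMap c (regScale n)) x := by
  have h1 := regScale_pos n
  have h4 := chordal_rep_pos hc hx
  rw [homPotential_regMap hc h1]
  unfold logKernel
  have h5 : Real.log (chordal c x.rep) = 1 / 2 * Real.log (chordal c x.rep ^ 2) := by
    rw [Real.log_pow]; push_cast; ring
  rw [h5]
  gcongr
  linarith

theorem tendsto_homPotential_regMap {c : C2} (hc : c ≠ 0) {x : P1}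
    (hx : x ≠ Projectivization.mk ℂ c hc) :
    Tendsto (fun n => homPotential 1 (regMap c (regScale n)) x) atTop (𝓝 (logKernel c x)) := by
  have h4 := chordal_rep_pos hc hx
  have h5 : logKernel c x = 1 / 2 * Real.log (chordal c x.rep ^ 2 + 0) := by
    unfold logKernel
    rw [add_zero, Real.log_pow]; push_cast; ring
  rw [h5]
  refine Tendsto.congr (fun n => (homPotential_regMap hc (regScale_pos n) x).symm) ?_
  refine Tendsto.const_mul _ ((tendsto_regScale.const_add _).log ?_)
  positivity

/-- If the point `[c]` is negligible and the kernel is integrable, its regularizations converge to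
it in mean. -/
theorem tendsto_integral_homPotential_regMap {c : C2} (hc : c ≠ 0) {ν : Measure P1}
    [IsFiniteMeasure ν] (h0 : ∀ᵐ x ∂ν, x ≠ Projectivization.mk ℂ c hc)
    (hi : Integrable (logKernel c) ν) :
    Tendsto (fun n => ∫ x, homPotential 1 (regMap c (regScale n)) x ∂ν) atTop
      (𝓝 (∫ x, logKernel c x ∂ν)) := by
  refine tendsto_integral_of_dominated_convergence (fun x => |logKernel c x| + 1 / 2 * Real.log 2)
    (fun n => (isHomMap_regMap hc (regScale_pos n)).isSmooth.continuous.aestronglyMeasurable)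
    (hi.abs.add (integrable_const _)) (fun n => ?_) ?_
  · filter_upwards [h0] with x hx
    have h1 := homPotential_regMap_le hc n x
    have h2 := logKernel_le_homPotential_regMap hc n hx
    have h3 : 0 < Real.log 2 := Real.log_pos (by norm_num)
    rw [Real.norm_eq_abs, abs_le]
    constructor
    · linarith [neg_abs_le (logKernel c x)]
    · linarith [abs_nonneg (logKernel c x)]
  · filter_upwards [h0] with x hx using tendsto_homPotential_regMap hc hx

/-- By Fatou's lemma, a measure whose regularized potentials at `[c]` stay bounded below does not
charge `[c]`, and its potential at `[c]` is finite. -/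
theorem integrable_logKernel_of_bound {c : C2} (hc : c ≠ 0) {ν : Measure P1} [IsProbabilityMeasure ν]
    {B : ℝ} (hB : ∀ n, B ≤ ∫ x, homPotential 1 (regMap c (regScale n)) x ∂ν) :
    (∀ᵐ x ∂ν, x ≠ Projectivization.mk ℂ c hc) ∧ Integrable (logKernel c) ν := by
  classical
  set u : ℕ → P1 → ℝ := fun n => homPotential 1 (regMap c (regScale n)) with hu
  set K : ℝ := 1 / 2 * Real.log 2 with hK
  have hcont : ∀ n, Continuous (u n) := fun n =>
    (isHomMap_regMap hc (regScale_pos n)).isSmooth.continuous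
  set fn : ℕ → P1 → ℝ≥0∞ := fun n x => ENNReal.ofReal (K - u n x) with hfn
  set fl : P1 → ℝ≥0∞ := fun x => if x = Projectivization.mk ℂ c hc then ⊤ else
    ENNReal.ofReal (K - logKernel c x) with hfl
  have hlim : ∀ x, Tendsto (fun n => fn n x) atTop (𝓝 (fl x)) := by
    intro x
    by_cases hx : x = Projectivization.mk ℂ c hc
    · simp only [hfl, if_pos hx]
      have h0 : chordal c x.rep = 0 := by
        rw [chordal_eq_zero_iff hc x.rep_nonzero, x.mk_rep, hx]
      refine ENNReal.tendsto_ofReal_atTop.comp ?_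
      have h1 : Tendsto (fun n => Real.log (regScale n)) atTop atBot :=
        Real.tendsto_log_nhdsGT_zero.comp (tendsto_nhdsWithin_iff.2
          ⟨tendsto_regScale, Eventually.of_forall fun n => regScale_pos n⟩)
      have h2 : ∀ n, K - u n x = K + (1 / 2) * (-Real.log (regScale n)) := by
        intro n
        simp only [hu]
        rw [homPotential_regMap hc (regScale_pos n), h0]
        ring_nf
      simp_rw [h2]
      exact tendsto_atTop_add_const_left _ _
        ((tendsto_neg_atBot_atTop.comp h1).const_mul_atTop (by norm_num))
    · simp only [hfl, if_neg hx]
      exact ENNReal.tendsto_ofReal ((tendsto_homPotential_regMap hc hx).const_sub K)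
  have hle : ∫⁻ x, fl x ∂ν ≤ ENNReal.ofReal (K - B) := by
    have h1 := lintegral_liminf_le (μ := ν) (f := fn) (u := atTop) fun n =>
      ((hcont n).measurable.const_sub K).ennreal_ofReal
    have e : ∀ x, liminf (fun n => fn n x) atTop = fl x := fun x => (hlim x).liminf_eq
    simp_rw [e] at h1
    refine h1.trans ?_
    refine (liminf_le_liminf (v := fun _ => ENNReal.ofReal (K - B))
      (Eventually.of_forall fun n => ?_)).trans (le_of_eq (liminf_const _))
    have hi : Integrable (fun x => K - u n x) ν :=
      (integrable_const _).sub (Continuous.integrable_P1 (hcont n) ν)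
    simp only [hfn]
    rw [← ofReal_integral_eq_lintegral_ofReal hi (ae_of_all _ fun x =>
      sub_nonneg.2 (homPotential_regMap_le hc n x)), integral_sub (integrable_const _)
      (Continuous.integrable_P1 (hcont n) ν)]
    refine ENNReal.ofReal_le_ofReal ?_
    simp only [integral_const, probReal_univ, one_smul]
    linarith [hB n]
  have hflm : Measurable fl := by
    refine Measurable.ite (measurableSet_singleton _) measurable_const ?_
    exact ((measurable_logKernel hc).const_sub K).ennreal_ofReal
  have hfin : ∀ᵐ x ∂ν, fl x < ⊤ := ae_lt_top hflm (hle.trans_lt ENNReal.ofReal_lt_top).ne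
  have h0 : ∀ᵐ x ∂ν, x ≠ Projectivization.mk ℂ c hc := by
    filter_upwards [hfin] with x hx h
    simp [hfl, h] at hx
  refine ⟨h0, ?_⟩
  have hi : Integrable (fun x => K - logKernel c x) ν := by
    have h3 : 0 < Real.log 2 := Real.log_pos (by norm_num)
    refine ⟨((measurable_logKernel hc).const_sub K).aestronglyMeasurable, ?_⟩
    rw [hasFiniteIntegral_iff_ofReal (ae_of_all _ fun x => by
      have := logKernel_nonpos c x
      simp only [Pi.zero_apply]
      linarith)]
    refine lt_of_le_of_lt ?_ (hle.trans_lt ENNReal.ofReal_lt_top)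
    refine le_of_eq (lintegral_congr_ae ?_)
    filter_upwards [h0] with x hx
    simp [hfl, hx]
  have := (integrable_const K).sub hi
  refine this.congr (ae_of_all _ fun x => ?_)
  simp

theorem fubiniStudy_ae_ne (x₀ : P1) : ∀ᵐ x ∂fubiniStudy, x ≠ x₀ := by
  unfold fubiniStudy
  have hm : MeasurableSet {x : P1 | x ≠ x₀} := (measurableSet_singleton x₀).compl
  rw [ae_map_iff (continuous_chart 0).measurable.aemeasurable hm]
  refine (withDensity_absolutelyContinuous _ _).ae_le ?_
  have hs : {z : ℂ | ¬ chart 0 z ≠ x₀}.Subsingleton := by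
    intro z hz w hw
    simp only [ne_eq, not_not, Set.mem_ofPred_eq] at hz hw
    exact chart_injective 0 (hz.trans hw.symm)
  exact hs.measure_zero _

/-- The kernel is integrable for the Green measure, and `g_F` is its potential up to a constant. -/
theorem IsLift.potential (hF : IsLift d F f) (hd : 2 ≤ d) {μ : Measure P1}
    (hμ : IsGreenMeasure d F μ) {c : C2} (hc : c ≠ 0) :
    (∀ᵐ x ∂μ, x ≠ Projectivization.mk ℂ c hc) ∧ Integrable (logKernel c) μ ∧
      ∫ x, logKernel c x ∂μ = greenFunP1 d F (Projectivization.mk ℂ c hc) -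
        ((∫ x, greenFunP1 d F x ∂fubiniStudy) + 1 / 2) := by
  have hg := hF.continuous_greenFunP1 hd
  have := hμ.isProbabilityMeasure
  have e1 : ∀ n, ∫ x, homPotential 1 (regMap c (regScale n)) x ∂μ =
      (∫ x, peak c (regScale n) x * greenFunP1 d F x ∂fubiniStudy) -
        (∫ x, greenFunP1 d F x ∂fubiniStudy) +
        ∫ x, homPotential 1 (regMap c (regScale n)) x ∂fubiniStudy := fun n =>
    (hμ.2 _ (isHomMap_regMap hc (regScale_pos n)).isSmooth).trans
      (ddcForm_regMap hc (regScale_pos n) hg)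
  have hlim : Tendsto (fun n => ∫ x, homPotential 1 (regMap c (regScale n)) x ∂μ) atTop
      (𝓝 (greenFunP1 d F (Projectivization.mk ℂ c hc) - (∫ x, greenFunP1 d F x ∂fubiniStudy) +
        ∫ x, logKernel c x ∂fubiniStudy)) := by
    simp_rw [e1]
    exact ((tendsto_integral_peak hc hg).sub_const _).add
      (tendsto_integral_homPotential_regMap hc (fubiniStudy_ae_ne _)
        (integrable_logKernel_fubiniStudy hc))
  obtain ⟨B, hB⟩ := hlim.bddBelow_range
  obtain ⟨h0, hi⟩ := integrable_logKernel_of_bound hc (ν := μ) (B := B) fun n =>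
    hB (Set.mem_range_self n)
  refine ⟨h0, hi, ?_⟩
  rw [tendsto_nhds_unique (tendsto_integral_homPotential_regMap hc h0 hi) hlim,
    integral_logKernel_fubiniStudy hc]
  ring

/-! ### Binary forms as products of linear forms -/

theorem wedge_zero_left (v : C2) : wedge 0 v = 0 := by simp [wedge]

/-- A binary form over `ℂ` is a constant times a product of linear forms: the roots of its
dehomogenization give all the factors but those equal to the first coordinate. -/
theorem exists_eval_eq_mul_prod_wedge {n : ℕ} {p : MvPolynomial (Fin 2) ℂ} (hp : p.IsHomogeneous n) :
    ∃ (k : ℂ) (s : Multiset C2), s.card = n ∧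
      ∀ v : C2, MvPolynomial.eval (fun j => v j) p = k * (s.map fun a => wedge a v).prod := by
  set q : Polynomial ℂ := MvPolynomial.aeval ![1, Polynomial.X] p with hq
  have hdeg : q.natDegree ≤ n := by
    have h := MvPolynomial.aeval_natDegree_le (m := n) (n := 1) p hp.totalDegree_le
      (![1, Polynomial.X] : Fin 2 → Polynomial ℂ) (fun i => by fin_cases i <;> simp)
    simpa using h
  have heval : ∀ z : ℂ, q.eval z = MvPolynomial.eval ![1, z] p := by
    intro z
    rw [hq, ← Polynomial.coe_evalRingHom, MvPolynomial.aeval_def, MvPolynomial.hom_eval₂,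
      MvPolynomial.eval, MvPolynomial.coe_eval₂Hom]
    congr 1
    · ext x; simp
    · funext i; fin_cases i <;> simp
  have hcard : q.roots.card ≤ n := (Polynomial.card_roots' q).trans hdeg
  refine ⟨q.leadingCoeff, q.roots.map (fun r => !₂[1, r]) +
    Multiset.replicate (n - q.roots.card) !₂[0, -1], ?_, ?_⟩
  · simp only [Multiset.card_add, Multiset.card_map, Multiset.card_replicate]
    omega
  have hsplit := (IsAlgClosed.splits q).eq_prod_roots
  -- both sides are continuous, so it is enough to compare them where the first coordinate is not 0
  have hdense : Dense {v : C2 | v 0 ≠ 0} := by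
    intro v
    rw [mem_closure_iff_seq_limit]
    by_cases h0 : v 0 = 0
    · refine ⟨fun n => v + (1 / ((n : ℂ) + 1)) • EuclideanSpace.single 0 1, fun n => ?_, ?_⟩
      · have : (n : ℂ) + 1 ≠ 0 := by exact_mod_cast n.succ_ne_zero
        simp [h0, this]
      · have h1 : Tendsto (fun n : ℕ => 1 / ((n : ℂ) + 1)) atTop (𝓝 0) :=
          tendsto_one_div_add_atTop_nhds_zero_nat
        simpa using (h1.smul_const (EuclideanSpace.single (0 : Fin 2) (1 : ℂ))).const_add v
    · exact ⟨fun _ => v, fun _ => h0, tendsto_const_nhds⟩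
  have hcl : Continuous fun v : C2 => MvPolynomial.eval (fun j => v j) p := (contDiff_eval p).continuous
  have hcr : Continuous fun v : C2 => q.leadingCoeff *
      ((q.roots.map (fun r => (!₂[1, r] : C2)) +
        Multiset.replicate (n - q.roots.card) !₂[0, -1]).map fun a => wedge a v).prod := by
    refine continuous_const.mul (continuous_multiset_prod _ fun a _ => ?_)
    unfold wedge
    fun_prop
  intro v
  refine congrFun (hcl.ext_on hdense hcr fun v (hv : v 0 ≠ 0) => ?_) v
  have e1 : v = v 0 • (!₂[1, v 1 / v 0] : C2) := by
    ext i
    fin_cases i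
    · simp
    · simp; field_simp
  have e2 : MvPolynomial.eval (fun j => v j) p = v 0 ^ n * q.eval (v 1 / v 0) := by
    conv_lhs => rw [e1]
    rw [eval_smul_of_isHomogeneous hp, heval]
  simp only [e2]
  have e3 : q.eval (v 1 / v 0) =
      q.leadingCoeff * (q.roots.map fun r => v 1 / v 0 - r).prod := by
    conv_lhs => rw [hsplit]
    rw [Polynomial.eval_mul, Polynomial.eval_C, Polynomial.eval_multiset_prod, Multiset.map_map]
    simp
  have e4 : (q.roots.map fun r => wedge (!₂[1, r] : C2) v).prod =
      v 0 ^ q.roots.card * (q.roots.map fun r => v 1 / v 0 - r).prod := by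
    rw [← Multiset.card_map (fun r => v 1 / v 0 - r) q.roots, ← Multiset.prod_replicate,
      ← Multiset.map_const, Multiset.map_map, ← Multiset.prod_map_mul]
    refine congrArg Multiset.prod (Multiset.map_congr rfl fun r _ => ?_)
    simp [wedge]
    field_simp
  rw [e3, Multiset.map_add, Multiset.prod_add, Multiset.map_map, Multiset.map_replicate,
    Multiset.prod_replicate]
  simp only [Function.comp_def]
  rw [e4]
  have e5 : wedge (!₂[0, -1] : C2) v = v 0 := by simp [wedge]
  rw [e5]
  have e6 : v 0 ^ n = v 0 ^ (n - q.roots.card) * v 0 ^ q.roots.card := by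
    rw [← pow_add]; congr 1; omega
  rw [e6]
  ring

/-- A binary form of positive degree is a product of linear forms. -/
theorem exists_eval_eq_prod_wedge {n : ℕ} (hn : n ≠ 0) {p : MvPolynomial (Fin 2) ℂ}
    (hp : p.IsHomogeneous n) :
    ∃ a : Fin n → C2, ∀ v : C2, MvPolynomial.eval (fun j => v j) p = ∏ i, wedge (a i) v := by
  obtain ⟨k, s, hs, h⟩ := exists_eval_eq_mul_prod_wedge hp
  obtain ⟨l, rfl⟩ := Quotient.exists_rep s
  · simp only [Multiset.quot_mk_to_coe] at h
    replace hs : l.length = n := hs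
    subst hs
    obtain ⟨b, l', rfl⟩ := List.exists_cons_of_ne_nil (List.length_pos_iff.1 (Nat.pos_of_ne_zero hn))
    refine ⟨Fin.cons (k • b) l'.get, fun v => ?_⟩
    have e : wedge (k • b) v = k * wedge b v := by simp [wedge]; ring
    rw [h v]
    refine Eq.trans ?_ (Fin.prod_univ_succ _).symm
    simp only [Fin.cons_zero, Fin.cons_succ, e, Multiset.map_coe,
      Multiset.prod_coe, List.map_cons, List.prod_cons, mul_assoc]
    rw [← List.prod_ofFn]
    congr 3
    apply List.ext_get <;> simp

theorem ne_zero_of_prod_wedge {ι : Type*} [Fintype ι] {a : ι → C2} {v : C2}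
    (h : ∏ i, wedge (a i) v ≠ 0) (i : ι) : a i ≠ 0 := by
  rintro h0
  exact h (Finset.prod_eq_zero (Finset.mem_univ i) (by rw [h0, wedge_zero_left]))

/-! ### The Jacobian determinant -/

theorem hasDerivAt_eval_affineVec (p : MvPolynomial (Fin 2) ℂ) (i : Fin 2) (z : ℂ) :
    HasDerivAt (fun w => MvPolynomial.eval (fun j => affineVec i w j) p)
      (MvPolynomial.eval (fun j => affineVec i z j) (MvPolynomial.pderiv (1 - i) p)) z := by
  induction p using MvPolynomial.induction_on with
  | C a => simpa using hasDerivAt_const z a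
  | add p q hp hq => simpa using hp.fun_add hq
  | mul_X p j hp =>
    have hX : HasDerivAt (fun w => affineVec i w j)
        (MvPolynomial.eval (fun j => affineVec i z j)
          (MvPolynomial.pderiv (1 - i) (MvPolynomial.X j : MvPolynomial (Fin 2) ℂ))) z := by
      rw [MvPolynomial.pderiv_X]
      fin_cases i <;> fin_cases j <;>
        simp [hasDerivAt_const, hasDerivAt_id']
    have := hp.fun_mul hX
    simp only [Derivation.leibniz, smul_eq_mul, map_add, map_mul, MvPolynomial.eval_X] at this ⊢
    refine HasDerivAt.congr_deriv this ?_
    ring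

/-- By Euler's identity, the Jacobian determinant is `d` times a Wronskian in an affine chart. -/
theorem jacDet_affineVec (hF : ∀ i, (F i).IsHomogeneous d) (i : Fin 2) (z : ℂ) :
    jacDet F (affineVec i z) = d *
      (polyMap F (affineVec i z) i * deriv (fun w => polyMap F (affineVec i w) (1 - i)) z -
        polyMap F (affineVec i z) (1 - i) * deriv (fun w => polyMap F (affineVec i w) i) z) := by
  have hder : ∀ j, deriv (fun w => polyMap F (affineVec i w) j) z =
      MvPolynomial.eval (fun j => affineVec i z j) (MvPolynomial.pderiv (1 - i) (F j)) := fun j =>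
    (hasDerivAt_eval_affineVec (F j) i z).deriv
  have hE : ∀ j, d * polyMap F (affineVec i z) j =
      affineVec i z 0 * MvPolynomial.eval (fun j => affineVec i z j) (MvPolynomial.pderiv 0 (F j)) +
      affineVec i z 1 * MvPolynomial.eval (fun j => affineVec i z j)
        (MvPolynomial.pderiv 1 (F j)) := by
    intro j
    have h := congrArg (MvPolynomial.eval (fun j => affineVec i z j)) (hF j).sum_X_mul_pderiv
    rw [Fin.sum_univ_two] at h
    simp only [map_add, map_mul, MvPolynomial.eval_X, nsmul_eq_mul, map_natCast] at h
    rw [h]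
    rfl
  have h0 := hE 0
  have h1 := hE 1
  unfold jacDet jacPoly
  rw [Matrix.det_fin_two, hder, hder]
  simp only [Matrix.of_apply, map_sub, map_mul]
  fin_cases i
  · simp only [Fin.zero_eta, Fin.isValue, sub_zero, affineVec_zero_zero, affineVec_zero_one,
      one_mul] at h0 h1 ⊢
    linear_combination -(MvPolynomial.eval (fun j => affineVec 0 z j)
      (MvPolynomial.pderiv 1 (F 1))) * h0 + (MvPolynomial.eval (fun j => affineVec 0 z j)
      (MvPolynomial.pderiv 1 (F 0))) * h1
  · simp only [Fin.mk_one, Fin.isValue, sub_self, affineVec_one_zero, affineVec_one_one,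
      one_mul] at h0 h1 ⊢
    linear_combination (MvPolynomial.eval (fun j => affineVec 1 z j)
      (MvPolynomial.pderiv 0 (F 1))) * h0 - (MvPolynomial.eval (fun j => affineVec 1 z j)
      (MvPolynomial.pderiv 0 (F 0))) * h1

/-- A vanishing Wronskian would give a smooth positive form of mass one which is zero. -/
theorem IsHomMap.exists_affineWronskian_ne_zero {k : ℕ} {H : C2 → C2} (hH : IsHomMap k H)
    (hk : k ≠ 0) : ∃ z, affineWronskian H z ≠ 0 := by
  by_contra! h
  have h1 := hH.ddcForm_eq hk (isSmooth_const 1)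
  rw [ddcForm_const] at h1
  simp [h] at h1

/-- By the relation with the Wronskian, `det F'` does not vanish identically. -/
theorem IsLift.exists_jacDet_ne_zero (hF : IsLift d F f) (hd : 2 ≤ d) : ∃ v, jacDet F v ≠ 0 := by
  obtain ⟨z, hz⟩ := hF.isHomMap.exists_affineWronskian_ne_zero (by omega)
  refine ⟨affineVec 0 z, ?_⟩
  rw [jacDet_affineVec hF.homogeneous]
  refine mul_ne_zero (by exact_mod_cast (by omega : d ≠ 0)) ?_
  exact hz

/-- The components of a lift are not proportional. -/
theorem IsLift.exists_wedge_ne_zero (hF : IsLift d F f) (hd : 2 ≤ d) {c : C2} (hc : c ≠ 0) :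
    ∃ v, wedge c (polyMap F v) ≠ 0 := by
  by_contra! h
  obtain ⟨z, hz⟩ := hF.isHomMap.exists_affineWronskian_ne_zero (by omega)
  have e : ∀ w, c 0 * polyMap F (affineVec 0 w) 1 = c 1 * polyMap F (affineVec 0 w) 0 := fun w =>
    sub_eq_zero.1 (h (affineVec 0 w))
  have hd0 : ∀ j, DifferentiableAt ℂ (fun w => polyMap F (affineVec 0 w) j) z := fun j =>
    (hasDerivAt_eval_affineVec (F j) 0 z).differentiableAt
  have e' : c 0 * deriv (fun w => polyMap F (affineVec 0 w) 1) z =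
      c 1 * deriv (fun w => polyMap F (affineVec 0 w) 0) z := by
    rw [← deriv_const_mul _ (hd0 1), ← deriv_const_mul _ (hd0 0)]
    exact congrArg (fun g => deriv g z) (funext e)
  have h0 : c 0 * affineWronskian (polyMap F) z = 0 := by
    unfold affineWronskian
    linear_combination polyMap F (affineVec 0 z) 0 * e' -
      deriv (fun w => polyMap F (affineVec 0 w) 0) z * e z
  have h1 : c 1 * affineWronskian (polyMap F) z = 0 := by
    unfold affineWronskian
    linear_combination polyMap F (affineVec 0 z) 1 * e' -
      deriv (fun w => polyMap F (affineVec 0 w) 1) z * e z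
  refine hc ?_
  ext j
  fin_cases j
  · simpa [hz] using h0
  · simpa [hz] using h1

theorem isHomogeneous_jacPoly (hF : ∀ i, (F i).IsHomogeneous d) :
    (jacPoly F).IsHomogeneous (2 * d - 2) := by
  unfold jacPoly
  rw [Matrix.det_fin_two]
  have e : 2 * d - 2 = d - 1 + (d - 1) := by omega
  rw [e]
  exact ((hF 0).pderiv.mul (hF 1).pderiv).sub ((hF 0).pderiv.mul (hF 1).pderiv)

theorem IsLift.exists_jacDet_eq_prod (hF : IsLift d F f) (hd : 2 ≤ d) :
    ∃ c : Fin (2 * d - 2) → C2, ∀ v, jacDet F v = ∏ j, wedge (c j) v :=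
  exists_eval_eq_prod_wedge (by omega) (isHomogeneous_jacPoly hF.homogeneous)

theorem IsLift.exists_wedge_polyMap_eq_prod (hF : IsLift d F f) (hd : 2 ≤ d) (c : C2) :
    ∃ a : Fin d → C2, ∀ v, wedge c (polyMap F v) = ∏ i, wedge (a i) v := by
  have hp : (MvPolynomial.C (c 0) * F 1 - MvPolynomial.C (c 1) * F 0).IsHomogeneous d :=
    ((hF.homogeneous 1).C_mul _).sub ((hF.homogeneous 0).C_mul _)
  obtain ⟨a, ha⟩ := exists_eval_eq_prod_wedge (by omega) hp
  refine ⟨a, fun v => ?_⟩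
  rw [← ha v]
  simp [wedge, polyMap]

/-! ### Invariance of the Green measure -/

theorem IsLift.continuous (hF : IsLift d F f) : Continuous f := by
  refine continuous_coinduced_dom.2 ?_
  have e : f ∘ (Projectivization.mk' ℂ : { v : C2 // v ≠ 0 } → P1) =
      fun v : { v : C2 // v ≠ 0 } =>
        Projectivization.mk ℂ (polyMap F v.1) (hF.nondegenerate v.1 v.2) := by
    funext v
    exact hF.semiconj v.1 v.2
  rw [e]
  have hc : Continuous fun v : { v : C2 // v ≠ 0 } => polyMap F v.1 :=
    hF.isHomMap.contDiff.continuous.comp continuous_subtype_val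
  have hc' : Continuous fun v : { v : C2 // v ≠ 0 } =>
      (⟨polyMap F v.1, hF.nondegenerate v.1 v.2⟩ : { v : C2 // v ≠ 0 }) := hc.subtype_mk _
  exact continuous_mk.comp hc'

theorem IsLift.apply_eq (hF : IsLift d F f) (x : P1) :
    f x = Projectivization.mk ℂ (polyMap F x.rep) (hF.nondegenerate _ x.rep_nonzero) := by
  conv_lhs => rw [← x.mk_rep]
  exact hF.semiconj _ _

theorem log_norm_wedge_rep {c : C2} (hc : c ≠ 0) {x : P1} (hx : x ≠ Projectivization.mk ℂ c hc) :
    Real.log ‖wedge c x.rep‖ = logKernel c x + Real.log ‖c‖ + Real.log ‖x.rep‖ := by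
  have h1 := norm_ne_zero_iff.2 hc
  have h2 := norm_ne_zero_iff.2 x.rep_nonzero
  have h3 : ‖wedge c x.rep‖ ≠ 0 := by
    rw [norm_ne_zero_iff, ne_eq, wedge_eq_zero_iff hc x.rep_nonzero, x.mk_rep]
    exact hx.symm
  unfold logKernel chordal
  rw [Real.log_div h3 (mul_ne_zero h1 h2), Real.log_mul h1 h2]
  ring

theorem log_norm_prod_wedge_rep {ι : Type*} [Fintype ι] {a : ι → C2} (ha : ∀ i, a i ≠ 0) {x : P1}
    (hx : ∀ i, x ≠ Projectivization.mk ℂ (a i) (ha i)) :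
    Real.log ‖∏ i, wedge (a i) x.rep‖ =
      ∑ i, (logKernel (a i) x + Real.log ‖a i‖) + Fintype.card ι * Real.log ‖x.rep‖ := by
  rw [norm_prod, Real.log_prod fun i _ => ?_]
  · simp_rw [log_norm_wedge_rep (ha _) (hx _)]
    rw [Finset.sum_add_distrib]
    simp
  · rw [norm_ne_zero_iff, ne_eq, wedge_eq_zero_iff (ha i) x.rep_nonzero, x.mk_rep]
    exact (hx i).symm

/-- The preimages of `[c]` under `f`, with multiplicities, as vectors in `ℂ²` : the linear factors
of `c ∧ F`. -/
structure IsFiber (F : Fin 2 → MvPolynomial (Fin 2) ℂ) (c : C2) (a : Fin d → C2) : Prop where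
  ne_zero : ∀ i, a i ≠ 0
  wedge_eq : ∀ v, wedge c (polyMap F v) = ∏ i, wedge (a i) v

theorem IsLift.exists_isFiber (hF : IsLift d F f) (hd : 2 ≤ d) {c : C2} (hc : c ≠ 0) :
    ∃ a : Fin d → C2, IsFiber F c a := by
  obtain ⟨a, ha⟩ := hF.exists_wedge_polyMap_eq_prod hd c
  obtain ⟨v, hv⟩ := hF.exists_wedge_ne_zero hd hc
  exact ⟨a, ne_zero_of_prod_wedge (v := v) (by rwa [← ha v]), ha⟩

theorem wedge_self (a : C2) : wedge a a = 0 := by simp [wedge, mul_comm]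

theorem IsFiber.exists_polyMap_eq_smul (hF : IsLift d F f) {c : C2} (hc : c ≠ 0) {a : Fin d → C2}
    (ha : IsFiber F c a) (i : Fin d) : ∃ l : ℂ, l ≠ 0 ∧ polyMap F (a i) = l • c := by
  have h0 : wedge c (polyMap F (a i)) = 0 := by
    rw [ha.wedge_eq]
    exact Finset.prod_eq_zero (Finset.mem_univ i) (wedge_self _)
  have hn := hF.nondegenerate _ (ha.ne_zero i)
  rw [wedge_eq_zero_iff hc hn, Projectivization.mk_eq_mk_iff] at h0
  obtain ⟨u, hu⟩ := h0
  refine ⟨(u⁻¹ : ℂˣ), Units.ne_zero _, ?_⟩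
  rw [← hu, ← Units.smul_def, inv_smul_smul]

/-- `∏ |λ_i|`, where `F (a_i) = λ_i c` and the `a_i` are the linear factors of `c ∧ F`. -/
def fiberConst (F : Fin 2 → MvPolynomial (Fin 2) ℂ) (c : C2) (a : Fin d → C2) : ℝ :=
  ∏ i, ‖polyMap F (a i)‖ / ‖c‖

/-- Both sides are the modulus of the resultant of the binary forms `c ∧ F` and `b ∧ F`, in the form
of the product of the values of one at the zeros of the other. -/
theorem IsFiber.norm_wedge_mul (hF : IsLift d F f) {c : C2} (hc : c ≠ 0) {a : Fin d → C2}
    (ha : IsFiber F c a) (b : C2) :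
    ‖wedge b c‖ ^ d * fiberConst F c a = ∏ i, ‖wedge b (polyMap F (a i))‖ := by
  have h : ‖wedge b c‖ ^ d = ∏ _i : Fin d, ‖wedge b c‖ := by simp
  rw [h, fiberConst, ← Finset.prod_mul_distrib]
  refine Finset.prod_congr rfl fun i _ => ?_
  obtain ⟨l, hl, e⟩ := ha.exists_polyMap_eq_smul hF hc i
  have := norm_ne_zero_iff.2 hc
  rw [e, wedge_smul_right, norm_smul, norm_mul]
  field_simp

/-- The two products `∏ |b ∧ F (a_i)|` and `∏ |c ∧ F (a'_j)|` are equal, since both are `∏ |a_i ∧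
a'_j|`. -/
theorem IsFiber.fiberConst_eq_of_wedge_ne_zero (hF : IsLift d F f) {b c : C2} (hb : b ≠ 0) (hc : c ≠ 0)
    {a a' : Fin d → C2} (ha : IsFiber F c a) (ha' : IsFiber F b a') (h : wedge b c ≠ 0) :
    fiberConst F c a = fiberConst F b a' := by
  have h1 := ha.norm_wedge_mul hF hc b
  have h2 := ha'.norm_wedge_mul hF hb c
  simp_rw [ha'.wedge_eq, norm_prod] at h1
  simp_rw [ha.wedge_eq, norm_prod] at h2
  rw [Finset.prod_comm] at h2
  have h3 : ∀ i j, ‖wedge (a' j) (a i)‖ = ‖wedge (a i) (a' j)‖ := fun i j => by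
    rw [wedge_swap, norm_neg]
  simp_rw [h3] at h1
  rw [← h2, wedge_swap c b, norm_neg] at h1
  exact mul_left_cancel₀ (pow_ne_zero _ (norm_ne_zero_iff.2 h)) h1

theorem wedge_add_right (c v w : C2) : wedge c (v + w) = wedge c v + wedge c w := by
  simp [wedge]; ring

theorem exists_wedge_vec_ne_zero {b : C2} (hb : b ≠ 0) : ∃ e : C2, wedge b e ≠ 0 := by
  by_contra! h
  refine hb ?_
  ext j
  fin_cases j
  · simpa [wedge] using h !₂[0, 1]
  · simpa [wedge] using h !₂[1, 0]

theorem exists_wedge_ne_zero_ne_zero {b c : C2} (hb : b ≠ 0) (hc : c ≠ 0) :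
    ∃ e : C2, e ≠ 0 ∧ wedge b e ≠ 0 ∧ wedge c e ≠ 0 := by
  suffices h : ∃ e : C2, wedge b e ≠ 0 ∧ wedge c e ≠ 0 by
    obtain ⟨e, h1, h2⟩ := h
    refine ⟨e, ?_, h1, h2⟩
    rintro rfl
    simp [wedge] at h1
  obtain ⟨e, he⟩ := exists_wedge_vec_ne_zero hb
  obtain ⟨e', he'⟩ := exists_wedge_vec_ne_zero hc
  by_cases h1 : wedge c e = 0
  · by_cases h2 : wedge b e' = 0
    · exact ⟨e + e', by simpa [wedge_add_right, h2] using he, by simpa [wedge_add_right, h1] using he'⟩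
    · exact ⟨e', h2, he'⟩
  · exact ⟨e, he, h1⟩

/-- The constant of a fiber is the same for all points: up to powers of `b ∧ c` it is the resultant
of `b ∧ F` and `c ∧ F`, which is symmetric in `b` and `c`. -/
theorem IsFiber.fiberConst_eq (hF : IsLift d F f) (hd : 2 ≤ d) {b c : C2} (hb : b ≠ 0) (hc : c ≠ 0)
    {a a' : Fin d → C2} (ha : IsFiber F c a) (ha' : IsFiber F b a') :
    fiberConst F c a = fiberConst F b a' := by
  obtain ⟨e, he, h1, h2⟩ := exists_wedge_ne_zero_ne_zero hb hc
  obtain ⟨a'', ha''⟩ := hF.exists_isFiber hd he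
  rw [← ha''.fiberConst_eq_of_wedge_ne_zero hF hb he ha' h1,
    ← ha''.fiberConst_eq_of_wedge_ne_zero hF hc he ha h2]

/-- The sum of `G_F` over a fiber, from `d G_F (a_i) = G_F (F (a_i)) = G_F (c) + log |λ_i|`. -/
theorem IsFiber.sum_greenFun (hF : IsLift d F f) (hd : 2 ≤ d) {c : C2} (hc : c ≠ 0) {a : Fin d → C2}
    (ha : IsFiber F c a) :
    ∑ i, greenFun d F (a i) = greenFun d F c + (d : ℝ)⁻¹ * Real.log (fiberConst F c a) := by
  have hd0 : (d : ℝ) ≠ 0 := by positivity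
  have hn := norm_ne_zero_iff.2 hc
  have h1 : ∀ i, greenFun d F (a i) =
      (d : ℝ)⁻¹ * (greenFun d F c + Real.log (‖polyMap F (a i)‖ / ‖c‖)) := by
    intro i
    obtain ⟨l, hl, e⟩ := ha.exists_polyMap_eq_smul hF hc i
    have h2 := hF.greenFun_map hd (ha.ne_zero i)
    rw [e, hF.greenFun_smul hd hl hc] at h2
    rw [e, norm_smul, mul_div_cancel_right₀ _ hn, h2]
    field_simp
  rw [fiberConst, Real.log_prod fun i _ => div_ne_zero
    (norm_ne_zero_iff.2 (hF.nondegenerate _ (ha.ne_zero i))) hn]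
  simp_rw [h1]
  rw [← Finset.mul_sum, Finset.sum_add_distrib, mul_add]
  simp [hd0]

/-- The kernel composed with `f` is a sum of kernels over the fiber of its pole, up to a smooth
function. -/
theorem IsLift.logKernel_comp (hF : IsLift d F f) {c : C2} (hc : c ≠ 0) {a : Fin d → C2}
    (ha : IsFiber F c a) {x : P1} (hx : ∀ i, x ≠ Projectivization.mk ℂ (a i) (ha.ne_zero i)) :
    logKernel c (f x) = ∑ i, (logKernel (a i) x + Real.log ‖a i‖) - Real.log ‖c‖ -
      homPotential d (polyMap F) x := by
  have h := log_norm_prod_wedge_rep ha.ne_zero hx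
  rw [Fintype.card_fin, ← ha.wedge_eq] at h
  have hn := hF.nondegenerate _ x.rep_nonzero
  have h1 := norm_ne_zero_iff.2 hc
  have h2 := norm_ne_zero_iff.2 hn
  have h3 : ‖wedge c (polyMap F x.rep)‖ ≠ 0 := by
    rw [ha.wedge_eq, norm_ne_zero_iff, Finset.prod_ne_zero_iff]
    intro i _
    rw [ne_eq, wedge_eq_zero_iff (ha.ne_zero i) x.rep_nonzero, x.mk_rep]
    exact (hx i).symm
  rw [hF.apply_eq, logKernel_mk]
  unfold chordal homPotential
  rw [Real.log_div h3 (mul_ne_zero h1 h2), Real.log_mul h1 h2, h]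
  ring

/-- The potential of the image of the Green measure is the Green function, up to a constant. -/
theorem IsLift.exists_potential_comp (hF : IsLift d F f) (hd : 2 ≤ d) {μ : Measure P1}
    (hμ : IsGreenMeasure d F μ) : ∃ K : ℝ, ∀ y : P1,
      Integrable (fun x => logKernel y.rep (f x)) μ ∧
        ∫ x, logKernel y.rep (f x) ∂μ = greenFunP1 d F y + K := by
  have := hμ.isProbabilityMeasure
  obtain ⟨a₀, ha₀⟩ := hF.exists_isFiber hd (affineVec_ne_zero 0 0)
  refine ⟨(d : ℝ)⁻¹ * Real.log (fiberConst F (affineVec 0 0) a₀) -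
    d * ((∫ x, greenFunP1 d F x ∂fubiniStudy) + 1 / 2) - ∫ x, homPotential d (polyMap F) x ∂μ,
    fun y => ?_⟩
  have hy := y.rep_nonzero
  obtain ⟨a, ha⟩ := hF.exists_isFiber hd hy
  have hp := fun i => hF.potential hd hμ (ha.ne_zero i)
  have hh : Integrable (homPotential d (polyMap F)) μ := hF.isHomMap.isSmooth.integrable μ
  have hae : (fun x => logKernel y.rep (f x)) =ᵐ[μ] fun x =>
      ∑ i, (logKernel (a i) x + Real.log ‖a i‖) - Real.log ‖y.rep‖ -
        homPotential d (polyMap F) x := by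
    filter_upwards [ae_all_iff.2 fun i => (hp i).1] with x hx
    exact hF.logKernel_comp hy ha hx
  have i1 : ∀ i, Integrable (fun x => logKernel (a i) x + Real.log ‖a i‖) μ := fun i =>
    (hp i).2.1.add (integrable_const _)
  have i2 : Integrable (fun x => ∑ i, (logKernel (a i) x + Real.log ‖a i‖)) μ :=
    integrable_finsetSum _ fun i _ => i1 i
  have i3 : Integrable (fun x => ∑ i, (logKernel (a i) x + Real.log ‖a i‖) - Real.log ‖y.rep‖) μ :=
    i2.sub (integrable_const _)
  refine ⟨(i3.sub hh).congr hae.symm, ?_⟩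
  rw [integral_congr_ae hae, integral_sub i3 hh, integral_sub i2 (integrable_const _),
    integral_finsetSum _ fun i _ => i1 i]
  have e1 : ∀ i, ∫ x, (logKernel (a i) x + Real.log ‖a i‖) ∂μ =
      greenFun d F (a i) - ((∫ x, greenFunP1 d F x ∂fubiniStudy) + 1 / 2) := by
    intro i
    rw [integral_add (hp i).2.1 (integrable_const _), (hp i).2.2, hF.greenFunP1_mk hd]
    simp only [integral_const, probReal_univ, one_smul]
    ring
  simp_rw [e1]
  rw [Finset.sum_sub_distrib, ha.sum_greenFun hF hd hy,
    ha.fiberConst_eq hF hd (affineVec_ne_zero 0 0) hy ha₀]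
  simp only [integral_const, probReal_univ, one_smul, Finset.sum_const, Finset.card_univ,
    Fintype.card_fin, nsmul_eq_mul, greenFunP1]
  ring

theorem measurable_logKernel_prod :
    Measurable fun p : P1 × P1 => logKernel p.1.rep p.2 := by
  refine Real.measurable_log.comp
    (measurable_uncurry_of_continuous_of_measurable (u := fun y x : P1 => chordal y.rep x.rep)
      (fun x => ?_) fun y => (continuous_chordal_rep y.rep_nonzero).measurable)
  simp_rw [chordal_comm _ x.rep]
  exact continuous_chordal_rep x.rep_nonzero

theorem logKernel_rep_comm (x y : P1) : logKernel x.rep y = logKernel y.rep x := by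
  unfold logKernel
  rw [chordal_comm]

/-- Fubini's theorem for the mutual energy of `ν` and of the image of `μ`. -/
theorem integral_logKernel_swap {μ ν : Measure P1} [IsProbabilityMeasure μ] [IsProbabilityMeasure ν]
    {f : P1 → P1} (hf : Continuous f) {h : P1 → ℝ} (hh : Continuous h)
    (hi : ∀ y : P1, Integrable (fun x => logKernel y.rep (f x)) μ)
    (he : ∀ y : P1, ∫ x, logKernel y.rep (f x) ∂μ = h y) :
    ∫ x, (∫ y, logKernel (f x).rep y ∂ν) ∂μ = ∫ y, h y ∂ν := by
  have hp : Measurable fun p : P1 × P1 => (p.1, f p.2) :=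
    measurable_fst.prodMk (hf.measurable.comp measurable_snd)
  have hm : Measurable (Function.uncurry fun y x : P1 => logKernel y.rep (f x)) := by
    have e : (Function.uncurry fun y x : P1 => logKernel y.rep (f x)) =
        (fun p : P1 × P1 => logKernel p.1.rep p.2) ∘ fun p => (p.1, f p.2) := rfl
    rw [e]
    exact measurable_logKernel_prod.comp hp
  have hint : Integrable (Function.uncurry fun y x : P1 => logKernel y.rep (f x)) (ν.prod μ) := by
    rw [integrable_prod_iff hm.aestronglyMeasurable]
    refine ⟨ae_of_all _ hi, ?_⟩
    -- the kernel is non-positive, so that its integrals along fibers control its absolute value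
    refine (Continuous.integrable_P1 hh.neg ν).congr (ae_of_all _ fun y => ?_)
    simp only [Function.uncurry_apply_pair, Real.norm_of_nonpos (logKernel_nonpos _ _)]
    rw [integral_neg, he, Pi.neg_apply]
  have := integral_integral_swap hint
  simp_rw [he] at this
  rw [this]
  simp_rw [fun x (y : P1) => logKernel_rep_comm (f x) y]

/-- The potentials of `μ` and of its image under `f` differ by a constant, which is zero since both
have the same mean for the Fubini-Study measure. The symmetry of the mutual energy of `μ` and its
image then gives the invariance of `μ`, tested on its own potential. -/
theorem IsLift.integral_greenFunP1_comp (hF : IsLift d F f) (hd : 2 ≤ d) {μ : Measure P1}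
    (hμ : IsGreenMeasure d F μ) : ∫ x, greenFunP1 d F (f x) ∂μ = ∫ x, greenFunP1 d F x ∂μ := by
  have := hμ.isProbabilityMeasure
  have hg := hF.continuous_greenFunP1 hd
  obtain ⟨K, hK⟩ := hF.exists_potential_comp hd hμ
  have hgK : Continuous fun y => greenFunP1 d F y + K := hg.add continuous_const
  -- against `ω`, where both potentials have mean `-1/2`: this determines `K`
  have h1 := integral_logKernel_swap (ν := fubiniStudy) hF.continuous hgK (fun y => (hK y).1)
    fun y => (hK y).2
  -- against `μ`: an identity between the integrals of `g_F ∘ f` and of `g_F`, up to `K`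
  have h2 := integral_logKernel_swap (ν := μ) hF.continuous hgK (fun y => (hK y).1)
    fun y => (hK y).2
  have hgf : Integrable (fun x => greenFunP1 d F (f x)) μ :=
    Continuous.integrable_P1 (hg.comp hF.continuous) μ
  simp_rw [fun x => integral_logKernel_fubiniStudy (f x).rep_nonzero] at h1
  simp_rw [fun x => (hF.potential hd hμ (f x).rep_nonzero).2.2, (f _).mk_rep] at h2
  rw [integral_add (Continuous.integrable_P1 hg _) (integrable_const _)] at h1 h2
  rw [integral_sub hgf (integrable_const _)] at h2
  simp only [integral_const, probReal_univ, one_smul] at h1 h2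
  linarith

/-! ### The differential of the rational map -/

theorem rep_chartIndex_ne_zero (x : P1) : x.rep (chartIndex x) ≠ 0 := by
  by_cases h : x.rep 0 ≠ 0
  · rwa [chartIndex, if_pos h]
  · rw [chartIndex, if_neg h]
    intro h1
    refine x.rep_nonzero ?_
    ext j
    fin_cases j
    · simpa using h
    · simpa using h1

theorem affineVec_coord (x : P1) :
    affineVec (chartIndex x) (coord (chartIndex x) x) =
      (x.rep (chartIndex x))⁻¹ • x.rep := by
  have h := rep_chartIndex_ne_zero x
  unfold coord
  generalize chartIndex x = i at h
  ext j
  fin_cases i <;> fin_cases j <;> simp at h ⊢ <;> field_simp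

theorem chart_coord (x : P1) : chart (chartIndex x) (coord (chartIndex x) x) = x := by
  conv_rhs => rw [← x.mk_rep]
  unfold chart
  rw [Projectivization.mk_eq_mk_iff']
  exact ⟨_, (affineVec_coord x).symm⟩

theorem coord_mk (i : Fin 2) (v : C2) (hv : v ≠ 0) :
    coord i (Projectivization.mk ℂ v hv) = v (1 - i) / v i := by
  refine apply_rep_mk (Φ := fun v => v (1 - i) / v i) (fun a ha v _ => ?_) v hv
  simp [mul_div_mul_left _ _ ha]

/-- The derivative of either quotient `p₁ / p₀`, `p₀ / p₁` is, up to sign, the Wronskian divided by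
the square of the denominator. -/
theorem norm_deriv_div_eq_norm_wronskian (p : Fin 2 → ℂ → ℂ) (z : ℂ) (hp : ∀ j, DifferentiableAt ℂ (p j) z)
    (i j : Fin 2) (hj : p j z ≠ 0) :
    ‖deriv (fun w => p (1 - j) w / p j w) z‖ =
      ‖p i z * deriv (p (1 - i)) z - p (1 - i) z * deriv (p i) z‖ / ‖p j z‖ ^ 2 := by
  rw [deriv_fun_div (hp _) (hp _) hj, norm_div, norm_pow]
  congr 1
  fin_cases i <;> fin_cases j
  · simp [mul_comm]
  · simp; rw [← norm_neg]; congr 1; ring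
  · simp; rw [← norm_neg]; congr 1; ring
  · simp [mul_comm]

/-- The norm of the differential, in terms of the Jacobian determinant of the lift. -/
theorem IsLift.sphericalDeriv_eq (hF : IsLift d F f) (hd : 2 ≤ d) (x : P1) :
    d * sphericalDeriv f x = ‖jacDet F x.rep‖ * ‖x.rep‖ ^ 2 / ‖polyMap F x.rep‖ ^ 2 := by
  set i := chartIndex x with hi
  set j := chartIndex (f x) with hj
  set z := coord i x with hz
  have hd0 : (d : ℝ) ≠ 0 := by positivity
  have hx : chart i z = x := chart_coord x
  set v := affineVec i z with hv
  have hv0 : v ≠ 0 := affineVec_ne_zero i z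
  have hFv := hF.nondegenerate v hv0
  have hnF := norm_ne_zero_iff.2 hFv
  have hfx : f x = Projectivization.mk ℂ (polyMap F v) hFv := by
    rw [← hx]; exact hF.semiconj v hv0
  have hcoord : ∀ w, (coord j ∘ f ∘ chart i) w =
      polyMap F (affineVec i w) (1 - j) / polyMap F (affineVec i w) j := by
    intro w
    simp only [Function.comp_apply]
    unfold chart
    rw [hF.semiconj _ (affineVec_ne_zero i w), coord_mk]
  have hPj : polyMap F v j ≠ 0 := by
    obtain ⟨a, ha, e⟩ := exists_rep_mk (polyMap F v) hFv
    have h := rep_chartIndex_ne_zero (f x)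
    rw [← hj, hfx, e] at h
    intro h0
    simp [h0] at h
  have hnP := norm_ne_zero_iff.2 hPj
  have hder := norm_deriv_div_eq_norm_wronskian (fun k w => polyMap F (affineVec i w) k) z
    (fun k => (hasDerivAt_eval_affineVec (F k) i z).differentiableAt) i j hPj
  have hjac : ‖jacDet F v‖ = d * ‖polyMap F v i * deriv (fun w => polyMap F (affineVec i w) (1 - i)) z -
      polyMap F v (1 - i) * deriv (fun w => polyMap F (affineVec i w) i) z‖ := by
    rw [hv, jacDet_affineVec hF.homogeneous, norm_mul, Complex.norm_natCast]
  have hnv : 1 + ‖z‖ ^ 2 = ‖v‖ ^ 2 := (norm_sq_affineVec i z).symm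
  have hnw : 1 + ‖coord j (f x)‖ ^ 2 = ‖polyMap F v‖ ^ 2 / ‖polyMap F v j‖ ^ 2 := by
    rw [hfx, coord_mk, norm_div, norm_sq_C2 (polyMap F v)]
    generalize polyMap F v = w at hnP
    generalize j = j at hnP
    fin_cases j
    · simp at hnP ⊢; field_simp
    · simp at hnP ⊢; field_simp; ring
  have hinv : ‖jacDet F x.rep‖ * ‖x.rep‖ ^ 2 / ‖polyMap F x.rep‖ ^ 2 =
      ‖jacDet F v‖ * ‖v‖ ^ 2 / ‖polyMap F v‖ ^ 2 := by
    rw [← hx]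
    refine apply_rep_mk (Φ := fun v => ‖jacDet F v‖ * ‖v‖ ^ 2 / ‖polyMap F v‖ ^ 2)
      (fun a ha u hu => ?_) v hv0
    have h1 : jacDet F (a • u) = a ^ (2 * d - 2) * jacDet F u :=
      eval_smul_of_isHomogeneous (isHomogeneous_jacPoly hF.homogeneous) a u
    have h2 := norm_ne_zero_iff.2 ha
    have h3 := norm_ne_zero_iff.2 (hF.nondegenerate u hu)
    rw [h1, hF.isHomMap.map_smul, norm_mul, norm_smul, norm_smul, norm_pow, norm_pow]
    have h4 : (‖a‖ ^ d) ^ 2 = ‖a‖ ^ (2 * d - 2) * ‖a‖ ^ 2 := by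
      rw [← pow_mul, ← pow_add]; congr 1; omega
    rw [mul_pow, mul_pow, h4]
    field_simp
  rw [hinv]
  unfold sphericalDeriv
  rw [← hi, ← hj, ← hz, hnv, hnw, funext hcoord, hder, hjac]
  rw [hv] at hnF hnP ⊢
  field_simp

/-! ### The critical divisor -/

/-- The linear factors of the Jacobian determinant. -/
structure IsCritical (F : Fin 2 → MvPolynomial (Fin 2) ℂ) (c : Fin (2 * d - 2) → C2) : Prop where
  ne_zero : ∀ j, c j ≠ 0
  jacDet_eq : ∀ v, jacDet F v = ∏ j, wedge (c j) v

theorem IsLift.isCritical (hF : IsLift d F f) (hd : 2 ≤ d) {c : Fin (2 * d - 2) → C2}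
    (hc : ∀ v, jacDet F v = ∏ j, wedge (c j) v) : IsCritical F c := by
  obtain ⟨v, hv⟩ := hF.exists_jacDet_ne_zero hd
  exact ⟨ne_zero_of_prod_wedge (v := v) (by rwa [← hc v]), hc⟩

theorem analyticAt_wedge_affineVec (c : C2) (i : Fin 2) (z : ℂ) :
    AnalyticAt ℂ (fun w => wedge c (affineVec i w)) z := by
  unfold wedge
  fin_cases i <;> simp <;> fun_prop

open Classical in
/-- A linear form has simple zeros in affine charts. -/
theorem analyticOrderAt_wedge {c : C2} (hc : c ≠ 0) (i : Fin 2) (z : ℂ) :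
    analyticOrderAt (fun w => wedge c (affineVec i w)) z =
      if Projectivization.mk ℂ c hc = chart i z then 1 else 0 := by
  have hiff := wedge_eq_zero_iff hc (affineVec_ne_zero i z)
  have han := analyticAt_wedge_affineVec c i z
  split_ifs with h
  · have h0 : wedge c (affineVec i z) = 0 := hiff.2 h
    refine han.analyticOrderAt_eq_one_of_zero_deriv_ne_zero h0 fun h1 => hc ?_
    ext j
    fin_cases i
    · have e : (fun w => wedge c (affineVec 0 w)) = fun w => c 0 * w - c 1 := by
        funext w; simp [wedge]
      have h2 : c 0 = 0 := by simpa [e] using h1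
      have h3 : c 1 = 0 := by simpa [wedge, h2] using h0
      fin_cases j
      · exact h2
      · exact h3
    · have e : (fun w => wedge c (affineVec 1 w)) = fun w => c 0 - c 1 * w := by
        funext w; simp [wedge]
      have h2 : c 1 = 0 := by simpa [e] using h1
      have h3 : c 0 = 0 := by simpa [wedge, h2] using h0
      fin_cases j
      · exact h3
      · exact h2
  · rw [han.analyticOrderAt_eq_zero]
    exact fun h0 => h (hiff.1 h0)

theorem analyticOrderAt_finsetProd {ι : Type*} (s : Finset ι) (p : ι → ℂ → ℂ) (z : ℂ)
    (hp : ∀ i ∈ s, AnalyticAt ℂ (p i) z) :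
    analyticOrderAt (fun w => ∏ i ∈ s, p i w) z = ∑ i ∈ s, analyticOrderAt (p i) z := by
  classical
  induction s using Finset.induction_on with
  | empty =>
    simp only [Finset.prod_empty, Finset.sum_empty]
    rw [analyticAt_const.analyticOrderAt_eq_zero]
    exact one_ne_zero
  | insert i s hi ih =>
    rw [Finset.sum_insert hi, ← ih fun j hj => hp j (Finset.mem_insert_of_mem hj)]
    simp_rw [Finset.prod_insert hi]
    exact analyticOrderAt_mul (hp i (Finset.mem_insert_self i s))
      (Finset.analyticAt_fun_prod s fun j hj => hp j (Finset.mem_insert_of_mem hj))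

open Classical in
/-- The multiplicity of `x` as a zero of `J_F` counts the linear factors vanishing at `x`. -/
theorem IsCritical.critMult_eq {c : Fin (2 * d - 2) → C2} (hc : IsCritical F c) (x : P1) :
    critMult F x = (Finset.univ.filter
      fun j => Projectivization.mk ℂ (c j) (hc.ne_zero j) = x).card := by
  unfold critMult analyticOrderNatAt
  simp_rw [hc.jacDet_eq]
  rw [analyticOrderAt_finsetProd _ _ _ fun j _ => analyticAt_wedge_affineVec _ _ _]
  simp_rw [fun j => analyticOrderAt_wedge (hc.ne_zero j), chart_coord]
  rw [Finset.sum_boole]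
  simp

theorem IsCritical.critCurrent_eq {c : Fin (2 * d - 2) → C2} (hc : IsCritical F c) :
    critCurrent F = ∑ j, Measure.dirac (Projectivization.mk ℂ (c j) (hc.ne_zero j)) := by
  classical
  rw [Finset.sum_comp (fun x => Measure.dirac x)
    fun j => Projectivization.mk ℂ (c j) (hc.ne_zero j)]
  unfold critCurrent
  rw [finsum_eq_sum_of_support_subset (s := Finset.univ.image
    fun j => Projectivization.mk ℂ (c j) (hc.ne_zero j))]
  · refine Finset.sum_congr rfl fun x _ => ?_
    rw [hc.critMult_eq, Nat.cast_smul_eq_nsmul]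
  · intro x hx
    by_contra hn
    refine hx ?_
    have : critMult F x = 0 := by
      rw [hc.critMult_eq, Finset.card_eq_zero, Finset.filter_eq_empty_iff]
      intro j _ h
      exact hn (by simpa using ⟨j, h⟩)
    simp [this]

/-! ### The Lyapunov exponent -/

/-- Off the critical points, `log ‖J_F‖₀` is a sum of kernels with poles at the critical points. -/
theorem IsCritical.log_normJac (hd : 2 ≤ d) {c : Fin (2 * d - 2) → C2} (hc : IsCritical F c) {x : P1}
    (hx : ∀ j, x ≠ Projectivization.mk ℂ (c j) (hc.ne_zero j)) :
    jacDet F x.rep ≠ 0 ∧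
      Real.log (normJac d F x) = ∑ j, (logKernel (c j) x + Real.log ‖c j‖) := by
  have h0 : jacDet F x.rep ≠ 0 := by
    rw [hc.jacDet_eq, Finset.prod_ne_zero_iff]
    intro j _
    rw [ne_eq, wedge_eq_zero_iff (hc.ne_zero j) x.rep_nonzero, x.mk_rep]
    exact (hx j).symm
  refine ⟨h0, ?_⟩
  have h := log_norm_prod_wedge_rep hc.ne_zero hx
  rw [← hc.jacDet_eq, Fintype.card_fin, Nat.cast_sub (by omega)] at h
  unfold normJac
  rw [Real.log_mul (Real.exp_pos _).ne' (norm_ne_zero_iff.2 h0), Real.log_exp, h]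
  push_cast
  ring

/-- The logarithm of the chain rule `F ∘ π = π ∘ f` for the norms of the differentials. -/
theorem IsLift.log_sphericalDeriv (hF : IsLift d F f) (hd : 2 ≤ d) {x : P1} (hx : jacDet F x.rep ≠ 0) :
    Real.log (sphericalDeriv f x) = Real.log (normJac d F x) +
      2 * (greenFunP1 d F (f x) - d * greenFunP1 d F x) - Real.log d := by
  have hd0 : (d : ℝ) ≠ 0 := by positivity
  have h := hF.sphericalDeriv_eq hd x
  have h1 := norm_ne_zero_iff.2 hx
  have h2 := norm_ne_zero_iff.2 x.rep_nonzero
  have h3 := norm_ne_zero_iff.2 (hF.nondegenerate _ x.rep_nonzero)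
  have h4 : sphericalDeriv f x ≠ 0 := by
    intro h0
    rw [h0, mul_zero, eq_comm, div_eq_zero_iff] at h
    simp [h1, h2, h3] at h
  have h5 := congrArg Real.log h
  rw [Real.log_mul hd0 h4, Real.log_div (mul_ne_zero h1 (pow_ne_zero _ h2)) (pow_ne_zero _ h3),
    Real.log_mul h1 (pow_ne_zero _ h2), Real.log_pow, Real.log_pow] at h5
  rw [hF.greenFunP1_comp hd]
  unfold normJac homPotential
  rw [Real.log_mul (Real.exp_pos _).ne' h1, Real.log_exp]
  push_cast at h5
  linarith

theorem integrable_sum_logKernel {ι : Type*} [Fintype ι] {ν : Measure P1} [IsFiniteMeasure ν]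
    {c : ι → C2} (hi : ∀ j, Integrable (logKernel (c j)) ν) :
    Integrable (fun x => ∑ j, (logKernel (c j) x + Real.log ‖c j‖)) ν :=
  integrable_finsetSum _ fun j _ => (hi j).add (integrable_const _)

theorem integral_sum_logKernel {ι : Type*} [Fintype ι] {ν : Measure P1} [IsProbabilityMeasure ν]
    {c : ι → C2} (hi : ∀ j, Integrable (logKernel (c j)) ν) :
    ∫ x, ∑ j, (logKernel (c j) x + Real.log ‖c j‖) ∂ν =
      ∑ j, ((∫ x, logKernel (c j) x ∂ν) + Real.log ‖c j‖) := by
  have hi' : ∀ j ∈ Finset.univ, Integrable (fun x => logKernel (c j) x + Real.log ‖c j‖) ν :=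
    fun j _ => (hi j).add (integrable_const _)
  rw [integral_finsetSum _ hi']
  refine Finset.sum_congr rfl fun j _ => ?_
  rw [integral_add (hi j) (integrable_const _)]
  simp

theorem IsCritical.integral_log_normJac (hd : 2 ≤ d) {c : Fin (2 * d - 2) → C2}
    (hc : IsCritical F c) :
    Integrable (fun x => Real.log (normJac d F x)) fubiniStudy ∧
      ∫ x, Real.log (normJac d F x) ∂fubiniStudy = ∑ j, Real.log ‖c j‖ - ((d : ℝ) - 1) := by
  have hae : (fun x => Real.log (normJac d F x)) =ᵐ[fubiniStudy]
      fun x => ∑ j, (logKernel (c j) x + Real.log ‖c j‖) := by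
    filter_upwards [ae_all_iff.2 fun j => fubiniStudy_ae_ne
      (Projectivization.mk ℂ (c j) (hc.ne_zero j))] with x hx
    exact (hc.log_normJac hd hx).2
  have hi := fun j => integrable_logKernel_fubiniStudy (hc.ne_zero j)
  refine ⟨(integrable_sum_logKernel hi).congr hae.symm, ?_⟩
  rw [integral_congr_ae hae, integral_sum_logKernel hi]
  simp_rw [fun j => integral_logKernel_fubiniStudy (hc.ne_zero j)]
  rw [Finset.sum_add_distrib]
  simp only [Finset.sum_const, Finset.card_univ, Fintype.card_fin, nsmul_eq_mul]
  rw [Nat.cast_sub (by omega)]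
  push_cast
  ring

theorem IsCritical.integral_greenFunP1 (hF : IsLift d F f) (hd : 2 ≤ d) {c : Fin (2 * d - 2) → C2}
    (hc : IsCritical F c) :
    Integrable (greenFunP1 d F) (critCurrent F) ∧
      ∫ x, greenFunP1 d F x ∂(critCurrent F) = ∑ j, (greenFun d F (c j) - Real.log ‖c j‖) := by
  have hg := hF.continuous_greenFunP1 hd
  have hi : ∀ j ∈ Finset.univ, Integrable (greenFunP1 d F)
      (Measure.dirac (Projectivization.mk ℂ (c j) (hc.ne_zero j))) := fun j _ =>
    Continuous.integrable_P1 hg _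
  rw [hc.critCurrent_eq]
  refine ⟨integrable_finsetSum_measure.2 hi, ?_⟩
  rw [integral_finsetSum_measure hi]
  refine Finset.sum_congr rfl fun j _ => ?_
  rw [integral_dirac, hF.greenFunP1_mk hd]

/-- The Lyapunov exponent in terms of the linear factors of the Jacobian determinant: the potential
of the Green measure is evaluated at the critical points, and the invariance of the measure removes
the cocycle `g_F ∘ f - d g_F`. -/
theorem IsCritical.lyapunovExponent_eq (hF : IsLift d F f) (hd : 2 ≤ d) {c : Fin (2 * d - 2) → C2}
    (hc : IsCritical F c) {μ : Measure P1} (hμ : IsGreenMeasure d F μ) :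
    Integrable (fun x => Real.log (sphericalDeriv f x)) μ ∧
      lyapunovExponent f μ + Real.log d =
        (∑ j, greenFun d F (c j)) -
          ((d : ℝ) - 1) * (1 + 2 * ∫ x, greenFunP1 d F x ∂(μ + fubiniStudy)) := by
  have := hμ.isProbabilityMeasure
  have hg := hF.continuous_greenFunP1 hd
  have hgi := Continuous.integrable_P1 hg μ
  have hgf : Integrable (fun x => greenFunP1 d F (f x)) μ :=
    Continuous.integrable_P1 (hg.comp hF.continuous) μ
  have hp := fun j => hF.potential hd hμ (hc.ne_zero j)
  have hae : (fun x => Real.log (sphericalDeriv f x)) =ᵐ[μ] fun x =>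
      ∑ j, (logKernel (c j) x + Real.log ‖c j‖) +
        2 * (greenFunP1 d F (f x) - d * greenFunP1 d F x) - Real.log d := by
    filter_upwards [ae_all_iff.2 fun j => (hp j).1] with x hx
    obtain ⟨h0, h1⟩ := hc.log_normJac hd hx
    rw [hF.log_sphericalDeriv hd h0, h1]
  have i1 := integrable_sum_logKernel fun j => (hp j).2.1
  have i2 : Integrable (fun x => 2 * (greenFunP1 d F (f x) - d * greenFunP1 d F x)) μ :=
    (hgf.sub (hgi.const_mul _)).const_mul 2
  have i3 : Integrable (fun x => ∑ j, (logKernel (c j) x + Real.log ‖c j‖) +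
      2 * (greenFunP1 d F (f x) - d * greenFunP1 d F x)) μ := i1.add i2
  refine ⟨(i3.sub (integrable_const _)).congr hae.symm, ?_⟩
  unfold lyapunovExponent
  rw [integral_congr_ae hae, integral_sub i3 (integrable_const _), integral_add i1 i2,
    integral_sum_logKernel fun j => (hp j).2.1, integral_const_mul,
    integral_sub hgf (hgi.const_mul _), integral_const_mul, hF.integral_greenFunP1_comp hd hμ,
    integral_add_measure hgi (Continuous.integrable_P1 hg fubiniStudy)]
  have e : ∀ j, (∫ x, logKernel (c j) x ∂μ) + Real.log ‖c j‖ =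
      greenFun d F (c j) - ((∫ x, greenFunP1 d F x ∂fubiniStudy) + 1 / 2) := by
    intro j
    rw [(hp j).2.2, hF.greenFunP1_mk hd]
    ring
  simp_rw [e]
  rw [Finset.sum_sub_distrib]
  simp only [integral_const, probReal_univ, one_smul, Finset.sum_const, Finset.card_univ,
    Fintype.card_fin, nsmul_eq_mul]
  rw [Nat.cast_sub (by omega)]
  push_cast
  ring

/-! ### Quaternionic rotations of `ℂ²` -/

/-- The real linear map `z ↦ u (-z̄₁, z̄₀)`: its value at `z` is Hermitian-orthogonal to `z`. -/
def quatRot (u : ℂ) : C2 →L[ℝ] C2 :=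
  LinearMap.toContinuousLinearMap
    { toFun := fun z => !₂[-(u * conj (z 1)), u * conj (z 0)]
      map_add' := fun z w => by
        ext i; fin_cases i <;> simp <;> ring
      map_smul' := fun r z => by
        ext i; fin_cases i <;> simp <;> ring }

@[simp] theorem quatRot_zero (u : ℂ) (z : C2) : quatRot u z 0 = -(u * conj (z 1)) := rfl

@[simp] theorem quatRot_one (u : ℂ) (z : C2) : quatRot u z 1 = u * conj (z 0) := rfl

theorem quatRot_quatRot {u : ℂ} (hu : ‖u‖ = 1) (z : C2) : quatRot u (quatRot u z) = -z := by
  have h : u * conj u = 1 := by rw [Complex.mul_conj', hu]; simp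
  ext i
  fin_cases i
  · simp only [Fin.zero_eta, quatRot_zero, quatRot_one, map_mul, Complex.conj_conj, PiLp.neg_apply]
    linear_combination -(z 0) * h
  · simp only [Fin.mk_one, quatRot_zero, quatRot_one, map_mul, map_neg, Complex.conj_conj,
      PiLp.neg_apply]
    linear_combination -(z 1) * h

/-- The flow `exp (t J) = cos t + sin t J` of the vector field `J = quatRot u`. -/
def quatFlow (u : ℂ) (t : ℝ) (z : C2) : C2 := Real.cos t • z + Real.sin t • quatRot u z

theorem norm_quatFlow {u : ℂ} (hu : ‖u‖ = 1) (t : ℝ) (z : C2) : ‖quatFlow u t z‖ = ‖z‖ := by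
  refine (sq_eq_sq₀ (norm_nonneg _) (norm_nonneg _)).1 ?_
  rw [norm_sq_C2, norm_sq_C2]
  have h : u.re * u.re + u.im * u.im = 1 := by
    rw [← Complex.normSq_apply, Complex.normSq_eq_norm_sq, hu, one_pow]
  have h2 := Real.sin_sq_add_cos_sq t
  simp only [quatFlow, PiLp.add_apply, PiLp.smul_apply, quatRot_zero, quatRot_one, Complex.real_smul,
    ← Complex.normSq_eq_norm_sq, Complex.normSq_apply, Complex.add_re, Complex.add_im, Complex.mul_re,
    Complex.mul_im, Complex.ofReal_re, Complex.ofReal_im, Complex.neg_re, Complex.neg_im,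
    Complex.conj_re, Complex.conj_im]
  linear_combination ((z 0).re ^ 2 + (z 0).im ^ 2 + (z 1).re ^ 2 + (z 1).im ^ 2) * h2 +
    Real.sin t ^ 2 * ((z 0).re ^ 2 + (z 0).im ^ 2 + (z 1).re ^ 2 + (z 1).im ^ 2) * h

/-- `quatFlow u t` as a linear isometry. -/
def quatFlowIsometry {u : ℂ} (hu : ‖u‖ = 1) (t : ℝ) : C2 →ₗᵢ[ℝ] C2 where
  toFun := quatFlow u t
  map_add' z w := by simp only [quatFlow, map_add]; module
  map_smul' r z := by simp only [quatFlow, map_smul, RingHom.id_apply]; module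
  norm_map' := norm_quatFlow hu t

/-- `quatFlow u t` as a linear isometric automorphism. -/
def quatFlowEquiv {u : ℂ} (hu : ‖u‖ = 1) (t : ℝ) : C2 ≃ₗᵢ[ℝ] C2 :=
  (quatFlowIsometry hu t).toLinearIsometryEquiv rfl

theorem coe_quatFlowEquiv {u : ℂ} (hu : ‖u‖ = 1) (t : ℝ) : ⇑(quatFlowEquiv hu t) = quatFlow u t := rfl

theorem hasDerivAt_quatFlow {u : ℂ} (hu : ‖u‖ = 1) (z : C2) (t : ℝ) :
    HasDerivAt (fun t => quatFlow u t z) (quatRot u (quatFlow u t z)) t := by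
  have h := ((Real.hasDerivAt_cos t).smul_const z).fun_add
    ((Real.hasDerivAt_sin t).smul_const (quatRot u z))
  refine h.congr_deriv ?_
  simp only [quatFlow, map_add, map_smul, quatRot_quatRot hu]
  module

/-- `1 / (4 π² r⁴)` for `r > 1`, and `0` otherwise. -/
def radialWeight (r : ℝ) : ℝ := if 1 < r then 1 / (4 * Real.pi ^ 2 * r ^ 4) else 0

theorem measurable_radialWeight : Measurable radialWeight :=
  Measurable.ite measurableSet_Ioi (by fun_prop) measurable_const

theorem radialWeight_nonneg (r : ℝ) : 0 ≤ radialWeight r := by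
  unfold radialWeight; split_ifs <;> positivity

theorem radialWeight_le_one (r : ℝ) : radialWeight r ≤ 1 := by
  unfold radialWeight
  split_ifs with h
  · refine div_le_one_of_le₀ ?_ (by positivity)
    have h1 : 1 ≤ Real.pi ^ 2 := one_le_pow₀ (by linarith [Real.pi_gt_three])
    have h2 : 1 ≤ r ^ 4 := one_le_pow₀ h.le
    nlinarith
  · exact zero_le_one

theorem integrable_radialWeight_smul {ψ : C2 → ℂ} (hψ : Continuous ψ) (hc : HasCompactSupport ψ) :
    Integrable (fun z => radialWeight ‖z‖ • ψ z) := by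
  have hw : AEStronglyMeasurable (fun z : C2 => radialWeight ‖z‖) volume :=
    (measurable_radialWeight.comp measurable_norm).aestronglyMeasurable
  refine (hψ.integrable_of_hasCompactSupport (μ := volume) hc).bdd_smul 1 hw
    (ae_of_all _ fun z => ?_)
  · rw [Real.norm_of_nonneg (radialWeight_nonneg _)]
    exact radialWeight_le_one _

theorem HasCompactSupport.fderiv_clm_apply {ψ : C2 → ℂ} (hc : HasCompactSupport ψ) (w : C2 → C2) :
    HasCompactSupport fun z => fderiv ℝ ψ z (w z) :=
  (hc.fderiv (𝕜 := ℝ)).mono' fun z hz => subset_tsupport _ fun h => hz (by simp [h])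

/-- The flow of `quatRot u` preserves Lebesgue measure and the norm, so derivatives along it have
mean zero for radial weights. -/
theorem integral_fderiv_quatRot {u : ℂ} (hu : ‖u‖ = 1) {ψ : C2 → ℂ} (hψ : ContDiff ℝ ∞ ψ)
    (hc : HasCompactSupport ψ) :
    ∫ z, radialWeight ‖z‖ • fderiv ℝ ψ z (quatRot u z) = 0 := by
  have hd : Differentiable ℝ ψ := hψ.differentiable (by norm_num)
  have hcont : Continuous fun z => fderiv ℝ ψ z (quatRot u z) :=
    (hψ.continuous_fderiv (by norm_num)).clm_apply (quatRot u).continuous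
  have hX := HasCompactSupport.fderiv_clm_apply hc (quatRot u)
  obtain ⟨M, hM⟩ := hX.exists_bound_of_continuous hcont
  obtain ⟨R, hR⟩ := hX.isCompact.isBounded.subset_closedBall (0 : C2)
  have hconst : ∀ t : ℝ, ∫ z, radialWeight ‖z‖ • ψ (quatFlow u t z) = ∫ z, radialWeight ‖z‖ • ψ z := by
    intro t
    have h := (quatFlowEquiv hu t).measurePreserving.integral_comp
      (quatFlowEquiv hu t).toHomeomorph.measurableEmbedding (fun z => radialWeight ‖z‖ • ψ z)
    simpa only [coe_quatFlowEquiv, norm_quatFlow hu] using h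
  have hF0 : ∀ t : ℝ, Continuous (quatFlow u t) := fun t => (quatFlowEquiv hu t).continuous
  have hw : AEStronglyMeasurable (fun z : C2 => radialWeight ‖z‖) volume :=
    (measurable_radialWeight.comp measurable_norm).aestronglyMeasurable
  have hzero : quatFlow u 0 = id := by funext z; simp [quatFlow]
  -- the integral of `ψ` along the flow is constant in `t`; differentiate it at `t = 0`
  have key := (hasDerivAt_integral_of_dominated_loc_of_deriv_le (μ := (volume : Measure C2))
    (F := fun (t : ℝ) z => radialWeight ‖z‖ • ψ (quatFlow u t z)) (x₀ := 0) (s := Set.univ)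
    (F' := fun t z => radialWeight ‖z‖ • fderiv ℝ ψ (quatFlow u t z) (quatRot u (quatFlow u t z)))
    (bound := (Metric.closedBall (0 : C2) R).indicator fun _ => M) univ_mem
    (Eventually.of_forall fun t => hw.smul (hψ.continuous.comp (hF0 t)).aestronglyMeasurable)
    (by simpa only [hzero, id] using integrable_radialWeight_smul hψ.continuous hc)
    (hw.smul (hcont.comp (hF0 0)).aestronglyMeasurable)
    (ae_of_all _ fun z t _ => ?_) ?_ (ae_of_all _ fun z t _ => ?_)).2
  · simp only [hzero, id] at key
    simp_rw [hconst] at key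
    exact key.unique (hasDerivAt_const _ _)
  · rw [norm_smul, Real.norm_of_nonneg (radialWeight_nonneg _)]
    by_cases hz : z ∈ Metric.closedBall (0 : C2) R
    · rw [Set.indicator_of_mem hz]
      calc _ ≤ 1 * ‖fderiv ℝ ψ (quatFlow u t z) (quatRot u (quatFlow u t z))‖ := by
            gcongr; exact radialWeight_le_one _
        _ ≤ M := by rw [one_mul]; exact hM _
    · rw [Set.indicator_of_notMem hz]
      have h1 : quatFlow u t z ∉ tsupport fun z => fderiv ℝ ψ z (quatRot u z) := by
        intro h
        have h2 := hR h
        rw [mem_closedBall_zero_iff, norm_quatFlow hu] at h2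
        exact hz (mem_closedBall_zero_iff.2 h2)
      have h3 := image_eq_zero_of_notMem_tsupport h1
      rw [h3]
      simp
  · exact (integrable_indicator_iff measurableSet_closedBall).2
      (integrableOn_const (isCompact_closedBall _ _).measure_lt_top.ne)
  · exact ((hd _).hasFDerivAt.comp_hasDerivAt t (hasDerivAt_quatFlow hu z t)).fun_const_smul _

/-- The second derivative of a function, as a bilinear map. -/
def hess (φ : C2 → ℂ) (z v w : C2) : ℂ := fderiv ℝ (fderiv ℝ φ) z v w

/-- On spheres, the second derivative along the flow has the same mean as the radial derivative. -/
theorem integral_hess_quatRot {u : ℂ} (hu : ‖u‖ = 1) {φ : C2 → ℂ} (hφ : ContDiff ℝ ∞ φ)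
    (hc : HasCompactSupport φ) :
    Integrable (fun z => radialWeight ‖z‖ • hess φ z (quatRot u z) (quatRot u z)) ∧
    ∫ z, radialWeight ‖z‖ • hess φ z (quatRot u z) (quatRot u z) =
      ∫ z, radialWeight ‖z‖ • fderiv ℝ φ z z := by
  have hφ1 : ContDiff ℝ ∞ (fderiv ℝ φ) := hφ.fderiv_right (by norm_num)
  have hX : ContDiff ℝ ∞ fun z => fderiv ℝ φ z (quatRot u z) :=
    hφ1.clm_apply (quatRot u).contDiff
  have hXc := HasCompactSupport.fderiv_clm_apply hc (quatRot u)
  have hXX := integral_fderiv_quatRot hu hX hXc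
  -- the second derivative along the linear field `J z` is `D²φ (J z, J z) + Dφ (J² z)`, and `J² = -1`
  have e : ∀ z, fderiv ℝ (fun z => fderiv ℝ φ z (quatRot u z)) z (quatRot u z) =
      hess φ z (quatRot u z) (quatRot u z) - fderiv ℝ φ z z := by
    intro z
    have h := ((hφ1.differentiable (by norm_num)) z).hasFDerivAt.clm_apply
      (quatRot u).hasFDerivAt (x := z)
    rw [h.fderiv]
    simp [hess, quatRot_quatRot hu]
    ring
  have i1 : Integrable fun z => radialWeight ‖z‖ • fderiv ℝ φ z z :=
    integrable_radialWeight_smul (hφ1.continuous.clm_apply continuous_id)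
      (HasCompactSupport.fderiv_clm_apply hc id)
  have i2 : Integrable fun z => radialWeight ‖z‖ •
      fderiv ℝ (fun z => fderiv ℝ φ z (quatRot u z)) z (quatRot u z) :=
    integrable_radialWeight_smul
      ((hX.continuous_fderiv (by norm_num)).clm_apply (quatRot u).continuous)
      (HasCompactSupport.fderiv_clm_apply hXc (quatRot u))
  have e2 : (fun z => radialWeight ‖z‖ • hess φ z (quatRot u z) (quatRot u z)) =
      fun z => radialWeight ‖z‖ • fderiv ℝ (fun z => fderiv ℝ φ z (quatRot u z)) z (quatRot u z) +
        radialWeight ‖z‖ • fderiv ℝ φ z z := by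
    funext z
    rw [e z, ← smul_add, sub_add_cancel]
  rw [e2]
  refine ⟨i2.add i1, ?_⟩
  rw [integral_add i2 i1, hXX, zero_add]

/-! ### The Monge-Ampère measure of `log⁺ ‖·‖` -/

theorem hasFDerivAt_posLog_norm {z : C2} (hz : 1 < ‖z‖) :
    HasFDerivAt (fun w : C2 => ((Real.posLog ‖w‖ : ℝ) : ℂ))
      (Complex.ofRealCLM.comp ((‖z‖ ^ 2)⁻¹ • innerSL ℝ z)) z := by
  have hn : ‖z‖ ^ 2 ≠ 0 := by positivity
  have h1 : HasFDerivAt (fun w : C2 => 1 / 2 * Real.log (‖w‖ ^ 2)) ((‖z‖ ^ 2)⁻¹ • innerSL ℝ z) z := by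
    have h := ((hasStrictFDerivAt_norm_sq z).hasFDerivAt.log hn).const_mul (1 / 2 : ℝ)
    refine h.congr_fderiv ?_
    ext v
    simp
    field_simp
  refine (Complex.ofRealCLM.hasFDerivAt.comp z h1).congr_of_eventuallyEq ?_
  filter_upwards [(isOpen_lt continuous_const continuous_norm).mem_nhds hz] with w hw
  have hw' : (1 : ℝ) ≤ |‖w‖| := by rw [abs_norm]; exact le_of_lt hw
  simp only [Function.comp_apply, Complex.ofRealCLM_apply]
  rw [Real.posLog_eq_log hw', Real.log_pow]
  push_cast
  ring

theorem fderiv_posLog_norm_of_lt {z : C2} (hz : ‖z‖ < 1) :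
    fderiv ℝ (fun w : C2 => ((Real.posLog ‖w‖ : ℝ) : ℂ)) z = 0 := by
  have h : (fun w : C2 => ((Real.posLog ‖w‖ : ℝ) : ℂ)) =ᶠ[𝓝 z] fun _ => 0 := by
    filter_upwards [(isOpen_lt continuous_norm continuous_const).mem_nhds hz] with w hw
    have hw' : |‖w‖| ≤ 1 := by rw [abs_norm]; exact le_of_lt hw
    rw [(Real.posLog_eq_zero_iff _).2 hw', Complex.ofReal_zero]
  rw [h.fderiv_eq]
  simp

theorem dz_posLog_norm {z : C2} (hz : 1 < ‖z‖) (j : Fin 2) :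
    dz j (fun w => ((Real.posLog ‖w‖ : ℝ) : ℂ)) z = conj (z j) / (2 * (‖z‖ : ℂ) ^ 2) ∧
      dzbar j (fun w => ((Real.posLog ‖w‖ : ℝ) : ℂ)) z = z j / (2 * (‖z‖ : ℂ) ^ 2) := by
  have hn : (‖z‖ : ℂ) ≠ 0 := by
    have : ‖z‖ ≠ 0 := by positivity
    exact_mod_cast this
  have e1 : inner ℝ z (EuclideanSpace.single j (1 : ℂ)) = (z j).re := by
    rw [PiLp.inner_apply, Fin.sum_univ_two]
    fin_cases j <;> simp [Complex.inner]
  have e2 : inner ℝ z (EuclideanSpace.single j Complex.I) = (z j).im := by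
    rw [PiLp.inner_apply, Fin.sum_univ_two]
    fin_cases j <;> simp [Complex.inner]
  unfold dz dzbar
  rw [(hasFDerivAt_posLog_norm hz).fderiv]
  simp only [ContinuousLinearMap.comp_apply, smul_apply, innerSL_apply_apply, e1, e2,
    Complex.ofRealCLM_apply, smul_eq_mul]
  push_cast
  constructor
  · have h : conj (z j) = (z j).re - (z j).im * Complex.I := by apply Complex.ext <;> simp
    rw [h]
    field_simp
  · conv_rhs => rw [← Complex.re_add_im (z j)]
    field_simp

theorem dz_dzbar_eq {φ : C2 → ℂ} (hφ : ContDiff ℝ ∞ φ) (z : C2) (j k : Fin 2) :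
    dz j (dzbar k φ) z =
      (hess φ z (EuclideanSpace.single j 1) (EuclideanSpace.single k 1) +
        Complex.I * hess φ z (EuclideanSpace.single j 1) (EuclideanSpace.single k Complex.I) -
        Complex.I * (hess φ z (EuclideanSpace.single j Complex.I) (EuclideanSpace.single k 1) +
          Complex.I * hess φ z (EuclideanSpace.single j Complex.I)
            (EuclideanSpace.single k Complex.I))) / 4 := by
  have hφ1 : ContDiff ℝ ∞ (fderiv ℝ φ) := hφ.fderiv_right (by norm_num)
  have hd : ∀ v : C2, HasFDerivAt (fun w => fderiv ℝ φ w v)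
      ((fderiv ℝ (fderiv ℝ φ) z).flip v) z := by
    intro v
    have h := ((hφ1.differentiable (by norm_num)) z).hasFDerivAt.clm_apply (hasFDerivAt_const v z)
    refine h.congr_fderiv ?_
    ext w
    simp
  have h : HasFDerivAt (dzbar k φ) ((2 : ℂ)⁻¹ •
      ((fderiv ℝ (fderiv ℝ φ) z).flip (EuclideanSpace.single k 1) +
        Complex.I • (fderiv ℝ (fderiv ℝ φ) z).flip (EuclideanSpace.single k Complex.I))) z := by
    have h1 := ((hd (EuclideanSpace.single k 1)).fun_add
      ((hd (EuclideanSpace.single k Complex.I)).fun_const_smul Complex.I)).fun_const_smul (2 : ℂ)⁻¹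
    refine h1.congr_of_eventuallyEq (Eventually.of_forall fun w => ?_)
    simp only [dzbar, smul_eq_mul]
    ring
  unfold dz
  rw [h.fderiv]
  simp only [smul_apply, add_apply, ContinuousLinearMap.flip_apply, smul_eq_mul, hess]
  ring

theorem vec_eq_sum_single (v : C2) :
    v = (v 0).re • EuclideanSpace.single 0 (1 : ℂ) + (v 0).im • EuclideanSpace.single 0 Complex.I +
      ((v 1).re • EuclideanSpace.single 1 (1 : ℂ) + (v 1).im • EuclideanSpace.single 1 Complex.I) := by
  ext i
  fin_cases i <;> simp

/-- The Levi form in the complex direction tangent to the spheres, as a sum of second derivatives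
along the rotations `quatRot 1` and `quatRot i`. -/
theorem levi_eq_hess {φ : C2 → ℂ} (hφ : ContDiff ℝ ∞ φ) (z : C2) :
    4 * (conj (z 0) * z 0 * dz 1 (dzbar 1 φ) z + conj (z 1) * z 1 * dz 0 (dzbar 0 φ) z -
      conj (z 0) * z 1 * dz 1 (dzbar 0 φ) z - conj (z 1) * z 0 * dz 0 (dzbar 1 φ) z) =
    hess φ z (quatRot 1 z) (quatRot 1 z) +
      hess φ z (quatRot Complex.I z) (quatRot Complex.I z) := by
  have hs : ∀ v w, hess φ z v w = hess φ z w v :=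
    (hφ.contDiffAt (x := z)).isSymmSndFDerivAt (by simpa using WithTop.coe_le_coe.2 (le_top (a := (2 : ℕ∞))))
  have hexp : ∀ v w : C2, hess φ z v w =
      (v 0).re * hess φ z (EuclideanSpace.single 0 1) w +
      (v 0).im * hess φ z (EuclideanSpace.single 0 Complex.I) w +
      ((v 1).re * hess φ z (EuclideanSpace.single 1 1) w +
      (v 1).im * hess φ z (EuclideanSpace.single 1 Complex.I) w) := by
    intro v w
    unfold hess
    conv_lhs => rw [vec_eq_sum_single v]
    simp only [map_add, map_smul, add_apply, smul_apply, Complex.real_smul]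
  simp_rw [dz_dzbar_eq hφ]
  rw [hexp (quatRot 1 z), hexp (quatRot Complex.I z)]
  simp only [hs _ (quatRot 1 z), hs _ (quatRot Complex.I z)]
  simp only [hexp (quatRot 1 z), hexp (quatRot Complex.I z)]
  rw [hs (EuclideanSpace.single 0 Complex.I) (EuclideanSpace.single 0 1),
    hs (EuclideanSpace.single 1 1) (EuclideanSpace.single 0 1),
    hs (EuclideanSpace.single 1 1) (EuclideanSpace.single 0 Complex.I),
    hs (EuclideanSpace.single 1 Complex.I) (EuclideanSpace.single 0 1),
    hs (EuclideanSpace.single 1 Complex.I) (EuclideanSpace.single 0 Complex.I),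
    hs (EuclideanSpace.single 1 Complex.I) (EuclideanSpace.single 1 1)]
  generalize hess φ z (EuclideanSpace.single 0 1) (EuclideanSpace.single 0 1) = b1
  generalize hess φ z (EuclideanSpace.single 0 1) (EuclideanSpace.single 0 Complex.I) = b2
  generalize hess φ z (EuclideanSpace.single 0 1) (EuclideanSpace.single 1 1) = b3
  generalize hess φ z (EuclideanSpace.single 0 1) (EuclideanSpace.single 1 Complex.I) = b4
  generalize hess φ z (EuclideanSpace.single 0 Complex.I) (EuclideanSpace.single 0 Complex.I) = b5
  generalize hess φ z (EuclideanSpace.single 0 Complex.I) (EuclideanSpace.single 1 1) = b6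
  generalize hess φ z (EuclideanSpace.single 0 Complex.I) (EuclideanSpace.single 1 Complex.I) = b7
  generalize hess φ z (EuclideanSpace.single 1 1) (EuclideanSpace.single 1 1) = b8
  generalize hess φ z (EuclideanSpace.single 1 1) (EuclideanSpace.single 1 Complex.I) = b9
  generalize hess φ z (EuclideanSpace.single 1 Complex.I) (EuclideanSpace.single 1 Complex.I) = b10
  simp only [quatRot_zero, quatRot_one, one_mul, Complex.neg_re, Complex.neg_im, Complex.conj_re,
    Complex.conj_im, Complex.mul_re, Complex.mul_im, Complex.I_re, Complex.I_im, zero_mul, zero_sub,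
    neg_neg, mul_neg]
  generalize z 0 = z0
  generalize z 1 = z1
  have h0 := Complex.re_add_im z0
  have h1 := Complex.re_add_im z1
  generalize z0.re = x0 at *
  generalize z0.im = y0 at *
  generalize z1.re = x1 at *
  generalize z1.im = y1 at *
  subst h0 h1
  simp only [map_add, map_mul, Complex.conj_ofReal, Complex.conj_I]
  push_cast
  ring_nf
  simp only [Complex.I_sq, Complex.I_pow_four]
  ring_nf

/-- Outside the unit sphere, where `du ∧ d^c u` is a multiple of `∂‖z‖² ∧ ∂̄‖z‖²`, the form
`du ∧ d^c u ∧ dd^c φ` is the Levi form of `φ` in the direction tangent to the spheres. Inside, it is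
zero. -/
theorem wedgeDensity_posLog_norm {φ : C2 → ℂ} (hφ : ContDiff ℝ ∞ φ) {z : C2} (hz : ‖z‖ ≠ 1) :
    wedgeDensity
      (Matrix.of fun j k => dz j (fun w => ((Real.posLog ‖w‖ : ℝ) : ℂ)) z *
        dzbar k (fun w => ((Real.posLog ‖w‖ : ℝ) : ℂ)) z)
      (Matrix.of fun j k => dz j (dzbar k φ) z) =
    radialWeight ‖z‖ • hess φ z (quatRot 1 z) (quatRot 1 z) +
      radialWeight ‖z‖ • hess φ z (quatRot Complex.I z) (quatRot Complex.I z) := by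
  rw [← smul_add, ← levi_eq_hess hφ]
  unfold wedgeDensity radialWeight
  simp only [Matrix.of_apply]
  split_ifs with h
  · have hn : (‖z‖ : ℂ) ≠ 0 := by
      have : ‖z‖ ≠ 0 := by positivity
      exact_mod_cast this
    have hpi : (Real.pi : ℂ) ≠ 0 := by exact_mod_cast Real.pi_ne_zero
    simp only [(dz_posLog_norm h _).1, (dz_posLog_norm h _).2, Complex.real_smul]
    push_cast
    field_simp
    ring
  · have hlt : ‖z‖ < 1 := lt_of_le_of_ne (not_lt.1 h) hz
    have h0 : ∀ j, dz j (fun w => ((Real.posLog ‖w‖ : ℝ) : ℂ)) z = 0 := fun j => by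
      unfold dz
      rw [fderiv_posLog_norm_of_lt hlt]
      simp
    simp [h0]

/-- Integration in polar coordinates. -/
theorem integral_eq_integral_toSphere {g : C2 → ℂ} (hg : Integrable g) :
    ∫ z, g z = ∫ θ, (∫ r in Set.Ioi (0 : ℝ), r ^ 3 • g (r • θ.1))
      ∂(volume : Measure C2).toSphere := by
  have hmp := (volume : Measure C2).measurePreserving_homeomorphUnitSphereProd
  rw [finrank_real_C2] at hmp
  have hemb := (homeomorphUnitSphereProd C2).measurableEmbedding
  have e : ∀ x : ({0}ᶜ : Set C2), g x.1 =
      (fun p : Metric.sphere (0 : C2) 1 × Set.Ioi (0 : ℝ) => g (p.2.1 • p.1.1))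
        (homeomorphUnitSphereProd C2 x) := by
    intro x
    have hx : ‖(x : C2)‖ ≠ 0 := norm_ne_zero_iff.2 x.2
    simp [smul_smul, hx]
  have hi : Integrable (fun x : ({0}ᶜ : Set C2) => g x.1) (Measure.comap Subtype.val volume) := by
    have h := (MeasurableEmbedding.subtype_coe (measurableSet_singleton (0 : C2)).compl)
    exact (h.integrableOn_range_iff_comap (f := g)).1 hg.integrableOn
  have hi2 : Integrable (fun p : Metric.sphere (0 : C2) 1 × Set.Ioi (0 : ℝ) => g (p.2.1 • p.1.1))
      ((volume : Measure C2).toSphere.prod (Measure.volumeIoiPow (4 - 1))) := by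
    rw [← hmp.integrable_comp_emb hemb]
    exact hi.congr (ae_of_all _ e)
  calc ∫ z, g z = ∫ x : ({0}ᶜ : Set C2), g x.1 ∂(Measure.comap Subtype.val volume) := by
        rw [integral_subtype_comap (measurableSet_singleton _).compl g,
          restrict_compl_singleton]
    _ = ∫ p, g (p.2.1 • p.1.1) ∂((volume : Measure C2).toSphere.prod (Measure.volumeIoiPow (4 - 1))) := by
        rw [← hmp.integral_comp hemb]
        exact integral_congr_ae (ae_of_all _ e)
    _ = ∫ θ, (∫ r, g (r.1 • θ.1) ∂(Measure.volumeIoiPow (4 - 1))) ∂(volume : Measure C2).toSphere :=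
        integral_prod _ hi2
    _ = _ := by
        refine integral_congr_ae (ae_of_all _ fun θ => ?_)
        simp only [Measure.volumeIoiPow, ENNReal.ofReal, show 4 - 1 = 3 from rfl]
        rw [integral_withDensity_eq_integral_smul,
          integral_subtype_comap measurableSet_Ioi
            fun r => Real.toNNReal (r ^ 3) • g (r • θ.1),
          setIntegral_congr_fun measurableSet_Ioi fun r hr => ?_]
        · rw [NNReal.smul_def, Real.coe_toNNReal _ (pow_nonneg (le_of_lt hr) _)]
        · exact (measurable_subtype_coe.pow_const _).real_toNNReal

/-- In polar coordinates the weight compensates the Jacobian `r³`, and the radial derivative of `φ`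
over `r > 1` integrates to minus the boundary value on the unit sphere. -/
theorem integral_radialWeight_fderiv {φ : C2 → ℂ} (hφ : ContDiff ℝ ∞ φ) (hc : HasCompactSupport φ) :
    ∫ z, radialWeight ‖z‖ • fderiv ℝ φ z z =
      ∫ θ, (1 / (4 * Real.pi ^ 2)) • -φ θ.1 ∂(volume : Measure C2).toSphere := by
  have hφ1 : ContDiff ℝ ∞ (fderiv ℝ φ) := hφ.fderiv_right (by norm_num)
  have hi : Integrable fun z => radialWeight ‖z‖ • fderiv ℝ φ z z := integrable_radialWeight_smul
    (hφ1.continuous.clm_apply continuous_id) (HasCompactSupport.fderiv_clm_apply hc id)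
  rw [integral_eq_integral_toSphere hi]
  refine integral_congr_ae (ae_of_all _ fun θ => ?_)
  simp only
  have hθ : ‖(θ : C2)‖ = 1 := by simp
  set p : ℝ → ℂ := fun r => φ (r • θ.1) with hp
  have hpd : ContDiff ℝ 1 p :=
    (hφ.of_le (by norm_num)).comp (contDiff_id.smul contDiff_const)
  have hpc : HasCompactSupport p := by
    obtain ⟨R, hR⟩ := hc.isCompact.isBounded.subset_closedBall (0 : C2)
    refine HasCompactSupport.of_support_subset_isCompact (isCompact_closedBall (0 : ℝ) R) fun r hr => ?_
    have h := hR (subset_tsupport _ hr)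
    rwa [mem_closedBall_zero_iff, norm_smul, hθ, mul_one, ← mem_closedBall_zero_iff] at h
  have hder : ∀ r, deriv p r = fderiv ℝ φ (r • θ.1) θ.1 := by
    intro r
    have h1 : HasDerivAt (fun r : ℝ => r • θ.1) θ.1 r := by
      simpa using (hasDerivAt_id r).smul_const θ.1
    exact (((hφ.differentiable (by norm_num)) _).hasFDerivAt.comp_hasDerivAt r h1).deriv
  have e : ∀ r ∈ Set.Ioi (0 : ℝ), r ^ 3 • radialWeight ‖r • θ.1‖ • fderiv ℝ φ (r • θ.1) (r • θ.1) =
      (Set.Ioi (1 : ℝ)).indicator (fun r => (1 / (4 * Real.pi ^ 2)) • deriv p r) r := by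
    intro r hr
    have hr0 : (0 : ℝ) < r := hr
    rw [norm_smul, hθ, mul_one, Real.norm_of_nonneg hr0.le, map_smul, smul_smul, smul_smul]
    simp only [hder]
    unfold radialWeight
    by_cases h : 1 < r
    · rw [if_pos h, Set.indicator_of_mem (Set.mem_Ioi.2 h)]
      congr 1
      have := Real.pi_ne_zero
      field_simp
    · rw [if_neg h, Set.indicator_of_notMem (by simpa using h)]
      simp
  rw [setIntegral_congr_fun measurableSet_Ioi e, setIntegral_indicator measurableSet_Ioi]
  have hset : Set.Ioi (0 : ℝ) ∩ Set.Ioi 1 = Set.Ioi 1 := by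
    rw [Set.Ioi_inter_Ioi]; simp
  rw [hset, integral_smul, hpc.integral_Ioi_deriv_eq hpd]
  simp [hp]

/-- The rotation-invariant probability measure of the unit sphere, on `ℂ²`. -/
def sphereMeasureC2 : Measure C2 := sphereMeasure.map Subtype.val

/-- The Monge-Ampère measure of `log⁺ ‖·‖` is the normalized surface measure of the unit sphere. The
integral of `du ∧ d^c u ∧ dd^c φ` is that of second derivatives of `φ` along rotations; these may be
replaced by radial derivatives, whose integral is the mean of `-φ` on the sphere. -/
theorem isMongeAmpere_sphereMeasureC2 :
    IsMongeAmpere (fun z => Real.posLog ‖z‖) sphereMeasureC2 := by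
  have : IsFiniteMeasure sphereMeasureC2 := by unfold sphereMeasureC2; infer_instance
  refine ⟨inferInstance, fun φ hφ hc => ?_⟩
  -- `log⁺ ‖·‖` is not differentiable on the unit sphere, which is negligible
  have hsph : ∀ᵐ z : C2, ‖z‖ ≠ 1 := by
    have h := Measure.addHaar_sphere (volume : Measure C2) 0 1
    rw [measure_eq_zero_iff_ae_notMem] at h
    filter_upwards [h] with z hz
    simpa using hz
  obtain ⟨i1, e1⟩ := integral_hess_quatRot (u := 1) (by simp) hφ hc
  obtain ⟨i2, e2⟩ := integral_hess_quatRot (u := Complex.I) (by simp) hφ hc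
  rw [integral_congr_ae (hsph.mono fun z hz => wedgeDensity_posLog_norm hφ hz),
    integral_add i1 i2, e1, e2, integral_radialWeight_fderiv hφ hc, sphereMeasureC2,
    integral_map measurable_subtype_coe.aemeasurable hφ.continuous.aestronglyMeasurable,
    sphereMeasure, integral_smul_measure, integral_smul, integral_neg,
    ENNReal.toReal_ofReal (by positivity)]
  rw [← add_smul, ← smul_neg, neg_neg]
  congr 1
  have := Real.pi_ne_zero
  field_simp
  norm_num

/-! ### Uniqueness of the Monge-Ampère measure -/

/-- Smooth functions increasing to the indicator of a bounded open set. -/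
theorem measureReal_eq_of_integral_contDiff_eq {μ ν : Measure C2} [IsFiniteMeasureOnCompacts μ]
    [IsFiniteMeasureOnCompacts ν]
    (h : ∀ φ : C2 → ℂ, ContDiff ℝ ∞ φ → HasCompactSupport φ → ∫ z, φ z ∂μ = ∫ z, φ z ∂ν)
    {U : Set C2} (hU : IsOpen U) (hb : Bornology.IsBounded U) : μ.real U = ν.real U := by
  obtain ⟨f, hsupp, hf, hrange⟩ := hU.exists_contDiff_support_eq (n := ⊤)
  set φ : ℕ → C2 → ℂ := fun n z => (Real.smoothTransition (n * f z) : ℂ) with hφ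
  have hf0 : ∀ z, 0 ≤ f z := fun z => (hrange (Set.mem_range_self z)).1
  have hsm : ∀ n, ContDiff ℝ ∞ (φ n) := fun n =>
    Complex.ofRealCLM.contDiff.comp (Real.smoothTransition.contDiff.comp (contDiff_const.mul hf))
  have hzero : ∀ n, ∀ z ∉ U, φ n z = 0 := by
    intro n z hz
    rw [← hsupp, Function.notMem_support] at hz
    simp [hφ, hz]
  have hcs : ∀ n, HasCompactSupport (φ n) := by
    intro n
    refine HasCompactSupport.intro hb.isCompact_closure fun z hz => hzero n z fun h => hz ?_
    exact subset_closure h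
  have hlim : ∀ z, Tendsto (fun n => φ n z) atTop (𝓝 (U.indicator (fun _ => 1) z)) := by
    intro z
    by_cases hz : z ∈ U
    · rw [Set.indicator_of_mem hz]
      have hpos : 0 < f z := by
        refine lt_of_le_of_ne (hf0 z) fun h => ?_
        rw [← hsupp, Function.mem_support] at hz
        exact hz h.symm
      obtain ⟨N, hN⟩ := exists_nat_gt (1 / f z)
      refine tendsto_const_nhds.congr' ?_
      filter_upwards [eventually_ge_atTop N] with n hn
      have h1 : 1 ≤ n * f z := by
        rw [div_lt_iff₀ hpos] at hN
        have : (N : ℝ) ≤ n := by exact_mod_cast hn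
        nlinarith
      simp [hφ, Real.smoothTransition.one_of_one_le h1]
    · rw [Set.indicator_of_notMem hz]
      simp only [hzero _ z hz]
      exact tendsto_const_nhds
  have key : ∀ (ρ : Measure C2) [IsFiniteMeasureOnCompacts ρ],
      Tendsto (fun n => ∫ z, φ n z ∂ρ) atTop (𝓝 (ρ.real U : ℂ)) := by
    intro ρ _
    have hfin : ρ U < ⊤ := lt_of_le_of_lt (measure_mono subset_closure)
      hb.isCompact_closure.measure_lt_top
    have e : ∫ z, U.indicator (fun _ => (1 : ℂ)) z ∂ρ = (ρ.real U : ℂ) := by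
      rw [integral_indicator_const _ hU.measurableSet]
      simp
    rw [← e]
    refine tendsto_integral_of_dominated_convergence (U.indicator fun _ => (1 : ℝ))
      (fun n => (hsm n).continuous.aestronglyMeasurable)
      ((integrable_indicator_iff hU.measurableSet).2 (integrableOn_const hfin.ne))
      (fun n => ae_of_all _ fun z => ?_) (ae_of_all _ hlim)
    by_cases hz : z ∈ U
    · rw [Set.indicator_of_mem hz, hφ, Complex.norm_real,
        Real.norm_of_nonneg (Real.smoothTransition.nonneg _)]
      exact Real.smoothTransition.le_one _
    · rw [Set.indicator_of_notMem hz, hzero n z hz, norm_zero]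
  have h1 := key μ
  simp_rw [fun n => h (φ n) (hsm n) (hcs n)] at h1
  exact_mod_cast tendsto_nhds_unique h1 (key ν)

/-- A Radon measure on `ℂ²` is determined by its values on test functions. -/
theorem measure_eq_of_integral_contDiff_eq {μ ν : Measure C2} [IsFiniteMeasureOnCompacts μ]
    [IsFiniteMeasureOnCompacts ν]
    (h : ∀ φ : C2 → ℂ, ContDiff ℝ ∞ φ → HasCompactSupport φ → ∫ z, φ z ∂μ = ∫ z, φ z ∂ν) :
    μ = ν := by
  have hfin : ∀ (ρ : Measure C2) [IsFiniteMeasureOnCompacts ρ] {U : Set C2},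
      Bornology.IsBounded U → ρ U ≠ ⊤ := fun ρ _ U hb =>
    (lt_of_le_of_lt (measure_mono subset_closure) hb.isCompact_closure.measure_lt_top).ne
  refine Measure.ext_of_generateFrom_of_iUnion {U : Set C2 | IsOpen U ∧ Bornology.IsBounded U}
    (fun n : ℕ => Metric.ball 0 n) ?_ ?_ (Metric.iUnion_ball_nat 0)
    (fun n => ⟨Metric.isOpen_ball, Metric.isBounded_ball⟩) (fun n => hfin μ Metric.isBounded_ball) ?_
  · refine le_antisymm ?_ (MeasurableSpace.generateFrom_le fun U hU => hU.1.measurableSet)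
    rw [BorelSpace.measurable_eq (α := C2)]
    refine MeasurableSpace.generateFrom_le fun U (hU : IsOpen U) => ?_
    have e : U = ⋃ n : ℕ, U ∩ Metric.ball 0 n := by
      rw [← Set.inter_iUnion, Metric.iUnion_ball_nat, Set.inter_univ]
    rw [e]
    refine MeasurableSet.iUnion fun n => MeasurableSpace.measurableSet_generateFrom ?_
    exact ⟨hU.inter Metric.isOpen_ball, Metric.isBounded_ball.subset Set.inter_subset_right⟩
  · exact fun U hU V hV _ => ⟨hU.1.inter hV.1, hU.2.subset Set.inter_subset_left⟩
  · intro U hU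
    have := measureReal_eq_of_integral_contDiff_eq h hU.1 hU.2
    rwa [measureReal_def, measureReal_def, ENNReal.toReal_eq_toReal_iff' (hfin μ hU.2) (hfin ν hU.2)]
      at this

theorem IsMongeAmpere.unique {u : C2 → ℝ} {μ ν : Measure C2} (hμ : IsMongeAmpere u μ)
    (hν : IsMongeAmpere u ν) : μ = ν := by
  have := hμ.1
  have := hν.1
  exact measure_eq_of_integral_contDiff_eq fun φ h1 h2 => (hμ.2 φ h1 h2).trans (hν.2 φ h1 h2).symm

theorem isMongeAmpere_logNormMeasure :
    IsMongeAmpere (fun z => Real.posLog ‖z‖) logNormMeasure := by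
  have h : ∃ μ, IsMongeAmpere (fun z => Real.posLog ‖z‖) μ := ⟨_, isMongeAmpere_sphereMeasureC2⟩
  unfold logNormMeasure
  rw [dif_pos h]
  exact h.choose_spec

theorem logNormMeasure_eq : logNormMeasure = sphereMeasureC2 :=
  isMongeAmpere_logNormMeasure.unique isMongeAmpere_sphereMeasureC2

/-- The value at `[v]` of the norm `‖J_F‖₀`, which is computed at a representative of `[v]`, may be
computed at `v`, as `det F'` is homogeneous of degree `2 d - 2`. -/
theorem normJac_sphereProj (hd : 2 ≤ d) (hF : ∀ i, (F i).IsHomogeneous d)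
    (v : Metric.sphere (0 : C2) 1) : normJac d F (sphereProj v) = ‖jacDet F v.1‖ := by
  have hv : ‖v.1‖ = 1 := by simp
  have h := apply_rep_mk
    (Φ := fun v => Real.exp (-(2 * ((d : ℝ) - 1)) * Real.log ‖v‖) * ‖jacDet F v‖)
    (fun a ha w hw => ?_) v.1 (ne_zero_of_mem_sphere v.2)
  · refine h.trans ?_
    simp only [hv, Real.log_one, mul_zero, Real.exp_zero, one_mul]
  · have h1 : jacDet F (a • w) = a ^ (2 * d - 2) * jacDet F w :=
      eval_smul_of_isHomogeneous (isHomogeneous_jacPoly hF) a w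
    have h2 : 0 < ‖a‖ := norm_pos_iff.2 ha
    have h3 := norm_ne_zero_iff.2 hw
    have h4 : Real.exp (-(2 * ((d : ℝ) - 1)) * Real.log ‖a‖) = (‖a‖ ^ (2 * d - 2))⁻¹ := by
      have e : (2 * ((d : ℝ) - 1)) = ((2 * d - 2 : ℕ) : ℝ) := by
        rw [Nat.cast_sub (by omega)]; push_cast; ring
      rw [e, neg_mul, Real.exp_neg, Real.exp_nat_mul, Real.exp_log h2]
    rw [h1, norm_smul, Real.log_mul h2.ne' h3, mul_add, Real.exp_add, h4, norm_mul, norm_pow]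
    field_simp

/-- On the unit sphere the canonical norm of `J_F` is `|det F'|`. -/
theorem integral_log_jacDet (hd : 2 ≤ d) (hF : ∀ i, (F i).IsHomogeneous d)
    (hi : Integrable (fun x => Real.log (normJac d F x)) fubiniStudy) :
    Integrable (fun z => Real.log ‖jacDet F z‖) logNormMeasure ∧
      ∫ z, Real.log ‖jacDet F z‖ ∂logNormMeasure =
        ∫ x, Real.log (normJac d F x) ∂fubiniStudy := by
  have hm : Measurable fun z => Real.log ‖jacDet F z‖ :=
    Real.measurable_log.comp (contDiff_eval (jacPoly F)).continuous.norm.measurable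
  have hp := continuous_sphereProj.measurable
  rw [← map_sphereProj] at hi ⊢
  have hi' := hi.comp_measurable hp
  have e : (fun x => Real.log (normJac d F x)) ∘ sphereProj =
      (fun z => Real.log ‖jacDet F z‖) ∘ Subtype.val := by
    funext v
    simp only [Function.comp_apply]
    rw [normJac_sphereProj hd hF]
  rw [e] at hi'
  rw [logNormMeasure_eq, sphereMeasureC2]
  refine ⟨(integrable_map_measure hm.aestronglyMeasurable
    measurable_subtype_coe.aemeasurable).2 hi', ?_⟩
  rw [integral_map measurable_subtype_coe.aemeasurable hm.aestronglyMeasurable,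
    integral_map hp.aemeasurable hi.aestronglyMeasurable]
  exact integral_congr_ae (ae_of_all _ fun v => (congrFun e v).symm)

end RatLyap

end

open RatLyap in
theorem mainTheorem8 (d : ℕ) (hd : 2 ≤ d) (f : P1 → P1)
    (F : Fin 2 → MvPolynomial (Fin 2) ℂ) (hF : IsLift d F f) :
    -- the measures `μ_f` and `m` exist, and all the integrals below converge
    IsGreenMeasure d F (greenMeasure d F) ∧
    IsMongeAmpere (fun z => Real.posLog ‖z‖) logNormMeasure ∧
    Integrable (fun x => Real.log (sphericalDeriv f x)) (greenMeasure d F) ∧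
    Integrable (greenFunP1 d F) (critCurrent F) ∧
    Integrable (greenFunP1 d F) (greenMeasure d F + fubiniStudy) ∧
    Integrable (fun x => Real.log (normJac d F x)) fubiniStudy ∧
    Integrable (fun z => Real.log ‖jacDet F z‖) logNormMeasure ∧
    -- (i)
    lyapunovExponent f (greenMeasure d F) + Real.log d =
      (∫ x, greenFunP1 d F x ∂(critCurrent F)) -
        2 * ((d : ℝ) - 1) * (∫ x, greenFunP1 d F x ∂(greenMeasure d F + fubiniStudy)) +
        ∫ x, Real.log (normJac d F x) ∂fubiniStudy ∧
    -- (ii)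
    lyapunovExponent f (greenMeasure d F) + Real.log d =
      (∫ x, greenFunP1 d F x ∂(critCurrent F)) -
        2 * ((d : ℝ) - 1) * (∫ x, greenFunP1 d F x ∂(greenMeasure d F + fubiniStudy)) +
        ∫ z, Real.log ‖jacDet F z‖ ∂logNormMeasure ∧
    -- (iii)
    ∀ c : Fin (2 * d - 2) → C2, (∀ z : C2, jacDet F z = ∏ j, wedge (c j) z) →
      lyapunovExponent f (greenMeasure d F) + Real.log d =
        (∑ j, greenFun d F (c j)) -
          ((d : ℝ) - 1) *
            (1 + 2 * ∫ x, greenFunP1 d F x ∂(greenMeasure d F + fubiniStudy)) := by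
  obtain ⟨c, hc⟩ := hF.exists_jacDet_eq_prod hd
  have hcr := hF.isCritical hd hc
  have hμ := hF.isGreenMeasure hd
  have := hμ.isProbabilityMeasure
  have hg := hF.continuous_greenFunP1 hd
  obtain ⟨hL, eL⟩ := hcr.lyapunovExponent_eq hF hd hμ
  obtain ⟨hC, eC⟩ := hcr.integral_greenFunP1 hF hd
  obtain ⟨hJ, eJ⟩ := hcr.integral_log_normJac hd
  obtain ⟨hm, em⟩ := integral_log_jacDet hd hF.homogeneous hJ
  have hi : lyapunovExponent f (greenMeasure d F) + Real.log d =
      (∫ x, greenFunP1 d F x ∂(critCurrent F)) -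
        2 * ((d : ℝ) - 1) * (∫ x, greenFunP1 d F x ∂(greenMeasure d F + fubiniStudy)) +
        ∫ x, Real.log (normJac d F x) ∂fubiniStudy := by
    rw [eL, eC, eJ, Finset.sum_sub_distrib]
    ring
  refine ⟨hμ, isMongeAmpere_logNormMeasure, hL, hC, Continuous.integrable_P1 hg _, hJ, hm, hi, ?_,
    fun c hc => ((hF.isCritical hd hc).lyapunovExponent_eq hF hd hμ).2⟩
  rw [em]
  exact hi
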